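/- **Setting.** Fix real parameters $a_1,a_2,b_1,\lambda_1,\dots,\lambda_4,K$. For $\gamma\in(0,1)$, $\delta>0$ put $\beta_1=\frac13-b_1$, $\alpha_1=\frac1{2\delta}-a_1$, $\alpha_2=\frac1{3\delta^2}-a_2$, $\beta_2=a_2+\frac\gamma\delta$, $a=\gamma((1-\lambda_2)\alpha_2-(1-\lambda_1)\beta_1)$, $b=\gamma(1-\lambda_2)\alpha_1$ and, for $U=(\eta_1,\eta_2,v_1,v_2)\in\mathbb R^4$, $$\mathcal A_0=\begin{pmatrix}0&0&1&0\\0&0&0&\frac1\delta\\1&1&0&0\\\gamma&1&0&0\end{pmatrix},\quad \mathcal A_1=\begin{pmatrix}0&0&-\lambda_1\beta_1&-\lambda_2\alpha_1\\0&0&0&-\lambda_2\frac{\alpha_2}\delta\\-\lambda_3b_1-\lambda_4\gamma a_1&-\lambda_3b_1-\lambda_4a_1&0&0\\-\lambda_4\gamma\beta_2-\lambda_3\frac\gamma2&-\lambda_4\beta_2-\lambda_3\frac\gamma2&0&0\end{pmatrix},$$ $$\mathcal A_2=\begin{pmatrix}(1-\lambda_1)\beta_1&\delta(1-\lambda_2)\alpha_1&0&0\\0&(1-\lambda_2)\alpha_2&0&0\\0&0&(1-\lambda_3)b_1&(1-\lambda_4)a_1\\0&0&(1-\lambda_3)\frac\gamma2&(1-\lambda_4)\beta_2\end{pmatrix},\quad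 \mathcal A(U)=\begin{pmatrix}v_1&0&\eta_1&0\\0&v_2&0&\eta_2\\0&0&v_1&0\\0&0&0&v_2\end{pmatrix},$$ $$S_0=\begin{pmatrix}\gamma&\gamma&0&0\\\gamma&1&0&0\\0&0&\gamma&0\\0&0&0&\frac1\delta\end{pmatrix},\quad S_1(U)=\begin{pmatrix}0&0&\gamma v_1&0\\0&0&0&v_2\\\gamma v_1&0&\gamma\eta_1&0\\0&v_2&0&\eta_2\end{pmatrix},$$ $$\tilde S_2=\begin{pmatrix}a+(\delta-1+\gamma)b&0&0&0\\a+\delta b&0&0&0\\0&0&a+(\delta-1)b+\gamma(b_1\lambda_3-\lambda_1\beta_1)&b+\gamma\lambda_4a_1\\0&0&\gamma(\frac{\lambda_3}{2\delta}-\lambda_2\alpha_1)&\frac{\lambda_4\beta_2-\lambda_2\alpha_2}\delta\end{pmatrix}+K S_0,$$ $S_2=S_0\mathcal A_2+\tilde S_2$, $\Sigma_0=S_0\mathcal A_0$, $\Sigma_1(U)=S_1(U)\mathcal A_0+S_0\mathcal A(U)$, $\Sigma_2=S_0\mathcal A_1+\tilde S_2\mathcal A_0$. The symmetric Boussinesq/Boussinesq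 system for $U(t,x)\in\mathbb R^4$, $x\in\mathbb R$, is $$\big(S_0+\epsilon(S_1(U)-S_2\partial_x^2)\big)\partial_tU+\big(\Sigma_0+\epsilon(\Sigma_1(U)-\Sigma_2\partial_x^2)\big)\partial_xU=0.\tag{1}$$ Fix $0<\gamma_{\min}\le\gamma_{\max}<1$ and $0<\delta_{\min}\le\delta_{\max}<\infty$, and assume that $K$ is so large that $S_2$ is positive definite for all $(\gamma,\delta)\in[\gamma_{\min},\gamma_{\max}]\times[\delta_{\min},\delta_{\max}]$. For $r\ge1$ write $H^r=H^r(\mathbb R;\mathbb R^4)$ and let $H^r_\epsilon$ be $H^r$ with the norm $|U|_{H^r_\epsilon}^2=|U|_{H^{r-1}}^2+\epsilon|U|_{H^r}^2$. **Proposition.** Let $s>3/2$. There is a positive function $C_0=C_0\big(\frac1{\gamma(1-\gamma)},\delta+\frac1\delta\big)$, nondecreasing in each argument (and depending otherwise only on $s$ and on the parameters and bounds fixed above), such that for all $\gamma\in[\gamma_{\min},\gamma_{\max}]$, $\delta\in[\delta_{\min},\delta_{\max}]$ and all $U^0\in H^{s+1}$ there is $T>0$, independent of $\epsilon$, with the following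 property. For every $\epsilon\in(0,1]$ with $\epsilon\,C_0|U^0|_{H^{s+1}_\epsilon}\le1$ one has $C_0|U^0|_{H^{s+1}_\epsilon}T<1$, and there is a unique $$U\in C^0([0,T/\epsilon);H^{s+1}_\epsilon)\cap C^1([0,T/\epsilon);H^s_\epsilon)$$ that solves (1) (at each time, in the sense of distributions in $x$) with $U|_{t=0}=U^0$. Moreover, for every $t\in[0,T/\epsilon]$, $$|U|_{L^\infty([0,t];H^{s+1}_\epsilon)}+|\partial_tU|_{L^\infty([0,t];H^s_\epsilon)}\le C_0\,\frac{|U^0|_{H^{s+1}_\epsilon}}{1-C_0|U^0|_{H^{s+1}_\epsilon}\,\epsilon t},$$ where for $t=T/\epsilon$ the suprema are over $[0,T/\epsilon)$. -/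

import Mathlib

open MeasureTheory Filter Topology Set
open scoped FourierTransform ENNReal ContDiff Matrix

noncomputable section

namespace SymBoussinesq

/-! ### The system -/

/-- The free parameters of the family of symmetric Boussinesq/Boussinesq models: `a₁, a₂, b₁` come
from the change of variables, `l₁, …, l₄` are the parameters `λ₁, …, λ₄` of the BBM trick, and `K`
is the multiple of `S₀` that is added to `S̃₂`. -/
structure Params where
  a₁ : ℝ
  a₂ : ℝ
  b₁ : ℝ
  l₁ : ℝ
  l₂ : ℝ
  l₃ : ℝ
  l₄ : ℝ
  K : ℝ

namespace Params

def β₁ (p : Params) : ℝ := 1 / 3 - p.b₁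

def α₁ (p : Params) (δ : ℝ) : ℝ := 1 / (2 * δ) - p.a₁

def α₂ (p : Params) (δ : ℝ) : ℝ := 1 / (3 * δ ^ 2) - p.a₂

def β₂ (p : Params) (γ δ : ℝ) : ℝ := p.a₂ + γ / δ

end Params

/-- `𝒜₀` -/
def A0 (γ δ : ℝ) : Matrix (Fin 4) (Fin 4) ℝ :=
  !![0, 0, 1, 0;
     0, 0, 0, 1 / δ;
     1, 1, 0, 0;
     γ, 1, 0, 0]

/-- `𝒜₁` -/
def A1 (p : Params) (γ δ : ℝ) : Matrix (Fin 4) (Fin 4) ℝ :=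
  !![0, 0, -p.l₁ * p.β₁, -p.l₂ * p.α₁ δ;
     0, 0, 0, -p.l₂ * (p.α₂ δ / δ);
     -p.l₃ * p.b₁ - p.l₄ * γ * p.a₁, -p.l₃ * p.b₁ - p.l₄ * p.a₁, 0, 0;
     -p.l₄ * γ * p.β₂ γ δ - p.l₃ * (γ / 2), -p.l₄ * p.β₂ γ δ - p.l₃ * (γ / 2), 0, 0]

/-- `𝒜₂` -/
def A2 (p : Params) (γ δ : ℝ) : Matrix (Fin 4) (Fin 4) ℝ :=
  !![(1 - p.l₁) * p.β₁, δ * (1 - p.l₂) * p.α₁ δ, 0, 0;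
     0, (1 - p.l₂) * p.α₂ δ, 0, 0;
     0, 0, (1 - p.l₃) * p.b₁, (1 - p.l₄) * p.a₁;
     0, 0, (1 - p.l₃) * (γ / 2), (1 - p.l₄) * p.β₂ γ δ]

/-- `𝒜(U)`, where `u = (η₁, η₂, v₁, v₂)`. -/
def A (u : Fin 4 → ℝ) : Matrix (Fin 4) (Fin 4) ℝ :=
  !![u 2, 0, u 0, 0;
     0, u 3, 0, u 1;
     0, 0, u 2, 0;
     0, 0, 0, u 3]

/-- `S₀` -/
def S0 (γ δ : ℝ) : Matrix (Fin 4) (Fin 4) ℝ :=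
  !![γ, γ, 0, 0;
     γ, 1, 0, 0;
     0, 0, γ, 0;
     0, 0, 0, 1 / δ]

/-- `S₁(U)`, where `u = (η₁, η₂, v₁, v₂)`. -/
def S1 (γ : ℝ) (u : Fin 4 → ℝ) : Matrix (Fin 4) (Fin 4) ℝ :=
  !![0, 0, γ * u 2, 0;
     0, 0, 0, u 3;
     γ * u 2, 0, γ * u 0, 0;
     0, u 3, 0, u 1]

/-- The scalar `a` in the definition of `S̃₂`. -/
def aCoef (p : Params) (γ δ : ℝ) : ℝ :=
  γ * ((1 - p.l₂) * p.α₂ δ - (1 - p.l₁) * p.β₁)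

/-- The scalar `b` in the definition of `S̃₂`. -/
def bCoef (p : Params) (γ δ : ℝ) : ℝ := γ * (1 - p.l₂) * p.α₁ δ

/-- `S̃₂ + K S₀` -/
def S2tilde (p : Params) (γ δ : ℝ) : Matrix (Fin 4) (Fin 4) ℝ :=
  !![aCoef p γ δ + (δ - 1 + γ) * bCoef p γ δ, 0, 0, 0;
     aCoef p γ δ + δ * bCoef p γ δ, 0, 0, 0;
     0, 0, aCoef p γ δ + (δ - 1) * bCoef p γ δ + γ * (p.b₁ * p.l₃ - p.l₁ * p.β₁),
       bCoef p γ δ + γ * p.l₄ * p.a₁;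
     0, 0, γ * (p.l₃ / (2 * δ) - p.l₂ * p.α₁ δ), (p.l₄ * p.β₂ γ δ - p.l₂ * p.α₂ δ) / δ]
    + p.K • S0 γ δ

/-- `S₂` -/
def S2 (p : Params) (γ δ : ℝ) : Matrix (Fin 4) (Fin 4) ℝ :=
  S0 γ δ * A2 p γ δ + S2tilde p γ δ

/-- `Σ₀` -/
def Sig0 (γ δ : ℝ) : Matrix (Fin 4) (Fin 4) ℝ := S0 γ δ * A0 γ δ

/-- `Σ₁(U)` -/
def Sig1 (γ δ : ℝ) (u : Fin 4 → ℝ) : Matrix (Fin 4) (Fin 4) ℝ :=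
  S1 γ u * A0 γ δ + S0 γ δ * A u

/-- `Σ₂` -/
def Sig2 (p : Params) (γ δ : ℝ) : Matrix (Fin 4) (Fin 4) ℝ :=
  S0 γ δ * A1 p γ δ + S2tilde p γ δ * A0 γ δ

/-! ### Sobolev spaces of nonnegative order for functions `ℝ → ℝ⁴` -/

/-- `L²(ℝ; ℝ)⁴`; all Sobolev spaces below are subspaces of it. -/
abbrev State : Type := Fin 4 → Lp ℝ 2 (volume : Measure ℝ)

/-- The value of (a representative of) `U` at `x`. -/
def State.eval (U : State) (x : ℝ) : Fin 4 → ℝ := fun i => U i x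

/-- The Fourier transform on `L²`. -/
def fourierL2 (u : Lp ℝ 2 (volume : Measure ℝ)) : Lp ℂ 2 (volume : Measure ℝ) :=
  𝓕 (Complex.ofRealCLM.compLp u)

/-- The square `|U|²_{H^r}` of the Sobolev norm, `r ≥ 0`; it is `∞` if `U ∉ H^r`. The frequency
variable is `2πξ` because of the normalization `e^{-2πixξ}` of the Fourier transform, so this is
`|(1 - ∂ₓ²)^{r/2} U|²_{L²}`. -/
def sobolevSq (r : ℝ) (U : State) : ℝ≥0∞ :=
  ∑ i, ∫⁻ ξ : ℝ, ENNReal.ofReal ((1 + (2 * Real.pi * ξ) ^ 2) ^ r) * ‖fourierL2 (U i) ξ‖ₑ ^ 2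

/-- `U ∈ H^r`, `r ≥ 0`. -/
def MemHs (r : ℝ) (U : State) : Prop := sobolevSq r U < ⊤

/-- The norm `|U|_{H^r_ε}`, where `|U|²_{H^r_ε} = |U|²_{H^{r-1}} + ε |U|²_{H^r}`. -/
def epsNorm (ε r : ℝ) (U : State) : ℝ≥0∞ :=
  (sobolevSq (r - 1) U + ENNReal.ofReal ε * sobolevSq r U) ^ (1 / 2 : ℝ)

/-! ### Functions of time with values in `H^r_ε` -/

/-- `U ∈ C⁰(I; H^r_ε)` -/
def IsC0 (ε r : ℝ) (I : Set ℝ) (U : ℝ → State) : Prop :=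
  ∀ t ∈ I, MemHs r (U t) ∧
    Tendsto (fun τ => epsNorm ε r (U τ - U t)) (𝓝[I] t) (𝓝 0)

/-- `V` is the derivative of `U` on `I`, in the norm of `H^r_ε` (one-sided at an end point). -/
def IsTimeDeriv (ε r : ℝ) (I : Set ℝ) (U V : ℝ → State) : Prop :=
  ∀ t ∈ I, Tendsto (fun τ => epsNorm ε r ((τ - t)⁻¹ • (U τ - U t) - V t)) (𝓝[I \ {t}] t) (𝓝 0)

/-- `|U|_{L^∞(I; H^r_ε)}` -/
def supNorm (ε r : ℝ) (I : Set ℝ) (U : ℝ → State) : ℝ≥0∞ := ⨆ t ∈ I, epsNorm ε r (U t)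

/-! ### Solutions -/

/-- Test functions `φ ∈ C_c^∞(ℝ)`. -/
def IsTest (φ : ℝ → ℝ) : Prop := ContDiff ℝ ∞ φ ∧ HasCompactSupport φ

/-- `W = ∂ₓ U` in the sense of distributions. -/
def IsWeakDeriv (U W : State) : Prop :=
  ∀ φ, IsTest φ → ∀ i, ∫ x, U i x * deriv φ x = -∫ x, W i x * φ x

/-- For `V = ∂ₜU` and `W = ∂ₓU` (at a fixed time), the equation
`(S₀ + ε (S₁(U) - S₂ ∂ₓ²)) V + (Σ₀ + ε (Σ₁(U) - Σ₂ ∂ₓ²)) W = 0` in the sense of distributions. -/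
def Equation (p : Params) (γ δ ε : ℝ) (U V W : State) : Prop :=
  ∀ φ, IsTest φ → ∀ i,
    ∫ x, (((S0 γ δ + ε • S1 γ (U.eval x)) *ᵥ V.eval x
            + (Sig0 γ δ + ε • Sig1 γ δ (U.eval x)) *ᵥ W.eval x) i * φ x
          - ε * (S2 p γ δ *ᵥ V.eval x + Sig2 p γ δ *ᵥ W.eval x) i * deriv (deriv φ) x) = 0

/-- `U ∈ C⁰([0,T'); H^{s+1}_ε) ∩ C¹([0,T'); H^s_ε)`, with time derivative `V`, solves the Cauchy
problem for the symmetric Boussinesq/Boussinesq system with initial datum `U⁰`. -/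
structure IsSolution (p : Params) (γ δ ε s T' : ℝ) (U0 : State) (U V : ℝ → State) : Prop where
  cont : IsC0 ε (s + 1) (Ico 0 T') U
  cont_deriv : IsC0 ε s (Ico 0 T') V
  hasDeriv : IsTimeDeriv ε s (Ico 0 T') U V
  initial : U 0 = U0
  equation : ∀ t ∈ Ico 0 T', ∃ W, IsWeakDeriv (U t) W ∧ Equation p γ δ ε (U t) (V t) W

end SymBoussinesq

end

open SymBoussinesq

open MeasureTheory Filter Topology Set
open scoped FourierTransform ENNReal ContDiff Matrix

noncomputable section

namespace SymBoussinesq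

set_option linter.unusedSectionVars false

open scoped RealInnerProductSpace

/-! Everything is done on the Fourier side. Write `⟨ξ⟩ = jb ξ`, `θ = (1 + ε⟨ξ⟩²)^{1/2}`, `f = ⟨ξ⟩^s
θ Û` and, for `V = ∂ₜU`, `h = ⟨ξ⟩^{s-1} θ V̂`. The `L²` norms of `f` and `h` are then exactly the
norms of `U` in `H^{s+1}_ε` and of `V` in `H^s_ε`, and the system becomes the relation `Rel f h`
(`equation_iff`). It can be inverted because `S₀ - ε S₂ ∂ₓ²` has the symbol `M`, which lies between
multiples of `θ²`, uniformly in `ε`.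

Local theory, `ε` fixed. For given `f` the relation is affine in `h`, and its `S₁` part is a
perturbation of norm at most 1/2 as long as `ε‖f‖` is small (`exists_rel`). The result has the form
`h = linOp f + emb (force f h)` (`Rel.eq`). The linear symbol `-i q M⁻¹ N` is unbounded but skew for
the form of `M`, so it generates a uniformly bounded group `G` (`norm_prop_le`). In the nonlinear
part `M⁻¹` regains the lost derivative at the price of `ε^{-1/2}`, so that `force` is bounded and
locally Lipschitz. Hence `G(-t) f(t)` solves an ordinary differential equation in a Hilbert space,
to which Picard–Lindelöf applies after truncation. Conversely every solution in the sense of the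
statement satisfies this equation (`FourierSol.hasDerivWithinAt`), and this gives uniqueness.

Time `T / ε`. To the quadratic form of `M` the energy adds `ε (S₁(a)a, a)` with `a = ⟨ξ⟩^s Û`. In
its time derivative the terms with too many derivatives on `V` cancel by the symmetry of `S₁`, and
those with too many derivatives on `U` are integrated by parts by the symmetry of `Σ₁`
(`energyDeriv_eq`). What remains are commutators and harmless products. The commutators are bounded
because `⟨ξ⟩^s - ⟨η⟩^s` gains a factor `⟨ξ - η⟩` (`isKernel_kComm`), and the condition `s > 3/2`
enters because it puts `⟨ξ⟩^{-(s-1)}` in `L²` (`isWeight_wt`). On a ball of radius `R` the energy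
therefore grows at a rate `ε R` times a constant free of `ε`; Grönwall's inequality and a continuity
argument give `‖f‖ ≤ amp ‖f₀‖` up to time `T / ε` (`exists_fourierSol`).

The constants depend only on `s`, a coercivity constant `κ` and a bound `K` of the coefficients,
which are uniform on the compact rectangle of parameters (`exists_coeffBound`). So `C₀` can be a
constant function. The bound with the denominator follows from the uniform one, since the
denominator is at most 1. -/

/-! ### Multiplication operators on vector-valued `L²(ℝ)` -/

/-- Square integrable functions on the frequency line with values in `E`. -/
abbrev L2 (E : Type*) [NormedAddCommGroup E] : Type _ := Lp E 2 (volume : Measure ℝ)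

section Multiplication

variable {E : Type*} [NormedAddCommGroup E] [InnerProductSpace ℝ E]

/-- `m` is a continuous operator-valued symbol bounded by `C`. -/
structure IsMult (m : ℝ → E →L[ℝ] E) (C : ℝ) : Prop where
  cont : Continuous m
  bound : ∀ ξ, ‖m ξ‖ ≤ C

namespace IsMult

variable {m m' : ℝ → E →L[ℝ] E} {C C' : ℝ}

lemma nonneg (hm : IsMult m C) : 0 ≤ C := (norm_nonneg _).trans (hm.bound 0)

lemma memLp (hm : IsMult m C) (f : L2 E) : MemLp (fun ξ => m ξ (f ξ)) 2 volume := by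
  refine MemLp.of_le_mul (c := C) (Lp.memLp f) ?_ (ae_of_all _ fun ξ => ?_)
  · exact isBoundedBilinearMap_apply.continuous.comp_aestronglyMeasurable
      (hm.cont.aestronglyMeasurable.prodMk (Lp.aestronglyMeasurable f))
  · exact (m ξ).le_of_opNorm_le (hm.bound ξ) _

lemma mul (hm : IsMult m C) (hm' : IsMult m' C') : IsMult (fun ξ => m ξ * m' ξ) (C * C') :=
  ⟨hm.cont.mul hm'.cont, fun ξ => (norm_mul_le _ _).trans
    (mul_le_mul (hm.bound ξ) (hm'.bound ξ) (norm_nonneg _) hm.nonneg)⟩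

end IsMult

open Classical in
/-- Multiplication by the symbol `m` on `L²`; it is `0` if `m` is not continuous and bounded. -/
def mulOp (m : ℝ → E →L[ℝ] E) : L2 E →L[ℝ] L2 E :=
  if h : ∃ C, IsMult m C then
    LinearMap.mkContinuous
      { toFun := fun f => (h.choose_spec.memLp f).toLp _
        map_add' := fun f g => by
          rw [← MemLp.toLp_add]
          refine MemLp.toLp_congr _ _ ?_
          filter_upwards [Lp.coeFn_add f g] with ξ hξ
          rw [hξ, Pi.add_apply, map_add, Pi.add_apply]
        map_smul' := fun c f => by
          rw [RingHom.id_apply, ← MemLp.toLp_const_smul]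
          refine MemLp.toLp_congr _ _ ?_
          filter_upwards [Lp.coeFn_smul c f] with ξ hξ
          rw [hξ, Pi.smul_apply, map_smul, Pi.smul_apply] } h.choose
      (fun f => by
        refine Lp.norm_le_mul_norm_of_ae_le_mul ?_
        filter_upwards [MemLp.coeFn_toLp (h.choose_spec.memLp f)] with ξ hξ
        simp only [LinearMap.coe_mk, AddHom.coe_mk, hξ]
        exact (m ξ).le_of_opNorm_le (h.choose_spec.bound ξ) _)
  else 0

variable {m m' : ℝ → E →L[ℝ] E} {C C' : ℝ}

lemma mulOp_ae (hm : IsMult m C) (f : L2 E) : mulOp m f =ᵐ[volume] fun ξ => m ξ (f ξ) := by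
  have h : ∃ C, IsMult m C := ⟨C, hm⟩
  rw [mulOp, dif_pos h]
  exact MemLp.coeFn_toLp (h.choose_spec.memLp f)

lemma norm_mulOp_le (hm : IsMult m C) (f : L2 E) : ‖mulOp m f‖ ≤ C * ‖f‖ := by
  refine Lp.norm_le_mul_norm_of_ae_le_mul ?_
  filter_upwards [mulOp_ae hm f] with ξ hξ
  rw [hξ]
  exact (m ξ).le_of_opNorm_le (hm.bound ξ) _

lemma mulOp_mulOp (hm : IsMult m C) (hm' : IsMult m' C') (f : L2 E) :
    mulOp m (mulOp m' f) = mulOp (fun ξ => m ξ * m' ξ) f := by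
  apply Lp.ext
  filter_upwards [mulOp_ae hm (mulOp m' f), mulOp_ae hm' f, mulOp_ae (hm.mul hm') f] with ξ h1 h2 h3
  rw [h1, h2, h3]; rfl

lemma mulOp_one (f : L2 E) : mulOp (fun _ => (1 : E →L[ℝ] E)) f = f := by
  have hm : IsMult (fun _ : ℝ => (1 : E →L[ℝ] E)) ‖(1 : E →L[ℝ] E)‖ :=
    ⟨continuous_const, fun _ => le_rfl⟩
  apply Lp.ext
  filter_upwards [mulOp_ae hm f] with ξ h1
  rw [h1]; rfl

lemma inner_mulOp_left (hm : IsMult m C) (hm' : IsMult m' C')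
    (h : ∀ ξ x y, ⟪m ξ x, y⟫ = ⟪x, m' ξ y⟫) (f g : L2 E) :
    ⟪mulOp m f, g⟫ = ⟪f, mulOp m' g⟫ := by
  rw [L2.inner_def, L2.inner_def]
  refine integral_congr_ae ?_
  filter_upwards [mulOp_ae hm f, mulOp_ae hm' g] with ξ h1 h2
  rw [h1, h2, h]

/-- Uniformly bounded symbols that converge pointwise give strongly convergent operators. -/
lemma tendsto_mulOp {ι : Type*} {l : Filter ι} [l.IsCountablyGenerated]
    {M : ι → ℝ → E →L[ℝ] E} (hM : ∀ i, IsMult (M i) C) (hm : IsMult m C')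
    (h : ∀ ξ, Tendsto (fun i => M i ξ) l (𝓝 (m ξ))) (f : L2 E) :
    Tendsto (fun i => mulOp (M i) f) l (𝓝 (mulOp m f)) := by
  rw [tendsto_iff_norm_sub_tendsto_zero, ← tendsto_zero_iff_norm_tendsto_zero]
  rw [tendsto_zero_iff_norm_tendsto_zero]
  have key : ∀ i, ‖mulOp (M i) f - mulOp m f‖ ^ 2 = ∫ ξ, ‖M i ξ (f ξ) - m ξ (f ξ)‖ ^ 2 := by
    intro i
    rw [← real_inner_self_eq_norm_sq, L2.inner_def]
    refine integral_congr_ae ?_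
    filter_upwards [Lp.coeFn_sub (mulOp (M i) f) (mulOp m f), mulOp_ae (hM i) f, mulOp_ae hm f]
      with ξ h1 h2 h3
    rw [real_inner_self_eq_norm_sq, h1, Pi.sub_apply, h2, h3]
  have hlim : Tendsto (fun i => ‖mulOp (M i) f - mulOp m f‖ ^ 2) l (𝓝 0) := by
    simp_rw [key]
    rw [show (0 : ℝ) = ∫ _ : ℝ, (0 : ℝ) by simp]
    -- Dominated convergence, with `(C + C')² |f|²` as the integrable majorant.
    refine tendsto_integral_filter_of_dominated_convergence
      (fun ξ => (C + C') ^ 2 * ‖f ξ‖ ^ 2) ?_ ?_ ?_ ?_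
    · refine Eventually.of_forall fun i => ?_
      exact (((hM i).memLp f).1.sub (hm.memLp f).1).norm.pow 2
    · refine Eventually.of_forall fun i => ae_of_all _ fun ξ => ?_
      rw [Real.norm_of_nonneg (by positivity), ← mul_pow]
      gcongr
      calc ‖M i ξ (f ξ) - m ξ (f ξ)‖ ≤ ‖M i ξ (f ξ)‖ + ‖m ξ (f ξ)‖ := norm_sub_le _ _
        _ ≤ C * ‖f ξ‖ + C' * ‖f ξ‖ := add_le_add ((M i ξ).le_of_opNorm_le ((hM i).bound ξ) _)
            ((m ξ).le_of_opNorm_le (hm.bound ξ) _)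
        _ = _ := by ring
    · exact ((memLp_two_iff_integrable_sq_norm (Lp.aestronglyMeasurable f)).1
        (Lp.memLp f)).const_mul _
    · refine ae_of_all _ fun ξ => ?_
      have h1 : Tendsto (fun i => M i ξ (f ξ) - m ξ (f ξ)) l (𝓝 0) := by
        have := ((ContinuousLinearMap.apply ℝ E (f ξ)).continuous.tendsto (m ξ)).comp (h ξ)
        simpa using this.sub_const (m ξ (f ξ))
      simpa using h1.norm.pow 2
  have := hlim.sqrt
  simpa using this

end Multiplication

/-! ### Bilinear operators with a kernel -/

section Bilinear

/-- Young's inequality `‖F * H‖₂ ≤ ‖F‖₁ ‖H‖₂`. -/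
lemma lintegral_convolution_sq_le {F H : ℝ → ℝ≥0∞} (hF : Measurable F) (hH : Measurable H) :
    ∫⁻ ξ, (∫⁻ η, F (ξ - η) * H η) ^ 2 ≤ (∫⁻ x, F x) ^ 2 * ∫⁻ x, H x ^ 2 := by
  have hFs : ∀ ξ, Measurable fun η => F (ξ - η) := fun ξ => hF.comp (by fun_prop)
  have h1 : ∀ ξ, (∫⁻ η, F (ξ - η) * H η) ^ 2 ≤ (∫⁻ x, F x) * ∫⁻ η, F (ξ - η) * H η ^ 2 := by
    intro ξ
    have hF1 : ∫⁻ η, F (ξ - η) = ∫⁻ x, F x := lintegral_sub_left_eq_self F ξ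
    -- Splitting `F = F^{1/2} F^{1/2}` before Cauchy–Schwarz leaves `F` to the first power in both
    -- factors, so that only its `L¹` norm appears after integration in `ξ`.
    have hcs := ENNReal.lintegral_mul_le_Lp_mul_Lq volume (p := 2) (q := 2)
      (f := fun η => F (ξ - η) ^ (1 / 2 : ℝ)) (g := fun η => F (ξ - η) ^ (1 / 2 : ℝ) * H η)
      (by constructor <;> norm_num) ((hFs ξ).pow_const _).aemeasurable
      (((hFs ξ).pow_const _).mul hH).aemeasurable
    have e1 : ∀ η, ((fun η => F (ξ - η) ^ (1 / 2 : ℝ)) * fun η => F (ξ - η) ^ (1 / 2 : ℝ) * H η) η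
        = F (ξ - η) * H η := by
      intro η
      simp only [Pi.mul_apply]
      rw [← mul_assoc, ← ENNReal.rpow_add_of_nonneg _ _ (by norm_num) (by norm_num)]
      norm_num
    have e2 : ∀ η, (F (ξ - η) ^ (1 / 2 : ℝ)) ^ (2 : ℝ) = F (ξ - η) := by
      intro η; rw [← ENNReal.rpow_mul]; norm_num
    have e3 : ∀ η, (F (ξ - η) ^ (1 / 2 : ℝ) * H η) ^ (2 : ℝ) = F (ξ - η) * H η ^ 2 := by
      intro η
      rw [ENNReal.mul_rpow_of_nonneg _ _ (by norm_num), e2]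
      norm_num
    simp_rw [e1, e2, e3, hF1] at hcs
    calc (∫⁻ η, F (ξ - η) * H η) ^ 2
        ≤ ((∫⁻ x, F x) ^ (1 / 2 : ℝ) * (∫⁻ η, F (ξ - η) * H η ^ 2) ^ (1 / 2 : ℝ)) ^ 2 := by gcongr
      _ = _ := by
        rw [mul_pow, ← ENNReal.rpow_natCast, ← ENNReal.rpow_natCast, ← ENNReal.rpow_mul,
          ← ENNReal.rpow_mul]
        norm_num
  calc ∫⁻ ξ, (∫⁻ η, F (ξ - η) * H η) ^ 2
      ≤ ∫⁻ ξ, (∫⁻ x, F x) * ∫⁻ η, F (ξ - η) * H η ^ 2 := lintegral_mono h1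
    _ = (∫⁻ x, F x) * ∫⁻ ξ, ∫⁻ η, F (ξ - η) * H η ^ 2 := by
        refine lintegral_const_mul _ ?_
        refine Measurable.lintegral_prod_right' (f := fun p : ℝ × ℝ => F (p.1 - p.2) * H p.2 ^ 2) ?_
        exact (hF.comp (by fun_prop)).mul ((hH.comp measurable_snd).pow_const 2)
    _ = (∫⁻ x, F x) * ∫⁻ η, ∫⁻ ξ, F (ξ - η) * H η ^ 2 := by
        rw [lintegral_lintegral_swap]
        exact ((hF.comp (by fun_prop)).mul ((hH.comp measurable_snd).pow_const 2)).aemeasurable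
    _ = (∫⁻ x, F x) * ∫⁻ η, (∫⁻ x, F x) * H η ^ 2 := by
        congr 1
        refine lintegral_congr fun η => ?_
        rw [lintegral_mul_const _ (by fun_prop), lintegral_sub_right_eq_self F η]
    _ = _ := by
        rw [lintegral_const_mul _ (hH.pow_const 2), ← mul_assoc, sq]

/-- Cauchy–Schwarz in the form `‖F H‖₁² ≤ ‖F‖₂² ‖H‖₂²`. -/
lemma lintegral_mul_sq_le {F H : ℝ → ℝ≥0∞} (hF : Measurable F) (hH : Measurable H) :
    (∫⁻ x, F x * H x) ^ 2 ≤ (∫⁻ x, F x ^ 2) * ∫⁻ x, H x ^ 2 := by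
  have hcs := ENNReal.lintegral_mul_le_Lp_mul_Lq volume (p := 2) (q := 2) (f := F) (g := H)
    (by constructor <;> norm_num) hF.aemeasurable hH.aemeasurable
  calc (∫⁻ x, F x * H x) ^ 2
      ≤ ((∫⁻ x, F x ^ (2 : ℝ)) ^ (1 / 2 : ℝ) * (∫⁻ x, H x ^ (2 : ℝ)) ^ (1 / 2 : ℝ)) ^ 2 := by
        gcongr; exact hcs
    _ = _ := by
        rw [mul_pow, ← ENNReal.rpow_natCast, ← ENNReal.rpow_natCast, ← ENNReal.rpow_mul,
          ← ENNReal.rpow_mul]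
        norm_num

/-- The bound for the bilinear operators below, for scalar functions. -/
lemma lintegral_kernel_sq_le {A F H : ℝ → ℝ≥0∞} (hA : Measurable A) (hF : Measurable F)
    (hH : Measurable H) :
    ∫⁻ ξ, (∫⁻ η, (A (ξ - η) + A η) * (F (ξ - η) * H η)) ^ 2
      ≤ 4 * (∫⁻ x, A x ^ 2) * (∫⁻ x, F x ^ 2) * ∫⁻ x, H x ^ 2 := by
  have hsub : ∀ ξ : ℝ, Measurable fun η : ℝ => ξ - η := fun ξ => by fun_prop
  -- The substitution `η ↦ ξ - η` in one of the terms gives the convolutions of `AF` with `H` and of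
  -- `AH` with `F`. Young's inequality applies to both, and the `L¹` norms of `AF` and `AH` are
  -- bounded by Cauchy–Schwarz.
  have hsplit : ∀ ξ, ∫⁻ η, (A (ξ - η) + A η) * (F (ξ - η) * H η)
      = (∫⁻ η, (A * F) (ξ - η) * H η) + ∫⁻ η, (A * H) (ξ - η) * F η := by
    intro ξ
    rw [← lintegral_sub_left_eq_self (fun η => (A * H) (ξ - η) * F η) ξ, ← lintegral_add_left]
    · refine lintegral_congr fun η => ?_
      simp only [Pi.mul_apply, sub_sub_cancel]
      ring
    · exact ((hA.mul hF).comp (hsub ξ)).mul hH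
  have hsq : ∀ x y : ℝ≥0∞, (x + y) ^ 2 ≤ 2 * x ^ 2 + 2 * y ^ 2 := by
    intro x y
    have := ENNReal.rpow_add_le_mul_rpow_add_rpow x y (p := 2) (by norm_num)
    norm_num at this
    rwa [← mul_add]
  have hm : Measurable fun ξ => ∫⁻ η, (A * F) (ξ - η) * H η :=
    Measurable.lintegral_prod_right' (f := fun p : ℝ × ℝ => (A * F) (p.1 - p.2) * H p.2)
      (((hA.mul hF).comp (by fun_prop)).mul (hH.comp measurable_snd))
  calc ∫⁻ ξ, (∫⁻ η, (A (ξ - η) + A η) * (F (ξ - η) * H η)) ^ 2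
      ≤ ∫⁻ ξ, (2 * (∫⁻ η, (A * F) (ξ - η) * H η) ^ 2
          + 2 * (∫⁻ η, (A * H) (ξ - η) * F η) ^ 2) := by
        refine lintegral_mono fun ξ => ?_
        dsimp only
        rw [hsplit]
        exact hsq _ _
    _ = 2 * (∫⁻ ξ, (∫⁻ η, (A * F) (ξ - η) * H η) ^ 2)
          + 2 * ∫⁻ ξ, (∫⁻ η, (A * H) (ξ - η) * F η) ^ 2 := by
        rw [lintegral_add_left ((hm.pow_const 2).const_mul 2),
          lintegral_const_mul' _ _ (by norm_num), lintegral_const_mul' _ _ (by norm_num)]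
    _ ≤ 2 * ((∫⁻ x, (A * F) x) ^ 2 * ∫⁻ x, H x ^ 2)
          + 2 * ((∫⁻ x, (A * H) x) ^ 2 * ∫⁻ x, F x ^ 2) := by
        gcongr
        · exact lintegral_convolution_sq_le (hA.mul hF) hH
        · exact lintegral_convolution_sq_le (hA.mul hH) hF
    _ ≤ 2 * (((∫⁻ x, A x ^ 2) * ∫⁻ x, F x ^ 2) * ∫⁻ x, H x ^ 2)
          + 2 * (((∫⁻ x, A x ^ 2) * ∫⁻ x, H x ^ 2) * ∫⁻ x, F x ^ 2) := by
        gcongr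
        · exact lintegral_mul_sq_le hA hF
        · exact lintegral_mul_sq_le hA hH
    _ = _ := by ring

/-- `α` is a nonnegative square integrable weight. -/
structure IsWeight (α : ℝ → ℝ) : Prop where
  meas : Measurable α
  nonneg : ∀ x, 0 ≤ α x
  memLp : MemLp α 2 volume

/-- The kernel `k` is bounded by `C (α(ξ - η) + α(η))`. -/
structure IsKernel (α : ℝ → ℝ) (k : ℝ → ℝ → ℝ) (C : ℝ) : Prop where
  meas : Measurable fun p : ℝ × ℝ => k p.1 p.2
  nonneg : 0 ≤ C
  bound : ∀ ξ η, |k ξ η| ≤ C * (α (ξ - η) + α η)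

variable {E : Type*} [NormedAddCommGroup E] [InnerProductSpace ℝ E]

/-- The integrand of `convK`. -/
def convI (k : ℝ → ℝ → ℝ) (b : E →L[ℝ] E →L[ℝ] E) (f g : ℝ → E) (ξ η : ℝ) : E :=
  k ξ η • b (f (ξ - η)) (g η)

/-- `ξ ↦ ∫ k(ξ, η) b(f(ξ - η), g(η)) dη` -/
def convK (k : ℝ → ℝ → ℝ) (b : E →L[ℝ] E →L[ℝ] E) (f g : ℝ → E) (ξ : ℝ) : E :=
  ∫ η, convI k b f g ξ η

variable {α : ℝ → ℝ} {k k' : ℝ → ℝ → ℝ} {C C' : ℝ} {b : E →L[ℝ] E →L[ℝ] E}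

lemma stronglyMeasurable_convI (hk : IsKernel α k C) (b : E →L[ℝ] E →L[ℝ] E) (f g : L2 E) :
    StronglyMeasurable fun p : ℝ × ℝ => convI k b f g p.1 p.2 := by
  have hf : StronglyMeasurable fun p : ℝ × ℝ => f (p.1 - p.2) :=
    (Lp.stronglyMeasurable f).comp_measurable (by fun_prop)
  have hg : StronglyMeasurable fun p : ℝ × ℝ => g p.2 :=
    (Lp.stronglyMeasurable g).comp_measurable measurable_snd
  refine hk.meas.stronglyMeasurable.smul ?_
  have hb : Continuous fun p : E × E => b p.1 p.2 := by fun_prop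
  exact hb.comp_stronglyMeasurable (hf.prodMk hg)

lemma lintegral_enorm_sq_eq {E : Type*} [NormedAddCommGroup E] (f : L2 E) : ∫⁻ x, ‖f x‖ₑ ^ 2 = ENNReal.ofReal (‖f‖ ^ 2) := by
  have h : ‖f‖ₑ ^ 2 = ∫⁻ x, ‖f x‖ₑ ^ 2 := by
    rw [Lp.enorm_def, eLpNorm_eq_lintegral_rpow_enorm_toReal (by norm_num) (by norm_num),
      ← ENNReal.rpow_natCast, ← ENNReal.rpow_mul]
    norm_num
  rw [← h, ENNReal.ofReal_pow (norm_nonneg _), ofReal_norm]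

/-- The `L²` norm of the weight, doubled: the constant in the bound for `bil`. -/
def weightConst (α : ℝ → ℝ) : ℝ := 2 * (eLpNorm α 2 volume).toReal

lemma weightConst_nonneg (α : ℝ → ℝ) : 0 ≤ weightConst α := by unfold weightConst; positivity

/-- The estimate is for the integral of the norm, so that it yields both absolute convergence for
almost every `ξ` and the `L²` bound. The 4 of `lintegral_kernel_sq_le` is the square of the 2 in
`weightConst`. -/
lemma lintegral_convI_sq_le (hα : IsWeight α) (hk : IsKernel α k C) (b : E →L[ℝ] E →L[ℝ] E)
    (f g : L2 E) :
    ∫⁻ ξ, (∫⁻ η, ‖convI k b f g ξ η‖ₑ) ^ 2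
      ≤ ENNReal.ofReal ((weightConst α * (C * ‖b‖) * ‖f‖ * ‖g‖) ^ 2) := by
  have hCb : 0 ≤ C * ‖b‖ := mul_nonneg hk.nonneg (norm_nonneg b)
  have hA : ∫⁻ x, ENNReal.ofReal (α x) ^ 2 = eLpNorm α 2 volume ^ 2 := by
    rw [eLpNorm_eq_lintegral_rpow_enorm_toReal (by norm_num) (by norm_num),
      ← ENNReal.rpow_natCast, ← ENNReal.rpow_mul]
    norm_num
    refine lintegral_congr fun x => ?_
    rw [Real.enorm_eq_ofReal (hα.nonneg x)]
  have hpt : ∀ ξ η, ‖convI k b f g ξ η‖ₑ ≤ ENNReal.ofReal (C * ‖b‖) *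
      ((ENNReal.ofReal (α (ξ - η)) + ENNReal.ofReal (α η)) * (‖f (ξ - η)‖ₑ * ‖g η‖ₑ)) := by
    intro ξ η
    rw [← ofReal_norm, ← ofReal_norm, ← ofReal_norm, ← ENNReal.ofReal_add (hα.nonneg _)
      (hα.nonneg _), ← ENNReal.ofReal_mul (norm_nonneg _), ← ENNReal.ofReal_mul
      (add_nonneg (hα.nonneg _) (hα.nonneg _)), ← ENNReal.ofReal_mul hCb]
    refine ENNReal.ofReal_le_ofReal ?_
    rw [convI, norm_smul, Real.norm_eq_abs]
    calc |k ξ η| * ‖b (f (ξ - η)) (g η)‖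
        ≤ (C * (α (ξ - η) + α η)) * (‖b‖ * ‖f (ξ - η)‖ * ‖g η‖) := by
          gcongr
          · exact mul_nonneg hk.nonneg (add_nonneg (hα.nonneg _) (hα.nonneg _))
          · exact hk.bound ξ η
          · exact b.le_opNorm₂ _ _
      _ = _ := by ring
  have hfm : Measurable fun x => ‖f x‖ₑ := (Lp.stronglyMeasurable f).enorm
  have hgm : Measurable fun x => ‖g x‖ₑ := (Lp.stronglyMeasurable g).enorm
  calc ∫⁻ ξ, (∫⁻ η, ‖convI k b f g ξ η‖ₑ) ^ 2
      ≤ ∫⁻ ξ, (ENNReal.ofReal (C * ‖b‖) * ∫⁻ η, (ENNReal.ofReal (α (ξ - η)) + ENNReal.ofReal (α η))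
          * (‖f (ξ - η)‖ₑ * ‖g η‖ₑ)) ^ 2 := by
        refine lintegral_mono fun ξ => ?_
        dsimp only
        gcongr
        rw [← lintegral_const_mul' _ _ ENNReal.ofReal_ne_top]
        exact lintegral_mono (hpt ξ)
    _ = ENNReal.ofReal (C * ‖b‖) ^ 2 * ∫⁻ ξ, (∫⁻ η, (ENNReal.ofReal (α (ξ - η))
          + ENNReal.ofReal (α η)) * (‖f (ξ - η)‖ₑ * ‖g η‖ₑ)) ^ 2 := by
        simp_rw [mul_pow]
        rw [lintegral_const_mul' _ _ (by simp)]
    _ ≤ ENNReal.ofReal (C * ‖b‖) ^ 2 * (4 * (∫⁻ x, ENNReal.ofReal (α x) ^ 2)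
          * (∫⁻ x, ‖f x‖ₑ ^ 2) * ∫⁻ x, ‖g x‖ₑ ^ 2) := by
        gcongr
        exact lintegral_kernel_sq_le hα.meas.ennreal_ofReal hfm hgm
    _ = _ := by
        rw [hA, lintegral_enorm_sq_eq, lintegral_enorm_sq_eq, weightConst,
          ← ENNReal.ofReal_toReal hα.memLp.2.ne, ENNReal.toReal_ofReal (by positivity),
          ← ENNReal.ofReal_pow hCb, ← ENNReal.ofReal_pow ENNReal.toReal_nonneg,
          show (4 : ℝ≥0∞) = ENNReal.ofReal 4 by norm_num,
          ← ENNReal.ofReal_mul (by positivity), ← ENNReal.ofReal_mul (by positivity),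
          ← ENNReal.ofReal_mul (by positivity), ← ENNReal.ofReal_mul (by positivity)]
        congr 1
        ring

lemma ae_integrable_convI (hα : IsWeight α) (hk : IsKernel α k C) (b : E →L[ℝ] E →L[ℝ] E)
    (f g : L2 E) : ∀ᵐ ξ, Integrable (convI k b f g ξ) := by
  have hm := stronglyMeasurable_convI hk b f g
  have hm' : Measurable fun ξ => (∫⁻ η, ‖convI k b f g ξ η‖ₑ) ^ 2 :=
    (Measurable.lintegral_prod_right' hm.enorm).pow_const 2
  have := ae_lt_top hm' ((lintegral_convI_sq_le hα hk b f g).trans_lt ENNReal.ofReal_lt_top).ne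
  filter_upwards [this] with ξ hξ
  refine ⟨(hm.comp_measurable (measurable_prodMk_left (x := ξ))).aestronglyMeasurable, ?_⟩
  rw [hasFiniteIntegral_iff_enorm]
  by_contra h
  rw [not_lt_top_iff] at h
  simp [h] at hξ

lemma memLp_convK (hα : IsWeight α) (hk : IsKernel α k C) (b : E →L[ℝ] E →L[ℝ] E) (f g : L2 E) :
    MemLp (convK k b f g) 2 volume ∧
      eLpNorm (convK k b f g) 2 volume
        ≤ ENNReal.ofReal (weightConst α * (C * ‖b‖) * ‖f‖ * ‖g‖) := by
  have hm := stronglyMeasurable_convI hk b f g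
  have hmK : StronglyMeasurable (convK k b f g) := hm.integral_prod_right
  have hle : eLpNorm (convK k b f g) 2 volume
      ≤ ENNReal.ofReal (weightConst α * (C * ‖b‖) * ‖f‖ * ‖g‖) := by
    have hc : 0 ≤ weightConst α * (C * ‖b‖) * ‖f‖ * ‖g‖ := by
      have := weightConst_nonneg α
      have := hk.nonneg
      positivity
    rw [eLpNorm_eq_lintegral_rpow_enorm_toReal (by norm_num) (by norm_num)]
    have h2 : ∫⁻ ξ, ‖convK k b f g ξ‖ₑ ^ 2
        ≤ ENNReal.ofReal ((weightConst α * (C * ‖b‖) * ‖f‖ * ‖g‖) ^ 2) := by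
      refine (lintegral_mono fun ξ => ?_).trans (lintegral_convI_sq_le hα hk b f g)
      dsimp only
      gcongr
      exact enorm_integral_le_lintegral_enorm _
    calc _ ≤ (ENNReal.ofReal ((weightConst α * (C * ‖b‖) * ‖f‖ * ‖g‖) ^ 2)) ^ (1 / 2 : ℝ) := by
          norm_num
          gcongr
      _ = _ := by
          rw [ENNReal.ofReal_rpow_of_nonneg (by positivity) (by norm_num), ← Real.rpow_natCast,
            ← Real.rpow_mul hc]
          norm_num
  exact ⟨⟨hmK.aestronglyMeasurable, hle.trans_lt ENNReal.ofReal_lt_top⟩, hle⟩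

/-- Almost everywhere equal functions give the same integrand. -/
lemma convI_congr {f f' g g' : ℝ → E} (hf : f =ᵐ[volume] f') (hg : g =ᵐ[volume] g') (ξ : ℝ) :
    convI k b f g ξ =ᵐ[volume] convI k b f' g' ξ := by
  have h1 : ∀ᵐ η, f (ξ - η) = f' (ξ - η) :=
    (Measure.measurePreserving_sub_left volume ξ).quasiMeasurePreserving.ae hf
  filter_upwards [h1, hg] with η h2 h3
  simp only [convI, h2, h3]

lemma convK_congr {f f' g g' : ℝ → E} (hf : f =ᵐ[volume] f') (hg : g =ᵐ[volume] g') (ξ : ℝ) :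
    convK k b f g ξ = convK k b f' g' ξ := integral_congr_ae (convI_congr hf hg ξ)

open Classical in
/-- The bounded bilinear operator `(f, g) ↦ ∫ k(·, η) b(f(· - η), g(η)) dη` on `L²`; it is `0`
if `k` is not bounded by `α`. -/
def bil (α : ℝ → ℝ) (k : ℝ → ℝ → ℝ) (b : E →L[ℝ] E →L[ℝ] E) : L2 E →L[ℝ] L2 E →L[ℝ] L2 E :=
  if h : IsWeight α ∧ ∃ C, IsKernel α k C then
    LinearMap.mkContinuous₂
      (LinearMap.mk₂ ℝ (fun f g => (memLp_convK h.1 h.2.choose_spec b f g).1.toLp _)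
        (fun f f' g => by
          rw [← MemLp.toLp_add]
          refine MemLp.toLp_congr _ _ ?_
          filter_upwards [ae_integrable_convI h.1 h.2.choose_spec b f g,
            ae_integrable_convI h.1 h.2.choose_spec b f' g] with ξ h1 h2
          rw [convK_congr (Lp.coeFn_add f f') (EventuallyEq.refl _ g), Pi.add_apply, convK, convK,
            convK, ← integral_add h1 h2]
          simp [convI])
        (fun c f g => by
          rw [← MemLp.toLp_const_smul]
          refine MemLp.toLp_congr _ _ (ae_of_all _ fun ξ => ?_)
          rw [convK_congr (Lp.coeFn_smul c f) (EventuallyEq.refl _ g), Pi.smul_apply, convK, convK,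
            ← integral_smul]
          simp [convI, smul_comm c])
        (fun f g g' => by
          rw [← MemLp.toLp_add]
          refine MemLp.toLp_congr _ _ ?_
          filter_upwards [ae_integrable_convI h.1 h.2.choose_spec b f g,
            ae_integrable_convI h.1 h.2.choose_spec b f g'] with ξ h1 h2
          rw [convK_congr (EventuallyEq.refl _ f) (Lp.coeFn_add g g'), Pi.add_apply, convK, convK,
            convK, ← integral_add h1 h2]
          simp [convI])
        (fun c f g => by
          rw [← MemLp.toLp_const_smul]
          refine MemLp.toLp_congr _ _ (ae_of_all _ fun ξ => ?_)
          rw [convK_congr (EventuallyEq.refl _ f) (Lp.coeFn_smul c g), Pi.smul_apply, convK, convK,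
            ← integral_smul]
          simp [convI, smul_comm c]))
      (weightConst α * (h.2.choose * ‖b‖))
      (fun f g => by
        have h2 := (memLp_convK h.1 h.2.choose_spec b f g).2
        have hc : 0 ≤ weightConst α * (h.2.choose * ‖b‖) * ‖f‖ * ‖g‖ := by
          have := weightConst_nonneg α
          have := h.2.choose_spec.nonneg
          positivity
        rw [LinearMap.mk₂_apply, Lp.norm_toLp]
        exact ENNReal.toReal_le_of_le_ofReal hc h2)
  else 0

lemma bil_ae (hα : IsWeight α) (hk : IsKernel α k C) (b : E →L[ℝ] E →L[ℝ] E) (f g : L2 E) :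
    bil α k b f g =ᵐ[volume] convK k b f g := by
  have h : IsWeight α ∧ ∃ C, IsKernel α k C := ⟨hα, C, hk⟩
  rw [bil, dif_pos h]
  exact MemLp.coeFn_toLp (memLp_convK h.1 h.2.choose_spec b f g).1

lemma norm_bil_le (hα : IsWeight α) (hk : IsKernel α k C) (b : E →L[ℝ] E →L[ℝ] E) (f g : L2 E) :
    ‖bil α k b f g‖ ≤ weightConst α * (C * ‖b‖) * ‖f‖ * ‖g‖ := by
  have h2 := (memLp_convK hα hk b f g).2
  have hc : 0 ≤ weightConst α * (C * ‖b‖) * ‖f‖ * ‖g‖ := by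
    have := weightConst_nonneg α
    have := hk.nonneg
    positivity
  rw [Lp.norm_def, eLpNorm_congr_ae (bil_ae hα hk b f g)]
  exact ENNReal.toReal_le_of_le_ofReal hc h2

end Bilinear

/-! ### Duality and symmetry of the bilinear operators. -/

section BilinearProperties

variable {E : Type*} [NormedAddCommGroup E] [InnerProductSpace ℝ E]
variable {α : ℝ → ℝ} {k k' : ℝ → ℝ → ℝ} {C C' : ℝ} {b b' : E →L[ℝ] E →L[ℝ] E}

lemma bil_eq_bil (hα : IsWeight α) (hk : IsKernel α k C) (hk' : IsKernel α k' C')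
    {f g f' g' : L2 E}
    (h : ∀ ξ, ∀ᵐ η, convI k b f g ξ η = convI k' b' f' g' ξ η) :
    bil α k b f g = bil α k' b' f' g' := by
  apply Lp.ext
  filter_upwards [bil_ae hα hk b f g, bil_ae hα hk' b' f' g'] with ξ h1 h2
  rw [h1, h2]
  exact integral_congr_ae (h ξ)

/-- Absolute integrability on the plane, which permits the exchange of integrations in
`inner_bil_symm`. It follows from Cauchy–Schwarz in `ξ` and `lintegral_convI_sq_le`. -/
lemma integrable_inner_convI (hα : IsWeight α) (hk : IsKernel α k C) (b : E →L[ℝ] E →L[ℝ] E)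
    (f g h : L2 E) :
    Integrable (fun p : ℝ × ℝ => ⟪convI k b f g p.1 p.2, h p.1⟫) (volume.prod volume) := by
  have hm := stronglyMeasurable_convI hk b f g
  have hhm : StronglyMeasurable fun p : ℝ × ℝ => h p.1 :=
    (Lp.stronglyMeasurable h).comp_measurable measurable_fst
  refine ⟨(hm.inner hhm).aestronglyMeasurable, ?_⟩
  rw [hasFiniteIntegral_iff_enorm]
  have hpt : ∀ p : ℝ × ℝ, ‖⟪convI k b f g p.1 p.2, h p.1⟫‖ₑ
      ≤ ‖convI k b f g p.1 p.2‖ₑ * ‖h p.1‖ₑ := by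
    intro p
    rw [← ofReal_norm, ← ofReal_norm, ← ofReal_norm, ← ENNReal.ofReal_mul (norm_nonneg _)]
    exact ENNReal.ofReal_le_ofReal (norm_inner_le_norm _ _)
  refine (lintegral_mono hpt).trans_lt ?_
  rw [lintegral_prod (fun p : ℝ × ℝ => ‖convI k b f g p.1 p.2‖ₑ * ‖h p.1‖ₑ)
    (hm.enorm.mul hhm.enorm).aemeasurable]
  have hin : ∀ ξ, ∫⁻ η, ‖convI k b f g ξ η‖ₑ * ‖h ξ‖ₑ
      = (∫⁻ η, ‖convI k b f g ξ η‖ₑ) * ‖h ξ‖ₑ := fun ξ =>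
    lintegral_mul_const' _ _ enorm_ne_top
  simp_rw [hin]
  have hcs := lintegral_mul_sq_le (F := fun ξ => ∫⁻ η, ‖convI k b f g ξ η‖ₑ)
    (H := fun ξ => ‖h ξ‖ₑ) (Measurable.lintegral_prod_right' hm.enorm)
    (Lp.stronglyMeasurable h).enorm
  have hfin : (∫⁻ ξ, (∫⁻ η, ‖convI k b f g ξ η‖ₑ) * ‖h ξ‖ₑ) ^ 2 < ⊤ := by
    refine hcs.trans_lt (ENNReal.mul_lt_top ?_ ?_)
    · exact (lintegral_convI_sq_le hα hk b f g).trans_lt ENNReal.ofReal_lt_top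
    · rw [lintegral_enorm_sq_eq]; exact ENNReal.ofReal_lt_top
  by_contra hcon
  rw [not_lt_top_iff] at hcon
  simp [hcon] at hfin

variable [CompleteSpace E]

lemma inner_bil_eq (hα : IsWeight α) (hk : IsKernel α k C) (b : E →L[ℝ] E →L[ℝ] E)
    (f g h : L2 E) :
    ⟪bil α k b f g, h⟫ = ∫ ξ, ∫ η, ⟪convI k b f g ξ η, h ξ⟫ := by
  rw [L2.inner_def]
  refine integral_congr_ae ?_
  filter_upwards [bil_ae hα hk b f g, ae_integrable_convI hα hk b f g] with ξ h1 h2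
  rw [h1, convK, real_inner_comm, ← integral_inner h2]
  simp_rw [real_inner_comm]

/-- If `f` is the transform of a real function and `b(u)` is symmetric for real `u`, then
`bil α k b f` is symmetric. -/
lemma inner_bil_symm (hα : IsWeight α) (hk : IsKernel α k C) (hks : ∀ ξ η, k ξ η = k η ξ)
    {c : E →L[ℝ] E} (hb : ∀ u x y, ⟪b u x, y⟫ = ⟪x, b (c u) y⟫) {f : L2 E}
    (hf : ∀ᵐ ξ, f (-ξ) = c (f ξ)) (g h : L2 E) :
    ⟪bil α k b f g, h⟫ = ⟪bil α k b f h, g⟫ := by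
  -- After the exchange of integrations `ξ` and `η` trade roles: `k` is symmetric, and the adjoint
  -- of `b(f(ξ - η))` is `b(c f(ξ - η)) = b(f(η - ξ))`.
  rw [inner_bil_eq hα hk, inner_bil_eq hα hk,
    integral_integral_swap (integrable_inner_convI hα hk b f g h)]
  refine integral_congr_ae (ae_of_all _ fun η => ?_)
  refine integral_congr_ae ?_
  have h1 : ∀ᵐ ξ, f (-(ξ - η)) = c (f (ξ - η)) :=
    (measurePreserving_sub_right volume η).quasiMeasurePreserving.ae hf
  filter_upwards [h1] with ξ h2
  rw [neg_sub] at h2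
  rw [convI, convI, inner_smul_left, inner_smul_left, hks ξ η, hb (f (ξ - η)), ← h2,
    real_inner_comm]

end BilinearProperties

/-! ### Reflection and conjugation -/

section Reflection

variable {E : Type*} [NormedAddCommGroup E] [InnerProductSpace ℝ E]

/-- `f ↦ c(f(-·))`; with `c` the complex conjugation, its fixed points are the transforms of real
functions. -/
def reflOp (c : E →L[ℝ] E) : L2 E →L[ℝ] L2 E :=
  (c.compLpL 2 volume).comp
    (Lp.compMeasurePreservingₗᵢ ℝ (Neg.neg : ℝ → ℝ)
      (Measure.measurePreserving_neg volume)).toContinuousLinearMap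

lemma reflOp_ae (c : E →L[ℝ] E) (f : L2 E) : reflOp c f =ᵐ[volume] fun ξ => c (f (-ξ)) := by
  have h1 := c.coeFn_compLpL (p := 2) (μ := volume)
    (Lp.compMeasurePreserving (Neg.neg : ℝ → ℝ) (Measure.measurePreserving_neg volume) f)
  have h2 := Lp.coeFn_compMeasurePreserving f (Measure.measurePreserving_neg (volume : Measure ℝ))
  filter_upwards [h1, h2] with ξ h3 h4
  rw [Function.comp_apply] at h4
  rw [← h4, ← h3]
  rfl

lemma ae_neg {p : ℝ → Prop} (h : ∀ᵐ ξ, p ξ) : ∀ᵐ ξ : ℝ, p (-ξ) :=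
  (Measure.measurePreserving_neg (volume : Measure ℝ)).quasiMeasurePreserving.ae h

lemma reflOp_eq_self_iff {c : E →L[ℝ] E} (hc : ∀ x, c (c x) = x) (f : L2 E) :
    reflOp c f = f ↔ ∀ᵐ ξ, f (-ξ) = c (f ξ) := by
  constructor
  · intro h
    have h1 := reflOp_ae c f
    rw [h] at h1
    filter_upwards [h1] with ξ h2
    rw [h2, hc]
  · intro h
    apply Lp.ext
    filter_upwards [reflOp_ae c f, h] with ξ h1 h2
    rw [h1, h2, hc]

lemma norm_reflOp_le {c : E →L[ℝ] E} (hc : ∀ x, ‖c x‖ = ‖x‖) (f : L2 E) :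
    ‖reflOp c f‖ ≤ ‖f‖ := by
  rw [← (Lp.compMeasurePreservingₗᵢ (E := E) (p := 2) ℝ (Neg.neg : ℝ → ℝ)
      (Measure.measurePreserving_neg volume)).norm_map f]
  refine Lp.norm_le_norm_of_ae_le ?_
  filter_upwards [reflOp_ae c f,
    Lp.coeFn_compMeasurePreserving f (Measure.measurePreserving_neg (volume : Measure ℝ))]
    with ξ h1 h2
  rw [h1, hc]
  exact (congrArg norm h2.symm).le

lemma reflOp_reflOp {c : E →L[ℝ] E} (hc : ∀ x, c (c x) = x) (f : L2 E) :
    reflOp c (reflOp c f) = f := by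
  apply Lp.ext
  filter_upwards [reflOp_ae c (reflOp c f), ae_neg (reflOp_ae c f)] with ξ h1 h2
  rw [h1, h2, neg_neg, hc]

lemma norm_reflOp {c : E →L[ℝ] E} (hcc : ∀ x, c (c x) = x) (hc : ∀ x, ‖c x‖ = ‖x‖) (f : L2 E) :
    ‖reflOp c f‖ = ‖f‖ := by
  refine le_antisymm (norm_reflOp_le hc f) ?_
  conv_lhs => rw [← reflOp_reflOp hcc f]
  exact norm_reflOp_le hc _

lemma reflOp_mulOp {c : E →L[ℝ] E} {m : ℝ → E →L[ℝ] E} {C : ℝ} (hm : IsMult m C)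
    (h : ∀ ξ x, c (m (-ξ) x) = m ξ (c x)) (f : L2 E) :
    reflOp c (mulOp m f) = mulOp m (reflOp c f) := by
  apply Lp.ext
  filter_upwards [reflOp_ae c (mulOp m f), ae_neg (mulOp_ae hm f), mulOp_ae hm (reflOp c f),
    reflOp_ae c f] with ξ h1 h2 h3 h4
  rw [h1, h2, h3, h4, h]

/-- The substitution `η ↦ -η` in the integral; this is how products of real functions stay real. -/
lemma reflOp_bil [CompleteSpace E] {c : E →L[ℝ] E} {α : ℝ → ℝ} {k : ℝ → ℝ → ℝ} {C : ℝ}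
    {b : E →L[ℝ] E →L[ℝ] E}
    (hα : IsWeight α) (hk : IsKernel α k C) (hks : ∀ ξ η, k (-ξ) (-η) = k ξ η)
    (hb : ∀ u x, c (b u x) = b (c u) (c x)) (f g : L2 E) :
    reflOp c (bil α k b f g) = bil α k b (reflOp c f) (reflOp c g) := by
  apply Lp.ext
  filter_upwards [reflOp_ae c (bil α k b f g), ae_neg (bil_ae hα hk b f g),
    ae_neg (ae_integrable_convI hα hk b f g), bil_ae hα hk b (reflOp c f) (reflOp c g)]
    with ξ h1 h2 h3 h4
  rw [h1, h2, h4, convK_congr (reflOp_ae c f) (reflOp_ae c g), convK, convK,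
    ← c.integral_comp_comm h3, ← integral_neg_eq_self]
  refine integral_congr_ae (ae_of_all _ fun η => ?_)
  simp only [convI, map_smul, hb, hks]
  congr 5
  ring

end Reflection

/-! ### The Japanese bracket and the kernels -/

section Kernels

/-- `⟨ξ⟩ = (1 + (2πξ)²)^{1/2}` -/
def jb (ξ : ℝ) : ℝ := √(1 + (2 * Real.pi * ξ) ^ 2)

lemma jb_sq (ξ : ℝ) : jb ξ ^ 2 = 1 + (2 * Real.pi * ξ) ^ 2 := Real.sq_sqrt (by positivity)

lemma one_le_jb (ξ : ℝ) : 1 ≤ jb ξ := by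
  rw [jb, Real.one_le_sqrt]; nlinarith [sq_nonneg (2 * Real.pi * ξ)]

lemma jb_pos (ξ : ℝ) : 0 < jb ξ := zero_lt_one.trans_le (one_le_jb ξ)

lemma continuous_jb : Continuous jb := by unfold jb; fun_prop

lemma jb_neg (ξ : ℝ) : jb (-ξ) = jb ξ := by simp [jb]

lemma jb_sub_comm (ξ η : ℝ) : jb (ξ - η) = jb (η - ξ) := by rw [← jb_neg, neg_sub]

lemma abs_le_jb (ξ : ℝ) : |2 * Real.pi * ξ| ≤ jb ξ := by
  rw [jb]; exact Real.abs_le_sqrt (by linarith)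

lemma jb_rpow_sq (r ξ : ℝ) : (1 + (2 * Real.pi * ξ) ^ 2) ^ r = (jb ξ ^ r) ^ 2 := by
  rw [← jb_sq, ← Real.rpow_natCast, ← Real.rpow_natCast, ← Real.rpow_mul (jb_pos ξ).le,
    ← Real.rpow_mul (jb_pos ξ).le, mul_comm]

/-- After squaring, only `|2π(ξ - η)| |2πη| ≤ ⟨ξ - η⟩⟨η⟩` is needed. -/
lemma jb_le_add (ξ η : ℝ) : jb ξ ≤ jb (ξ - η) + jb η := by
  have h1 := jb_sq (ξ - η)
  have h2 := jb_sq η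
  have h3 := abs_le_jb (ξ - η)
  have h4 := abs_le_jb η
  have h5 : |2 * Real.pi * (ξ - η)| * |2 * Real.pi * η| ≤ jb (ξ - η) * jb η :=
    mul_le_mul h3 h4 (abs_nonneg _) (jb_pos _).le
  rw [← abs_mul] at h5
  have h6 := le_abs_self (2 * Real.pi * (ξ - η) * (2 * Real.pi * η))
  rw [jb, Real.sqrt_le_left (add_pos (jb_pos _) (jb_pos _)).le]
  nlinarith

lemma abs_jb_sub_le (ξ η : ℝ) : |jb ξ - jb η| ≤ jb (ξ - η) := by
  have h1 := jb_le_add ξ η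
  have h2 := jb_le_add η ξ
  rw [jb_sub_comm η ξ] at h2
  rw [abs_le]; constructor <;> linarith

lemma add_rpow_le {x y r : ℝ} (hx : 0 ≤ x) (hy : 0 ≤ y) (hr : 0 ≤ r) :
    (x + y) ^ r ≤ 2 ^ r * (x ^ r + y ^ r) := by
  have hm : x + y ≤ 2 * max x y := by
    have := le_max_left x y; have := le_max_right x y; linarith
  calc (x + y) ^ r ≤ (2 * max x y) ^ r := Real.rpow_le_rpow (by positivity) hm hr
    _ = 2 ^ r * (max x y) ^ r := Real.mul_rpow (by norm_num) (by positivity)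
    _ ≤ _ := by
      gcongr
      rcases max_choice x y with h | h <;> rw [h]
      · linarith [Real.rpow_nonneg hy r]
      · linarith [Real.rpow_nonneg hx r]

/-- Bernoulli's inequality for `y / x`: the convex power lies above its tangent at `x`. No order
between `x` and `y` is needed. -/
lemma rpow_sub_rpow_le {x y s : ℝ} (hx : 0 < x) (hy : 0 ≤ y) (hs : 1 ≤ s) :
    x ^ s - y ^ s ≤ s * x ^ (s - 1) * (x - y) := by
  have h := one_add_mul_self_le_rpow_one_add (s := y / x - 1) (by
    have : 0 ≤ y / x := by positivity
    linarith) hs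
  rw [show 1 + (y / x - 1) = y / x by ring, Real.div_rpow hy hx.le,
    le_div_iff₀ (Real.rpow_pos_of_pos hx s)] at h
  have hxs : x ^ s = x ^ (s - 1) * x := by
    rw [← Real.rpow_add_one hx.ne']; congr 1; ring
  have : (1 + s * (y / x - 1)) * x ^ s = x ^ s - s * x ^ (s - 1) * (x - y) := by
    rw [hxs]; field_simp; ring
  linarith

lemma abs_rpow_sub_rpow_le {x y s : ℝ} (hx : 0 < x) (hy : 0 < y) (hs : 1 ≤ s) :
    |x ^ s - y ^ s| ≤ s * (max x y) ^ (s - 1) * |x - y| := by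
  rcases le_total y x with h | h
  · rw [abs_of_nonneg (sub_nonneg.2 (Real.rpow_le_rpow hy.le h (by linarith))),
      abs_of_nonneg (sub_nonneg.2 h), max_eq_left h]
    exact rpow_sub_rpow_le hx hy.le hs
  · rw [abs_sub_comm, abs_sub_comm x y,
      abs_of_nonneg (sub_nonneg.2 (Real.rpow_le_rpow hx.le h (by linarith))),
      abs_of_nonneg (sub_nonneg.2 h), max_eq_right h]
    exact rpow_sub_rpow_le hy hx.le hs

/-- The weight `⟨ξ⟩^{-(s-1)}`. -/
def wt (s : ℝ) (ξ : ℝ) : ℝ := jb ξ ^ (-(s - 1))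

lemma continuous_jb_rpow (r : ℝ) : Continuous fun ξ => jb ξ ^ r :=
  continuous_jb.rpow_const fun ξ => Or.inl (jb_pos ξ).ne'

@[fun_prop]
lemma measurable_jb : Measurable jb := continuous_jb.measurable

lemma jb_rpow_pos (r ξ : ℝ) : 0 < jb ξ ^ r := Real.rpow_pos_of_pos (jb_pos ξ) r

lemma jb_rpow_le_one {r : ℝ} (hr : r ≤ 0) (ξ : ℝ) : jb ξ ^ r ≤ 1 :=
  Real.rpow_le_one_of_one_le_of_nonpos (one_le_jb ξ) hr

lemma jb_rpow_le_rpow {r r' : ℝ} (h : r ≤ r') (ξ : ℝ) : jb ξ ^ r ≤ jb ξ ^ r' :=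
  Real.rpow_le_rpow_of_exponent_le (one_le_jb ξ) h

/-- The threshold `s > 3/2` is exactly `2(s - 1) > 1`, the condition for `⟨ξ⟩^{-2(s-1)}` to be
integrable on the line. -/
lemma isWeight_wt {s : ℝ} (hs : 3 / 2 < s) : IsWeight (wt s) := by
  have hc : Continuous (wt s) := continuous_jb_rpow _
  refine ⟨hc.measurable, fun x => (jb_rpow_pos _ x).le, ?_⟩
  rw [memLp_two_iff_integrable_sq hc.aestronglyMeasurable]
  have h1 : Integrable (fun x : ℝ => (1 + ‖x‖ ^ 2) ^ (-(2 * (s - 1)) / 2)) volume :=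
    integrable_rpow_neg_one_add_norm_sq (by simp; linarith)
  have h2 := h1.comp_mul_left' (R := 2 * Real.pi) (by positivity)
  refine h2.congr (ae_of_all _ fun ξ => ?_)
  simp only [wt]
  rw [← jb_rpow_sq, Real.norm_eq_abs, sq_abs]
  congr 1
  ring

/-- The kernel of the product, in `H^{s-1}`, of a function in `H^s` and a function in `H^{s-1}`. -/
def kProd (s ξ η : ℝ) : ℝ := jb ξ ^ (s - 1) * jb (ξ - η) ^ (-s) * jb η ^ (-(s - 1))

/-- The kernel of the commutator of `(1 - ∂²)^{s/2}` with the multiplication by a function in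
`H^s`, acting on `H^{s-1}`. -/
def kComm (s ξ η : ℝ) : ℝ := (jb ξ ^ s - jb η ^ s) * jb (ξ - η) ^ (-s) * jb η ^ (-(s - 1))

/-- The kernel of the multiplication by a function in `H^r`, acting on `L²`. -/
def kMul (r ξ η : ℝ) : ℝ := jb (ξ - η) ^ (-r)

lemma jb_rpow_le_add {r : ℝ} (hr : 0 ≤ r) (ξ η : ℝ) :
    (max (jb ξ) (jb η)) ^ r ≤ 2 ^ r * (jb (ξ - η) ^ r + jb η ^ r) := by
  refine le_trans ?_ (add_rpow_le (jb_pos (ξ - η)).le (jb_pos η).le hr)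
  refine Real.rpow_le_rpow (le_max_of_le_left (jb_pos ξ).le) (max_le (jb_le_add ξ η) ?_) hr
  linarith [jb_pos (ξ - η)]

lemma jb_rpow_mul (r r' ξ : ℝ) : jb ξ ^ r * jb ξ ^ r' = jb ξ ^ (r + r') :=
  (Real.rpow_add (jb_pos ξ) r r').symm

/-- Distributing `⟨ξ⟩^{s-1}` over the two frequencies leaves `⟨ξ - η⟩^{-1} ⟨η⟩^{-(s-1)}` and `⟨ξ -
η⟩^{-s}`; each is below a value of the weight. -/
lemma isKernel_kProd {s : ℝ} (hs : 3 / 2 < s) : IsKernel (wt s) (kProd s) (2 ^ (s - 1)) := by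
  refine ⟨by unfold kProd; fun_prop, by positivity, fun ξ η => ?_⟩
  have h1 := (Real.rpow_le_rpow (jb_pos ξ).le (le_max_left _ (jb η)) (by linarith)).trans
    (jb_rpow_le_add (r := s - 1) (by linarith) ξ η)
  have p1 := jb_rpow_pos (-s) (ξ - η)
  have p2 := jb_rpow_pos (-(s - 1)) η
  have p3 := jb_rpow_pos (s - 1) ξ
  rw [kProd, abs_of_pos (by positivity)]
  calc jb ξ ^ (s - 1) * jb (ξ - η) ^ (-s) * jb η ^ (-(s - 1))
      ≤ (2 ^ (s - 1) * (jb (ξ - η) ^ (s - 1) + jb η ^ (s - 1))) * jb (ξ - η) ^ (-s)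
        * jb η ^ (-(s - 1)) := by gcongr
    _ = 2 ^ (s - 1) * ((jb (ξ - η) ^ (s - 1) * jb (ξ - η) ^ (-s)) * jb η ^ (-(s - 1))
        + (jb η ^ (s - 1) * jb η ^ (-(s - 1))) * jb (ξ - η) ^ (-s)) := by ring
    _ = 2 ^ (s - 1) * (jb (ξ - η) ^ (-1 : ℝ) * wt s η + jb (ξ - η) ^ (-s)) := by
        rw [jb_rpow_mul, jb_rpow_mul, add_neg_cancel, Real.rpow_zero, one_mul, wt,
          show s - 1 + -s = -1 by ring]
    _ ≤ 2 ^ (s - 1) * (1 * wt s η + wt s (ξ - η)) := by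
        have := jb_rpow_le_one (r := -1) (by norm_num) (ξ - η)
        have h3 : jb (ξ - η) ^ (-s) ≤ wt s (ξ - η) := jb_rpow_le_rpow (by linarith) _
        have h4 : 0 ≤ wt s η := p2.le
        gcongr
    _ = _ := by ring

/-- The mean value bound `|⟨ξ⟩^s - ⟨η⟩^s| ≤ s max(⟨ξ⟩, ⟨η⟩)^{s-1} ⟨ξ - η⟩` leaves only `s - 1`
powers to distribute: one derivative has moved to the coefficient. This is what makes the energy
estimate free of `ε^{-1/2}`. -/
lemma isKernel_kComm {s : ℝ} (hs : 3 / 2 < s) : IsKernel (wt s) (kComm s) (s * 2 ^ (s - 1)) := by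
  refine ⟨by unfold kComm; fun_prop, by positivity, fun ξ η => ?_⟩
  have h1 := jb_rpow_le_add (r := s - 1) (by linarith) ξ η
  have h2 := abs_rpow_sub_rpow_le (s := s) (jb_pos ξ) (jb_pos η) (by linarith)
  have h3 := abs_jb_sub_le ξ η
  have p1 := jb_rpow_pos (-s) (ξ - η)
  have p2 := jb_rpow_pos (-(s - 1)) η
  have p3 := jb_rpow_pos (s - 1) (ξ - η)
  have p4 := jb_rpow_pos (s - 1) η
  have hs0 : 0 < s := by linarith
  rw [kComm, abs_mul, abs_mul, abs_of_pos p1, abs_of_pos p2]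
  calc |jb ξ ^ s - jb η ^ s| * jb (ξ - η) ^ (-s) * jb η ^ (-(s - 1))
      ≤ (s * (2 ^ (s - 1) * (jb (ξ - η) ^ (s - 1) + jb η ^ (s - 1))) * jb (ξ - η))
        * jb (ξ - η) ^ (-s) * jb η ^ (-(s - 1)) := by
        gcongr
        refine h2.trans ?_
        gcongr
    _ = s * 2 ^ (s - 1) * ((jb (ξ - η) ^ (s - 1) * jb (ξ - η) ^ (1 : ℝ) * jb (ξ - η) ^ (-s))
          * jb η ^ (-(s - 1))
        + (jb η ^ (s - 1) * jb η ^ (-(s - 1))) * (jb (ξ - η) ^ (1 : ℝ) * jb (ξ - η) ^ (-s))) := by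
        rw [Real.rpow_one]; ring
    _ = _ := by
        rw [jb_rpow_mul, jb_rpow_mul, jb_rpow_mul, jb_rpow_mul, add_neg_cancel, Real.rpow_zero,
          show s - 1 + 1 + -s = 0 by ring, Real.rpow_zero, wt, wt,
          show 1 + -s = -(s - 1) by ring]
        ring

/-- Needed for `r = s`, and for the borderline `r = s - 1` when a derivative has fallen on the
coefficient. -/
lemma isKernel_kMul {s r : ℝ} (hr : s - 1 ≤ r) : IsKernel (wt s) (kMul r) 1 := by
  refine ⟨by unfold kMul; fun_prop, by positivity, fun ξ η => ?_⟩
  rw [kMul, abs_of_pos (jb_rpow_pos _ _), one_mul]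
  have h1 : jb (ξ - η) ^ (-r) ≤ wt s (ξ - η) := jb_rpow_le_rpow (by linarith) _
  have h2 : 0 < wt s η := jb_rpow_pos _ _
  linarith

lemma kProd_neg (s ξ η : ℝ) : kProd s (-ξ) (-η) = kProd s ξ η := by
  rw [kProd, kProd, jb_neg, jb_neg, show -ξ - -η = -(ξ - η) by ring, jb_neg]

lemma kMul_comm (r ξ η : ℝ) : kMul r ξ η = kMul r η ξ := by rw [kMul, kMul, jb_sub_comm]

end Kernels

/-! ### The abstract system on the Fourier side -/

section Coercive

variable {E : Type*} [NormedAddCommGroup E] [InnerProductSpace ℝ E] [FiniteDimensional ℝ E]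
  [CompleteSpace E]

lemma isUnit_of_coercive {A : E →L[ℝ] E} {κ : ℝ} (hκ : 0 < κ) (hA : ∀ x, κ * ‖x‖ ^ 2 ≤ ⟪A x, x⟫) :
    IsUnit A := by
  have hinj : Function.Injective A := by
    rw [injective_iff_map_eq_zero]
    intro x hx
    have h := hA x
    rw [hx, inner_zero_left] at h
    by_contra hne
    have : 0 < ‖x‖ := norm_pos_iff.2 hne
    have : 0 < κ * ‖x‖ ^ 2 := by positivity
    linarith
  rw [ContinuousLinearMap.isUnit_iff_bijective]
  exact ⟨hinj, (LinearMap.injective_iff_surjective (f := A.toLinearMap)).1 hinj⟩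

lemma norm_inverse_le_of_coercive {A : E →L[ℝ] E} {κ : ℝ} (hκ : 0 < κ)
    (hA : ∀ x, κ * ‖x‖ ^ 2 ≤ ⟪A x, x⟫) : ‖Ring.inverse A‖ ≤ κ⁻¹ := by
  refine ContinuousLinearMap.opNorm_le_bound _ (by positivity) fun x => ?_
  set y := Ring.inverse A x
  have hy : A y = x := by
    change (A * Ring.inverse A) x = x
    rw [Ring.mul_inverse_cancel _ (isUnit_of_coercive hκ hA)]; rfl
  have h := hA y
  rw [hy] at h
  have h2 := real_inner_le_norm x y
  rw [inv_mul_eq_div, le_div_iff₀ hκ]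
  by_cases h0 : ‖y‖ = 0
  · rw [h0]; simp
  · have hp : 0 < ‖y‖ := lt_of_le_of_ne (norm_nonneg _) (Ne.symm h0)
    refine le_of_mul_le_mul_right ?_ hp
    linarith [sq ‖y‖]

end Coercive

/-- An operator that is self-adjoint and commutes with the complex structure and the conjugation. -/
structure IsLinCoeff {E : Type*} [NormedAddCommGroup E] [InnerProductSpace ℝ E]
    (I c : E →L[ℝ] E) (K : ℝ) (A : E →L[ℝ] E) : Prop where
  symm : ∀ x y, ⟪A x, y⟫ = ⟪x, A y⟫
  comm_I : ∀ x, A (I x) = I (A x)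
  comm_c : ∀ x, A (c x) = c (A x)
  bound : ‖A‖ ≤ K

/-- A complex bilinear operator that commutes with the conjugation and whose values at real vectors
are self-adjoint. -/
structure IsQuadCoeff {E : Type*} [NormedAddCommGroup E] [InnerProductSpace ℝ E]
    (I c : E →L[ℝ] E) (K : ℝ) (b : E →L[ℝ] E →L[ℝ] E) : Prop where
  symm : ∀ u x y, ⟪b u x, y⟫ = ⟪x, b (c u) y⟫
  I_left : ∀ u x, b (I u) x = I (b u x)
  I_right : ∀ u x, b u (I x) = I (b u x)
  comm_c : ∀ u x, c (b u x) = b (c u) (c x)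
  bound : ‖b‖ ≤ K

/-- The coefficients of the system
`(S₀ + ε (S₁(U) - S₂ ∂²)) ∂ₜU + (N₀ + ε (N₁(U) - N₂ ∂²)) ∂U = 0`, acting on the values of Fourier
transforms; `I` is the multiplication by `i` and `c` the complex conjugation. -/
structure Model (E : Type*) [NormedAddCommGroup E] [InnerProductSpace ℝ E] (κ K s : ℝ) where
  ε : ℝ
  I : E →L[ℝ] E
  c : E →L[ℝ] E
  S₀ : E →L[ℝ] E
  S₂ : E →L[ℝ] E
  N₀ : E →L[ℝ] E
  N₂ : E →L[ℝ] E
  S₁ : E →L[ℝ] E →L[ℝ] E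
  N₁ : E →L[ℝ] E →L[ℝ] E
  hs : 3 / 2 < s
  hκ : 0 < κ
  hε : 0 < ε
  hε1 : ε ≤ 1
  I_skew : ∀ x y, ⟪I x, y⟫ = -⟪x, I y⟫
  norm_I : ∀ x, ‖I x‖ ≤ ‖x‖
  c_c : ∀ x, c (c x) = x
  norm_c : ∀ x, ‖c x‖ = ‖x‖
  c_I : ∀ x, c (I x) = -I (c x)
  hS₀ : IsLinCoeff I c K S₀
  hS₂ : IsLinCoeff I c K S₂
  hN₀ : IsLinCoeff I c K N₀
  hN₂ : IsLinCoeff I c K N₂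
  hS₁ : IsQuadCoeff I c K S₁
  hN₁ : IsQuadCoeff I c K N₁
  coercive₀ : ∀ x, κ * ‖x‖ ^ 2 ≤ ⟪S₀ x, x⟫
  coercive₂ : ∀ x, κ * ‖x‖ ^ 2 ≤ ⟪S₂ x, x⟫

namespace Model

variable {E : Type*} [NormedAddCommGroup E] [InnerProductSpace ℝ E] {κ K s : ℝ}
variable (Q : Model E κ K s)

lemma K_nonneg (Q : Model E κ K s) : 0 ≤ K := (norm_nonneg _).trans Q.hS₀.bound

/-- `θ(ξ) = (1 + ε ⟨ξ⟩²)^{1/2}` -/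
def θ (ξ : ℝ) : ℝ := √(1 + Q.ε * jb ξ ^ 2)

lemma θ_sq (ξ : ℝ) : Q.θ ξ ^ 2 = 1 + Q.ε * jb ξ ^ 2 :=
  Real.sq_sqrt (by have := Q.hε; positivity)

lemma one_le_θ (ξ : ℝ) : 1 ≤ Q.θ ξ := by
  rw [θ, Real.one_le_sqrt]; nlinarith [sq_nonneg (jb ξ), Q.hε]

lemma θ_pos (ξ : ℝ) : 0 < Q.θ ξ := zero_lt_one.trans_le (Q.one_le_θ ξ)

lemma θ_neg (ξ : ℝ) : Q.θ (-ξ) = Q.θ ξ := by rw [θ, θ, jb_neg]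

lemma continuous_θ : Continuous Q.θ := by
  have := continuous_jb
  unfold θ; fun_prop

lemma inv_θ_le_one (ξ : ℝ) : (Q.θ ξ)⁻¹ ≤ 1 := inv_le_one_of_one_le₀ (Q.one_le_θ ξ)

/-- One derivative is traded for `ε^{-1/2}`. Such bounds serve the theory for fixed `ε` only; the
size of the energy derivative is estimated without them. -/
lemma jb_div_θ_le (ξ : ℝ) : jb ξ * (Q.θ ξ)⁻¹ ≤ (√Q.ε)⁻¹ := by
  have h1 : √Q.ε * jb ξ ≤ Q.θ ξ := by
    rw [θ]
    refine Real.le_sqrt_of_sq_le ?_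
    rw [mul_pow, Real.sq_sqrt Q.hε.le]; linarith
  have h2 : 0 < √Q.ε := Real.sqrt_pos.2 Q.hε
  rw [← div_eq_mul_inv, div_le_iff₀ (Q.θ_pos ξ), inv_mul_eq_div, le_div_iff₀ h2]
  linarith

lemma inv_jb_le_one (ξ : ℝ) : (jb ξ)⁻¹ ≤ 1 := inv_le_one_of_one_le₀ (one_le_jb ξ)

lemma continuous_inv_θ : Continuous fun ξ => (Q.θ ξ)⁻¹ :=
  Q.continuous_θ.inv₀ fun ξ => (Q.θ_pos ξ).ne'

lemma continuous_inv_jb : Continuous fun ξ => (jb ξ)⁻¹ :=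
  continuous_jb.inv₀ fun ξ => (jb_pos ξ).ne'

/-- `q(ξ) = 2πξ` -/
def q (ξ : ℝ) : ℝ := 2 * Real.pi * ξ

@[fun_prop]
lemma continuous_q : Continuous q := by unfold q; fun_prop

lemma q_neg (ξ : ℝ) : q (-ξ) = -q ξ := by simp [q]

/-- The symbol `S₀ + ε q² S₂`. -/
def M (ξ : ℝ) : E →L[ℝ] E := Q.S₀ + (Q.ε * q ξ ^ 2) • Q.S₂

/-- The symbol `N₀ + ε q² N₂`. -/
def N (ξ : ℝ) : E →L[ℝ] E := Q.N₀ + (Q.ε * q ξ ^ 2) • Q.N₂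

lemma continuous_M : Continuous Q.M := by unfold M; fun_prop

lemma continuous_N : Continuous Q.N := by unfold N; fun_prop

lemma εq_nonneg (ξ : ℝ) : 0 ≤ Q.ε * q ξ ^ 2 := by have := Q.hε; positivity

lemma θ_sq' (ξ : ℝ) : Q.θ ξ ^ 2 = 1 + Q.ε + Q.ε * q ξ ^ 2 := by rw [θ_sq, jb_sq, q]; ring

lemma norm_M_le (ξ : ℝ) : ‖Q.M ξ‖ ≤ K * Q.θ ξ ^ 2 := by
  have h1 := Q.hS₀.bound
  have h2 := Q.hS₂.bound
  have h0 := Q.εq_nonneg ξ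
  calc ‖Q.M ξ‖ ≤ ‖Q.S₀‖ + ‖(Q.ε * q ξ ^ 2) • Q.S₂‖ := norm_add_le _ _
    _ = ‖Q.S₀‖ + (Q.ε * q ξ ^ 2) * ‖Q.S₂‖ := by rw [norm_smul, Real.norm_of_nonneg h0]
    _ ≤ K + (Q.ε * q ξ ^ 2) * K := by gcongr
    _ ≤ _ := by rw [θ_sq']; nlinarith [Q.hε, Q.K_nonneg]

lemma norm_N_le (ξ : ℝ) : ‖Q.N ξ‖ ≤ K * Q.θ ξ ^ 2 := by
  have h1 := Q.hN₀.bound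
  have h2 := Q.hN₂.bound
  have h0 := Q.εq_nonneg ξ
  calc ‖Q.N ξ‖ ≤ ‖Q.N₀‖ + ‖(Q.ε * q ξ ^ 2) • Q.N₂‖ := norm_add_le _ _
    _ = ‖Q.N₀‖ + (Q.ε * q ξ ^ 2) * ‖Q.N₂‖ := by rw [norm_smul, Real.norm_of_nonneg h0]
    _ ≤ K + (Q.ε * q ξ ^ 2) * K := by gcongr
    _ ≤ _ := by rw [θ_sq']; nlinarith [Q.hε, Q.K_nonneg]

/-- The half is lost in `θ² = 1 + ε + ε q² ≤ 2 (1 + ε q²)`, by `ε ≤ 1`. -/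
lemma coercive_M (ξ : ℝ) (x : E) : κ / 2 * Q.θ ξ ^ 2 * ‖x‖ ^ 2 ≤ ⟪Q.M ξ x, x⟫ := by
  have h0 := Q.εq_nonneg ξ
  have h1 : ⟪Q.M ξ x, x⟫ = ⟪Q.S₀ x, x⟫ + (Q.ε * q ξ ^ 2) * ⟪Q.S₂ x, x⟫ := by
    simp [M, inner_add_left, inner_smul_left]
  rw [h1, θ_sq']
  have h2 : 0 ≤ κ * ‖x‖ ^ 2 := by have := Q.hκ; positivity
  nlinarith [Q.coercive₀ x, mul_le_mul_of_nonneg_left (Q.coercive₂ x) h0, Q.hε1, Q.hε,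
    mul_nonneg h0 h2]

lemma M_symm (ξ : ℝ) (x y : E) : ⟪Q.M ξ x, y⟫ = ⟪x, Q.M ξ y⟫ := by
  simp [M, inner_add_left, inner_smul_left, inner_add_right, inner_smul_right, Q.hS₀.symm,
    Q.hS₂.symm]

lemma N_symm (ξ : ℝ) (x y : E) : ⟪Q.N ξ x, y⟫ = ⟪x, Q.N ξ y⟫ := by
  simp [N, inner_add_left, inner_smul_left, inner_add_right, inner_smul_right, Q.hN₀.symm,
    Q.hN₂.symm]

lemma M_I (ξ : ℝ) : Q.M ξ * Q.I = Q.I * Q.M ξ := by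
  ext x; simp [M, Q.hS₀.comm_I, Q.hS₂.comm_I]

lemma N_I (ξ : ℝ) : Q.N ξ * Q.I = Q.I * Q.N ξ := by
  ext x; simp [N, Q.hN₀.comm_I, Q.hN₂.comm_I]

lemma M_c (ξ : ℝ) : Q.M ξ * Q.c = Q.c * Q.M ξ := by
  ext x; simp [M, Q.hS₀.comm_c, Q.hS₂.comm_c]

lemma N_c (ξ : ℝ) : Q.N ξ * Q.c = Q.c * Q.N ξ := by
  ext x; simp [N, Q.hN₀.comm_c, Q.hN₂.comm_c]

lemma M_neg (ξ : ℝ) : Q.M (-ξ) = Q.M ξ := by simp [M, q_neg]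

lemma N_neg (ξ : ℝ) : Q.N (-ξ) = Q.N ξ := by simp [N, q_neg]

lemma norm_I_le : ‖Q.I‖ ≤ 1 :=
  ContinuousLinearMap.opNorm_le_bound _ zero_le_one fun x => by simpa using Q.norm_I x

/-- The inverse of `M`. -/
def Minv (ξ : ℝ) : E →L[ℝ] E := Ring.inverse (Q.M ξ)

lemma Minv_neg (ξ : ℝ) : Q.Minv (-ξ) = Q.Minv ξ := by rw [Minv, Minv, M_neg]

section

variable [FiniteDimensional ℝ E] [CompleteSpace E]

lemma coeff_pos (ξ : ℝ) : 0 < κ / 2 * Q.θ ξ ^ 2 := by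
  have := Q.hκ; have := Q.θ_pos ξ; positivity

lemma isUnit_M (ξ : ℝ) : IsUnit (Q.M ξ) := isUnit_of_coercive (Q.coeff_pos ξ) (Q.coercive_M ξ)

lemma M_mul_Minv (ξ : ℝ) : Q.M ξ * Q.Minv ξ = 1 := Ring.mul_inverse_cancel _ (Q.isUnit_M ξ)

lemma Minv_mul_M (ξ : ℝ) : Q.Minv ξ * Q.M ξ = 1 := Ring.inverse_mul_cancel _ (Q.isUnit_M ξ)

lemma continuous_Minv : Continuous Q.Minv := by
  refine continuous_iff_continuousAt.2 fun ξ => ?_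
  obtain ⟨u, hu⟩ := Q.isUnit_M ξ
  have h := NormedRing.inverse_continuousAt u
  rw [hu] at h
  exact ContinuousAt.comp (f := Q.M) h Q.continuous_M.continuousAt

lemma norm_Minv_le (ξ : ℝ) : ‖Q.Minv ξ‖ ≤ 2 / κ * (Q.θ ξ)⁻¹ ^ 2 := by
  have := norm_inverse_le_of_coercive (Q.coeff_pos ξ) (Q.coercive_M ξ)
  refine this.trans_eq ?_
  rw [mul_inv, inv_div, inv_pow]

lemma Minv_comm {A : E →L[ℝ] E} {ξ : ℝ} (h : Q.M ξ * A = A * Q.M ξ) :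
    Q.Minv ξ * A = A * Q.Minv ξ := by
  calc Q.Minv ξ * A = Q.Minv ξ * A * (Q.M ξ * Q.Minv ξ) := by rw [M_mul_Minv, mul_one]
    _ = Q.Minv ξ * (A * Q.M ξ) * Q.Minv ξ := by simp only [mul_assoc]
    _ = Q.Minv ξ * Q.M ξ * (A * Q.Minv ξ) := by rw [← h]; simp only [mul_assoc]
    _ = _ := by rw [Minv_mul_M, one_mul]

lemma Minv_c (ξ : ℝ) : Q.Minv ξ * Q.c = Q.c * Q.Minv ξ := Q.Minv_comm (Q.M_c ξ)

/-- The symbol `-i q M⁻¹ N` of the linear part of the evolution. -/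
def Lsym (ξ : ℝ) : E →L[ℝ] E := (-q ξ) • (Q.I * (Q.Minv ξ * Q.N ξ))

/-- The bound `2 K / κ` for `M⁻¹ N`. -/
def Λ (_ : Model E κ K s) : ℝ := 2 * K / κ

lemma Λ_nonneg : 0 ≤ Q.Λ := by have := Q.hκ; have := Q.K_nonneg; unfold Λ; positivity

/-- The factors `θ²` of `M` and `N` cancel, so the linear part loses one derivative with a constant
independent of `ε`. -/
lemma norm_Minv_mul_N_le (ξ : ℝ) : ‖Q.Minv ξ * Q.N ξ‖ ≤ Q.Λ := by
  refine (norm_mul_le _ _).trans ?_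
  have h := mul_le_mul (Q.norm_Minv_le ξ) (Q.norm_N_le ξ) (norm_nonneg _)
    (by have := Q.hκ; positivity)
  refine h.trans_eq ?_
  have := (Q.θ_pos ξ).ne'
  rw [Λ]
  field_simp

lemma norm_Lsym_le (ξ : ℝ) : ‖Q.Lsym ξ‖ ≤ jb ξ * Q.Λ := by
  rw [Lsym, norm_smul, norm_neg, Real.norm_eq_abs]
  have h1 : ‖Q.I * (Q.Minv ξ * Q.N ξ)‖ ≤ 1 * Q.Λ := (norm_mul_le _ _).trans
    (mul_le_mul Q.norm_I_le (Q.norm_Minv_mul_N_le ξ) (norm_nonneg _) zero_le_one)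
  rw [one_mul] at h1
  exact mul_le_mul (abs_le_jb ξ) h1 (norm_nonneg _) (jb_pos ξ).le

lemma continuous_Lsym : Continuous Q.Lsym := by
  have := Q.continuous_Minv
  have := Q.continuous_N
  unfold Lsym; fun_prop

lemma M_mul_Lsym (ξ : ℝ) : Q.M ξ * Q.Lsym ξ = (-q ξ) • (Q.I * Q.N ξ) := by
  rw [Lsym, mul_smul_comm, ← mul_assoc, M_I, mul_assoc, ← mul_assoc (Q.M ξ), M_mul_Minv, one_mul]

/-- `M L = -i q N`, where `N` is symmetric and commutes with the skew operator `i`. Hence `L` is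
skew for the form of `M`, although not for the inner product of `E`. -/
lemma Lsym_skew (ξ : ℝ) (x y : E) : ⟪Q.M ξ (Q.Lsym ξ x), y⟫ = -⟪Q.M ξ x, Q.Lsym ξ y⟫ := by
  have h : ∀ x, Q.M ξ (Q.Lsym ξ x) = (-q ξ) • Q.I (Q.N ξ x) := fun x =>
    congrArg (fun A : E →L[ℝ] E => A x) (Q.M_mul_Lsym ξ)
  have hNI : Q.N ξ (Q.I y) = Q.I (Q.N ξ y) := congrArg (fun A : E →L[ℝ] E => A y) (Q.N_I ξ)
  rw [Q.M_symm ξ x, h, h, inner_smul_left, inner_smul_right, Q.I_skew, Q.N_symm, hNI]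
  simp

/-- Conjugation anticommutes with `i` and reflection changes the sign of `q`, so the two signs
cancel: the linear evolution preserves real functions. -/
lemma c_Lsym (ξ : ℝ) : Q.c * Q.Lsym (-ξ) = Q.Lsym ξ * Q.c := by
  have hcI : Q.c * Q.I = -(Q.I * Q.c) := by ext x; simp [Q.c_I]
  rw [Lsym, Lsym, Minv_neg, N_neg, q_neg, neg_neg, mul_smul_comm, smul_mul_assoc, ← mul_assoc, hcI,
    neg_mul, mul_assoc, ← mul_assoc Q.c, ← Minv_c, mul_assoc (Q.Minv ξ), ← N_c]
  simp only [mul_assoc, smul_neg, neg_smul]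

/-! #### The group of the linear part -/

/-- `exp(t L)` -/
def prop (t ξ : ℝ) : E →L[ℝ] E := NormedSpace.exp (t • Q.Lsym ξ)

lemma hasDerivAt_prop (t ξ : ℝ) :
    HasDerivAt (fun t => Q.prop t ξ) (Q.Lsym ξ * Q.prop t ξ) t :=
  hasDerivAt_exp_smul_const' (𝕂 := ℝ) (Q.Lsym ξ) t

lemma inner_M_prop (t ξ : ℝ) (x y : E) :
    ⟪Q.M ξ (Q.prop t ξ x), Q.prop t ξ y⟫ = ⟪Q.M ξ x, y⟫ := by
  have hd : ∀ x t, HasDerivAt (fun t => Q.prop t ξ x) (Q.Lsym ξ (Q.prop t ξ x)) t := fun x t =>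
    ((ContinuousLinearMap.apply ℝ E x).hasFDerivAt.comp_hasDerivAt t (Q.hasDerivAt_prop t ξ))
  have hM : ∀ t, HasDerivAt (fun t => Q.M ξ (Q.prop t ξ x)) (Q.M ξ (Q.Lsym ξ (Q.prop t ξ x))) t :=
    fun t => (Q.M ξ).hasFDerivAt.comp_hasDerivAt t (hd x t)
  have hdi : ∀ t, HasDerivAt (fun t => ⟪Q.M ξ (Q.prop t ξ x), Q.prop t ξ y⟫) 0 t := by
    intro t
    have h := (hM t).inner ℝ (hd y t)
    rw [Q.Lsym_skew] at h
    simpa using h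
  have hconst := is_const_of_deriv_eq_zero (fun t => (hdi t).differentiableAt)
    (fun t => (hdi t).deriv) t 0
  simpa [prop] using hconst

/-- The bound for the group of the linear part. -/
def Γ (Q : Model E κ K s) : ℝ := √Q.Λ

/-- The group conserves the form of `M`, which lies between `κ/2` and `K` times `θ² |x|²`. The
factor `θ²` drops out, so that the bound depends neither on `t` nor on `ξ`. -/
lemma norm_prop_le (t ξ : ℝ) : ‖Q.prop t ξ‖ ≤ Q.Γ := by
  refine ContinuousLinearMap.opNorm_le_bound _ (Real.sqrt_nonneg _) fun x => ?_
  have h1 := Q.coercive_M ξ (Q.prop t ξ x)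
  rw [inner_M_prop] at h1
  have h2 : ⟪Q.M ξ x, x⟫ ≤ K * Q.θ ξ ^ 2 * ‖x‖ ^ 2 := by
    refine (real_inner_le_norm _ _).trans ?_
    rw [sq ‖x‖, ← mul_assoc]
    gcongr
    exact (Q.M ξ).le_of_opNorm_le (Q.norm_M_le ξ) x
  have hθ : 0 < Q.θ ξ ^ 2 := by have := Q.θ_pos ξ; positivity
  have h3 : ‖Q.prop t ξ x‖ ^ 2 ≤ Q.Λ * ‖x‖ ^ 2 := by
    have h4 : Q.θ ξ ^ 2 * (κ / 2 * ‖Q.prop t ξ x‖ ^ 2) ≤ Q.θ ξ ^ 2 * (K * ‖x‖ ^ 2) := by linarith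
    have h5 := le_of_mul_le_mul_left h4 hθ
    have hκ := Q.hκ
    rw [Λ, div_mul_eq_mul_div, le_div_iff₀ hκ]
    linarith
  refine le_of_sq_le_sq ?_ (by unfold Γ; positivity)
  rwa [mul_pow, Γ, Real.sq_sqrt Q.Λ_nonneg]

lemma isMult_prop (t : ℝ) : IsMult (Q.prop t) Q.Γ :=
  ⟨by have hL := Q.continuous_Lsym
      let _ : NormedAlgebra ℚ (E →L[ℝ] E) := NormedAlgebra.restrictScalars ℚ ℝ _
      exact NormedSpace.exp_continuous.comp (hL.const_smul t), Q.norm_prop_le t⟩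

lemma prop_mul_prop_neg (t ξ : ℝ) : Q.prop t ξ * Q.prop (-t) ξ = 1 := by
  let _ : NormedAlgebra ℚ (E →L[ℝ] E) := NormedAlgebra.restrictScalars ℚ ℝ _
  rw [prop, prop, ← NormedSpace.exp_add_of_commute]
  · simp
  · exact ((Commute.refl (Q.Lsym ξ)).smul_left t).smul_right (-t)

lemma Lsym_comm_prop (t ξ : ℝ) : Q.Lsym ξ * Q.prop t ξ = Q.prop t ξ * Q.Lsym ξ :=
  (((Commute.refl (Q.Lsym ξ)).smul_right t).exp_right).eq

lemma c_prop (t ξ : ℝ) : Q.c * Q.prop t (-ξ) = Q.prop t ξ * Q.c := by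
  let _ : NormedAlgebra ℚ (E →L[ℝ] E) := NormedAlgebra.restrictScalars ℚ ℝ _
  have hcc : Q.c * Q.c = 1 := by ext x; simp [Q.c_c]
  let u : (E →L[ℝ] E)ˣ := ⟨Q.c, Q.c, hcc, hcc⟩
  have h1 : t • Q.Lsym ξ = (u : E →L[ℝ] E) * (t • Q.Lsym (-ξ)) * (↑u⁻¹ : E →L[ℝ] E) := by
    change _ = Q.c * (t • Q.Lsym (-ξ)) * Q.c
    rw [mul_smul_comm, c_Lsym, smul_mul_assoc, mul_assoc, hcc, mul_one]
  rw [prop, prop, h1, NormedSpace.exp_units_conj]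
  change _ = Q.c * _ * Q.c * Q.c
  rw [mul_assoc _ Q.c Q.c, hcc, mul_one]

/-- The group of the linear part, on `L²`. -/
def G (t : ℝ) : L2 E →L[ℝ] L2 E := mulOp (Q.prop t)

lemma norm_G_le (t : ℝ) (f : L2 E) : ‖Q.G t f‖ ≤ Q.Γ * ‖f‖ := norm_mulOp_le (Q.isMult_prop t) f

lemma G_G_neg (t : ℝ) (f : L2 E) : Q.G t (Q.G (-t) f) = f := by
  rw [G, G, mulOp_mulOp (Q.isMult_prop t) (Q.isMult_prop (-t))]
  simp_rw [prop_mul_prop_neg]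
  exact mulOp_one f

lemma G_zero (f : L2 E) : Q.G 0 f = f := by
  have : Q.prop 0 = fun _ => 1 := by ext ξ; simp [prop]
  rw [G, this, mulOp_one]

lemma reflOp_G (t : ℝ) (f : L2 E) : reflOp Q.c (Q.G t f) = Q.G t (reflOp Q.c f) :=
  reflOp_mulOp (Q.isMult_prop t)
    (fun ξ x => congrArg (fun A : E →L[ℝ] E => A x) (Q.c_prop t ξ)) f

lemma continuous_G_apply (f : L2 E) : Continuous fun t => Q.G t f := by
  refine continuous_iff_continuousAt.2 fun t => ?_
  exact tendsto_mulOp Q.isMult_prop (Q.isMult_prop t)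
    (fun ξ => (Q.hasDerivAt_prop t ξ).continuousAt) f

/-- The group is jointly continuous. -/
lemma tendsto_G {ι : Type*} {l : Filter ι} {τ : ι → ℝ} {t : ℝ} {x : ι → L2 E} {y : L2 E}
    (hτ : Tendsto τ l (𝓝 t)) (hx : Tendsto x l (𝓝 y)) :
    Tendsto (fun i => Q.G (τ i) (x i)) l (𝓝 (Q.G t y)) := by
  have h1 : Tendsto (fun i => Q.G (τ i) y) l (𝓝 (Q.G t y)) :=
    ((Q.continuous_G_apply y).tendsto t).comp hτ
  have h2 : Tendsto (fun i => Q.G (τ i) (x i - y)) l (𝓝 0) := by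
    rw [tendsto_zero_iff_norm_tendsto_zero]
    have h3 : Tendsto (fun i => Q.Γ * ‖x i - y‖) l (𝓝 0) := by
      have := (tendsto_iff_norm_sub_tendsto_zero.1 hx).const_mul Q.Γ
      simpa using this
    exact squeeze_zero (fun i => norm_nonneg _) (fun i => Q.norm_G_le _ _) h3
  have := h2.add h1
  simpa using this

/-- The embedding `H^{s+1} → H^s` in terms of the normalized transforms: multiplication by
`⟨ξ⟩⁻¹`. -/
def emb (_ : Model E κ K s) : L2 E →L[ℝ] L2 E := mulOp fun ξ => (jb ξ)⁻¹ • (1 : E →L[ℝ] E)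

lemma isMult_smul {m : ℝ → E →L[ℝ] E} {C : ℝ} {φ : ℝ → ℝ} (hφ : Continuous φ) (hm : Continuous m)
    (h : ∀ ξ, |φ ξ| * ‖m ξ‖ ≤ C) : IsMult (fun ξ => φ ξ • m ξ) C :=
  ⟨hφ.smul hm, fun ξ => by rw [norm_smul, Real.norm_eq_abs]; exact h ξ⟩

end

end Model

/-! ### The generator of the linear group, the nonlinear terms, and the time derivative as a
function of the unknown. -/

namespace Model

variable {E : Type*} [NormedAddCommGroup E] [InnerProductSpace ℝ E] {κ K s : ℝ}
variable (Q : Model E κ K s)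
variable [FiniteDimensional ℝ E] [CompleteSpace E]

lemma norm_one_le : ‖(1 : E →L[ℝ] E)‖ ≤ 1 := ContinuousLinearMap.norm_id_le

lemma isMult_smul_one {φ : ℝ → ℝ} {C : ℝ} (hφ : Continuous φ) (h : ∀ ξ, |φ ξ| ≤ C) :
    IsMult (fun ξ => φ ξ • (1 : E →L[ℝ] E)) C :=
  isMult_smul hφ continuous_const fun ξ =>
    (mul_le_mul (h ξ) norm_one_le (norm_nonneg _) ((abs_nonneg _).trans (h ξ))).trans_eq (mul_one C)

lemma isMult_emb : IsMult (fun ξ => (jb ξ)⁻¹ • (1 : E →L[ℝ] E)) 1 :=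
  isMult_smul_one continuous_inv_jb fun ξ => by
    rw [abs_of_pos (inv_pos.2 (jb_pos ξ))]; exact inv_jb_le_one ξ

lemma emb_ae (f : L2 E) : Q.emb f =ᵐ[volume] fun ξ => (jb ξ)⁻¹ • f ξ := by
  filter_upwards [mulOp_ae isMult_emb f] with ξ h
  rw [emb, h]; simp

lemma emb_injective : Function.Injective Q.emb := by
  intro f g h
  apply Lp.ext
  have h1 := Q.emb_ae f
  rw [h] at h1
  filter_upwards [h1, Q.emb_ae g] with ξ h2 h3
  rw [h2] at h3
  exact smul_right_injective E (inv_ne_zero (jb_pos ξ).ne') h3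

/-- The linear part of the evolution, from `H^{s+1}` to `H^s`. -/
def linOp : L2 E →L[ℝ] L2 E := mulOp fun ξ => (jb ξ)⁻¹ • Q.Lsym ξ

lemma isMult_linOp : IsMult (fun ξ => (jb ξ)⁻¹ • Q.Lsym ξ) Q.Λ :=
  isMult_smul continuous_inv_jb Q.continuous_Lsym fun ξ => by
    rw [abs_of_pos (inv_pos.2 (jb_pos ξ)), inv_mul_le_iff₀ (jb_pos ξ)]
    exact Q.norm_Lsym_le ξ

lemma norm_linOp_le (f : L2 E) : ‖Q.linOp f‖ ≤ Q.Λ * ‖f‖ := norm_mulOp_le Q.isMult_linOp f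

lemma G_emb (t : ℝ) (f : L2 E) : Q.G t (Q.emb f) = Q.emb (Q.G t f) := by
  rw [G, emb, mulOp_mulOp (Q.isMult_prop t) isMult_emb, mulOp_mulOp isMult_emb (Q.isMult_prop t)]
  congr 2
  ext ξ x
  simp

lemma G_linOp (t : ℝ) (f : L2 E) : Q.G t (Q.linOp f) = Q.linOp (Q.G t f) := by
  rw [G, linOp, mulOp_mulOp (Q.isMult_prop t) Q.isMult_linOp,
    mulOp_mulOp Q.isMult_linOp (Q.isMult_prop t)]
  congr 2
  ext1 ξ
  rw [mul_smul_comm, smul_mul_assoc, Lsym_comm_prop]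

lemma norm_prop_sub_le (t τ ξ : ℝ) : ‖Q.prop τ ξ - Q.prop t ξ‖ ≤ jb ξ * Q.Λ * Q.Γ * |τ - t| := by
  have hb : ∀ r, ‖Q.Lsym ξ * Q.prop r ξ‖ ≤ jb ξ * Q.Λ * Q.Γ := fun r =>
    (norm_mul_le _ _).trans (mul_le_mul (Q.norm_Lsym_le ξ) (Q.norm_prop_le r ξ)
      (norm_nonneg _) (mul_nonneg (jb_pos ξ).le Q.Λ_nonneg))
  have h := Convex.norm_image_sub_le_of_norm_hasDerivWithin_le (f := fun r => Q.prop r ξ)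
    (f' := fun r => Q.Lsym ξ * Q.prop r ξ) (s := univ) (C := jb ξ * Q.Λ * Q.Γ) (x := t) (y := τ)
    (fun r _ => (Q.hasDerivAt_prop r ξ).hasDerivWithinAt) (fun r _ => hb r) convex_univ
    (mem_univ _) (mem_univ _)
  rwa [Real.norm_eq_abs] at h

/-- The generator is unbounded, so only vectors in the range of `emb` have differentiable orbits. On
them the difference quotients of the symbol are bounded, by `norm_prop_sub_le` with its factor `⟨ξ⟩`
absorbed by `emb`, and converge at each frequency. -/
lemma hasDerivAt_G_emb (z : L2 E) (t : ℝ) :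
    HasDerivAt (fun τ => Q.G τ (Q.emb z)) (Q.linOp (Q.G t z)) t := by
  rw [hasDerivAt_iff_tendsto_slope]
  let D : ℝ → ℝ → E →L[ℝ] E := fun τ ξ => (jb ξ)⁻¹ • ((τ - t)⁻¹ • (Q.prop τ ξ - Q.prop t ξ))
  have hΓ : 0 ≤ Q.Γ := Real.sqrt_nonneg _
  have hD : ∀ τ, IsMult (D τ) (Q.Λ * Q.Γ) := by
    intro τ
    have h1 := (Q.isMult_prop τ).cont
    have h2 := (Q.isMult_prop t).cont
    have hc : Continuous fun ξ => (τ - t)⁻¹ • (Q.prop τ ξ - Q.prop t ξ) := by fun_prop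
    refine isMult_smul continuous_inv_jb hc fun ξ => ?_
    rw [abs_of_pos (inv_pos.2 (jb_pos ξ)), inv_mul_le_iff₀ (jb_pos ξ), norm_smul, norm_inv,
      Real.norm_eq_abs]
    by_cases h0 : τ - t = 0
    · rw [h0]
      have := jb_pos ξ
      have := Q.Λ_nonneg
      simp; positivity
    · rw [inv_mul_le_iff₀ (abs_pos.2 h0)]
      refine (Q.norm_prop_sub_le t τ ξ).trans_eq (by ring)
  have hm : IsMult (fun ξ => (jb ξ)⁻¹ • Q.Lsym ξ * Q.prop t ξ) (Q.Λ * Q.Γ) :=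
    Q.isMult_linOp.mul (Q.isMult_prop t)
  have hlim := tendsto_mulOp (l := 𝓝[≠] t) hD hm (fun ξ => by
    have h := hasDerivAt_iff_tendsto_slope.1 (Q.hasDerivAt_prop t ξ)
    have h2 := h.const_smul (jb ξ)⁻¹
    rw [← smul_mul_assoc] at h2
    exact h2) z
  rw [linOp, G, mulOp_mulOp Q.isMult_linOp (Q.isMult_prop t)]
  refine hlim.congr fun τ => ?_
  apply Lp.ext
  rw [slope_def_module]
  filter_upwards [mulOp_ae (hD τ) z, Lp.coeFn_smul (τ - t)⁻¹ (Q.G τ (Q.emb z) - Q.G t (Q.emb z)),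
    Lp.coeFn_sub (Q.G τ (Q.emb z)) (Q.G t (Q.emb z)), mulOp_ae (Q.isMult_prop τ) (Q.emb z),
    mulOp_ae (Q.isMult_prop t) (Q.emb z), Q.emb_ae z] with ξ h1 h2 h3 h4 h5 h6
  rw [h1, h2, Pi.smul_apply, h3, Pi.sub_apply, G, G, h4, h5, h6]
  simp only [D, smul_apply, sub_apply, map_smul]
  rw [← smul_sub, smul_comm]

/-- The product rule for `t ↦ G(σ t) w(t)`, if `w(t)` belongs to the smaller space at the point
under consideration. -/
lemma hasDerivWithinAt_G_apply {w : ℝ → L2 E} {w' z : L2 E} {S : Set ℝ} {t : ℝ} (σ : ℝ)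
    (hw : HasDerivWithinAt w w' S t) (hz : w t = Q.emb z) :
    HasDerivWithinAt (fun τ => Q.G (σ * τ) (w τ)) (Q.G (σ * t) w' + σ • Q.linOp (Q.G (σ * t) z))
      S t := by
  -- `w τ` is split into the fixed vector `emb z`, whose orbit is differentiable, and the increment
  -- `w τ - w t`; for the latter, which vanishes at `t`, the joint continuity of `G` suffices.
  have h1 : HasDerivWithinAt (fun τ => Q.G (σ * τ) (Q.emb z)) (σ • Q.linOp (Q.G (σ * t) z)) S t := by
    have h2 : HasDerivAt (fun τ : ℝ => σ * τ) σ t := by simpa using (hasDerivAt_id t).const_mul σ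
    exact ((Q.hasDerivAt_G_emb z (σ * t)).scomp t h2).hasDerivWithinAt
  have h3 : HasDerivWithinAt (fun τ => Q.G (σ * τ) (w τ - w t)) (Q.G (σ * t) w') S t := by
    rw [hasDerivWithinAt_iff_tendsto_slope] at hw ⊢
    have hτ : Tendsto (fun τ => σ * τ) (𝓝[S \ {t}] t) (𝓝 (σ * t)) :=
      ((continuous_const.mul continuous_id).tendsto t).mono_left nhdsWithin_le_nhds
    refine (Q.tendsto_G hτ hw).congr fun τ => ?_
    simp [slope_def_module]
  have := h3.add h1
  refine this.congr (fun τ _ => ?_) ?_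
  · simp [← hz]
  · simp [← hz]

/-! #### The nonlinear terms -/

/-- `f = ⟨ξ⟩^s θ Û ↦ ⟨ξ⟩^s Û` -/
def aOp : L2 E →L[ℝ] L2 E := mulOp fun ξ => (Q.θ ξ)⁻¹ • (1 : E →L[ℝ] E)

/-- `f = ⟨ξ⟩^s θ Û ↦ ⟨ξ⟩^{s-1} i q Û` -/
def dOp : L2 E →L[ℝ] L2 E := mulOp fun ξ => (q ξ * (jb ξ)⁻¹ * (Q.θ ξ)⁻¹) • Q.I

/-- Multiplication by `θ M⁻¹`. -/
def resOp : L2 E →L[ℝ] L2 E := mulOp fun ξ => Q.θ ξ • Q.Minv ξ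

/-- Multiplication by `⟨ξ⟩ θ M⁻¹`. -/
def forceOp : L2 E →L[ℝ] L2 E := mulOp fun ξ => (jb ξ * Q.θ ξ) • Q.Minv ξ

lemma isMult_aOp : IsMult (fun ξ => (Q.θ ξ)⁻¹ • (1 : E →L[ℝ] E)) 1 :=
  isMult_smul_one Q.continuous_inv_θ fun ξ => by
    rw [abs_of_pos (inv_pos.2 (Q.θ_pos ξ))]; exact Q.inv_θ_le_one ξ

lemma abs_q_mul_inv_jb_le (ξ : ℝ) : |q ξ * (jb ξ)⁻¹| ≤ 1 := by
  rw [abs_mul, abs_of_pos (inv_pos.2 (jb_pos ξ)), ← div_eq_mul_inv, div_le_one (jb_pos ξ)]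
  exact abs_le_jb ξ

lemma isMult_dOp : IsMult (fun ξ => (q ξ * (jb ξ)⁻¹ * (Q.θ ξ)⁻¹) • Q.I) 1 :=
  isMult_smul ((continuous_q.mul continuous_inv_jb).mul Q.continuous_inv_θ) continuous_const
    fun ξ => by
      rw [abs_mul, abs_of_pos (inv_pos.2 (Q.θ_pos ξ))]
      have h := mul_le_mul (abs_q_mul_inv_jb_le ξ) (Q.inv_θ_le_one ξ)
        (inv_pos.2 (Q.θ_pos ξ)).le zero_le_one
      have := mul_le_mul h Q.norm_I_le (norm_nonneg _) (by norm_num)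
      simpa using this

lemma isMult_resOp : IsMult (fun ξ => Q.θ ξ • Q.Minv ξ) (2 / κ) :=
  isMult_smul Q.continuous_θ Q.continuous_Minv fun ξ => by
    have hθ := Q.θ_pos ξ
    have hκ := Q.hκ
    rw [abs_of_pos hθ]
    calc Q.θ ξ * ‖Q.Minv ξ‖ ≤ Q.θ ξ * (2 / κ * (Q.θ ξ)⁻¹ ^ 2) := by gcongr; exact Q.norm_Minv_le ξ
      _ = 2 / κ * (Q.θ ξ)⁻¹ := by field_simp
      _ ≤ 2 / κ * 1 := by gcongr; exact Q.inv_θ_le_one ξ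
      _ = _ := mul_one _

lemma isMult_forceOp : IsMult (fun ξ => (jb ξ * Q.θ ξ) • Q.Minv ξ) (2 / κ * (√Q.ε)⁻¹) :=
  isMult_smul (continuous_jb.mul Q.continuous_θ) Q.continuous_Minv fun ξ => by
    have hθ := Q.θ_pos ξ
    have hj := jb_pos ξ
    have hκ := Q.hκ
    rw [abs_of_pos (by positivity)]
    calc jb ξ * Q.θ ξ * ‖Q.Minv ξ‖ ≤ jb ξ * Q.θ ξ * (2 / κ * (Q.θ ξ)⁻¹ ^ 2) := by
          gcongr; exact Q.norm_Minv_le ξ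
      _ = 2 / κ * (jb ξ * (Q.θ ξ)⁻¹) := by field_simp
      _ ≤ _ := by gcongr; exact Q.jb_div_θ_le ξ

/-- The nonlinear term of `h` lies in the range of `emb`: with the linear part removed, the
evolution loses no derivative for fixed `ε`. -/
lemma emb_forceOp (f : L2 E) : Q.emb (Q.forceOp f) = Q.resOp f := by
  rw [emb, forceOp, resOp, mulOp_mulOp isMult_emb Q.isMult_forceOp]
  congr 2
  ext ξ x
  have := (jb_pos ξ).ne'
  simp only [smul_mul_smul_comm, one_mul]
  congr 2
  field_simp

lemma norm_aOp_le (f : L2 E) : ‖Q.aOp f‖ ≤ ‖f‖ := 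
  (norm_mulOp_le Q.isMult_aOp f).trans_eq (one_mul _)

lemma norm_dOp_le (f : L2 E) : ‖Q.dOp f‖ ≤ ‖f‖ := 
  (norm_mulOp_le Q.isMult_dOp f).trans_eq (one_mul _)

/-- The quadratic terms `(S₁(U) V)^ + (N₁(U) ∂U)^`, times `⟨ξ⟩^{s-1}`. -/
def quad (f h : L2 E) : L2 E :=
  bil (wt s) (kProd s) Q.S₁ (Q.aOp f) (Q.aOp h) + bil (wt s) (kProd s) Q.N₁ (Q.aOp f) (Q.dOp f)

/-- The constant in the product estimate. -/
def B (_ : Model E κ K s) : ℝ := weightConst (wt s) * (2 ^ (s - 1) * K)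

lemma B_nonneg : 0 ≤ Q.B := by
  have := weightConst_nonneg (wt s); have := Q.K_nonneg
  unfold B; positivity

lemma norm_prod_le {b : E →L[ℝ] E →L[ℝ] E} (hb : ‖b‖ ≤ K) (f g : L2 E) :
    ‖bil (wt s) (kProd s) b f g‖ ≤ Q.B * ‖f‖ * ‖g‖ := by
  refine (norm_bil_le (isWeight_wt Q.hs) (isKernel_kProd Q.hs) b f g).trans ?_
  have := weightConst_nonneg (wt s)
  unfold B
  gcongr

lemma norm_prod_le' {b : E →L[ℝ] E →L[ℝ] E} (hb : ‖b‖ ≤ K) {f g : L2 E} {x y : ℝ}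
    (hf : ‖f‖ ≤ x) (hg : ‖g‖ ≤ y) : ‖bil (wt s) (kProd s) b f g‖ ≤ Q.B * x * y := by
  refine (Q.norm_prod_le hb f g).trans ?_
  have := Q.B_nonneg
  have : 0 ≤ x := (norm_nonneg _).trans hf
  gcongr

lemma norm_quad_le (f h : L2 E) : ‖Q.quad f h‖ ≤ Q.B * ‖f‖ * (‖h‖ + ‖f‖) := by
  refine (norm_add_le _ _).trans ?_
  have h1 := Q.norm_prod_le' Q.hS₁.bound (Q.norm_aOp_le f) (Q.norm_aOp_le h)
  have h2 := Q.norm_prod_le' Q.hN₁.bound (Q.norm_aOp_le f) (Q.norm_dOp_le f)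
  linarith

lemma norm_quad_sub_le (f h f' h' : L2 E) : ‖Q.quad f h - Q.quad f' h'‖
    ≤ Q.B * (‖f - f'‖ * (‖h‖ + ‖f‖) + ‖f'‖ * (‖h - h'‖ + ‖f - f'‖)) := by
  have e : Q.quad f h - Q.quad f' h' =
      bil (wt s) (kProd s) Q.S₁ (Q.aOp (f - f')) (Q.aOp h)
      + bil (wt s) (kProd s) Q.S₁ (Q.aOp f') (Q.aOp (h - h'))
      + bil (wt s) (kProd s) Q.N₁ (Q.aOp (f - f')) (Q.dOp f)
      + bil (wt s) (kProd s) Q.N₁ (Q.aOp f') (Q.dOp (f - f')) := by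
    simp only [quad, map_sub, sub_apply]
    abel
  rw [e]
  refine (norm_add₄_le).trans ?_
  have h1 := Q.norm_prod_le' Q.hS₁.bound (Q.norm_aOp_le (f - f')) (Q.norm_aOp_le h)
  have h2 := Q.norm_prod_le' Q.hS₁.bound (Q.norm_aOp_le f') (Q.norm_aOp_le (h - h'))
  have h3 := Q.norm_prod_le' Q.hN₁.bound (Q.norm_aOp_le (f - f')) (Q.norm_dOp_le f)
  have h4 := Q.norm_prod_le' Q.hN₁.bound (Q.norm_aOp_le f') (Q.norm_dOp_le (f - f'))
  linarith

/-- `h = ⟨ξ⟩^{s-1} θ V̂` where `V` is the time derivative given by the equation for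
`f = ⟨ξ⟩^s θ Û`. -/
def Rel (f h : L2 E) : Prop := h = Q.linOp f - Q.ε • Q.resOp (Q.quad f h)

/-- The size of `‖f‖` up to which the equation can be solved for the time derivative. -/
def Small (R : ℝ) : Prop := Q.ε * (2 / κ * (Q.B * R)) ≤ 1 / 2

lemma Small.mono {R R' : ℝ} (h : Q.Small R) (hR : R' ≤ R) : Q.Small R' := by
  refine le_trans ?_ h
  have := Q.hε; have := Q.hκ; have := Q.B_nonneg
  gcongr

lemma norm_eps_resOp_le {x : ℝ} {g : L2 E} (hg : ‖g‖ ≤ Q.B * x) :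
    ‖Q.ε • Q.resOp g‖ ≤ Q.ε * (2 / κ * (Q.B * x)) := by
  have := Q.hε; have := Q.hκ
  rw [norm_smul, Real.norm_of_nonneg Q.hε.le]
  gcongr
  exact (norm_mulOp_le Q.isMult_resOp g).trans (by gcongr)

/-- For fixed `f` the relation reads `(1 - A) h = g` with `A` linear of norm at most 1/2 by `Small`;
the Neumann series inverts `1 - A`. -/
lemma exists_rel {f : L2 E} (hf : Q.Small ‖f‖) : ∃ h, Q.Rel f h := by
  let A : L2 E →L[ℝ] L2 E :=
    (-Q.ε) • (Q.resOp.comp ((bil (wt s) (kProd s) Q.S₁ (Q.aOp f)).comp Q.aOp))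
  have hA : ‖A‖ < 1 := by
    refine lt_of_le_of_lt (b := (1 / 2 : ℝ)) ?_ (by norm_num)
    refine ContinuousLinearMap.opNorm_le_bound _ (by norm_num) fun h => ?_
    have h1 : ‖bil (wt s) (kProd s) Q.S₁ (Q.aOp f) (Q.aOp h)‖ ≤ Q.B * (‖f‖ * ‖h‖) :=
      (Q.norm_prod_le' Q.hS₁.bound (Q.norm_aOp_le f) (Q.norm_aOp_le h)).trans_eq (mul_assoc _ _ _)
    have h2 := Q.norm_eps_resOp_le h1
    have h3 : A h = -(Q.ε • Q.resOp (bil (wt s) (kProd s) Q.S₁ (Q.aOp f) (Q.aOp h))) := by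
      simp [A]
    rw [h3, norm_neg]
    refine h2.trans ?_
    have := mul_le_mul_of_nonneg_right hf (norm_nonneg h)
    linarith
  have hu := isUnit_one_sub_of_norm_lt_one (R := L2 E →L[ℝ] L2 E) hA
  set g := Q.linOp f - Q.ε • Q.resOp (bil (wt s) (kProd s) Q.N₁ (Q.aOp f) (Q.dOp f))
  refine ⟨Ring.inverse (1 - A) g, ?_⟩
  set h := Ring.inverse (1 - A) g
  have h1 : (1 - A) h = g := by
    change ((1 - A) * Ring.inverse (1 - A)) g = g
    rw [Ring.mul_inverse_cancel _ hu]; rfl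
  have h2 : h = g + A h := by
    rw [← h1]; simp
  rw [Rel]
  conv_lhs => rw [h2]
  simp only [g, A, quad, map_add, smul_add, neg_smul, neg_apply,
    smul_apply, ContinuousLinearMap.comp_apply]
  abel

/-- `Small` gives `‖h‖ ≤ Λ‖f‖ + (‖h‖ + ‖f‖)/2`, and half of `‖h‖` is absorbed on the left. -/
lemma norm_le_of_rel {f h : L2 E} (hf : Q.Small ‖f‖) (hr : Q.Rel f h) :
    ‖h‖ ≤ (2 * Q.Λ + 1) * ‖f‖ := by
  have h1 : ‖h‖ ≤ Q.Λ * ‖f‖ + Q.ε * (2 / κ * (Q.B * (‖f‖ * (‖h‖ + ‖f‖)))) := by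
    have h3 := Q.norm_eps_resOp_le ((Q.norm_quad_le f h).trans_eq (mul_assoc _ _ _))
    calc ‖h‖ = ‖Q.linOp f - Q.ε • Q.resOp (Q.quad f h)‖ := by conv_lhs => rw [hr]
      _ ≤ _ := (norm_sub_le _ _).trans (add_le_add (Q.norm_linOp_le f) h3)
  have h2 := mul_le_mul_of_nonneg_right hf (add_nonneg (norm_nonneg h) (norm_nonneg f))
  nlinarith

/-- The same absorption for differences. Taking `f = f'` gives the uniqueness of `h`; in general it
makes the time derivative a Lipschitz function of the unknown. -/
lemma norm_sub_le_of_rel {R : ℝ} (hR : Q.Small R) {f h f' h' : L2 E} (hf : ‖f‖ ≤ R)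
    (hf' : ‖f'‖ ≤ R) (hr : Q.Rel f h) (hr' : Q.Rel f' h') :
    ‖h - h'‖ ≤ (4 * Q.Λ + 3) * ‖f - f'‖ := by
  have h0 := Q.norm_le_of_rel (hR.mono Q hf) hr
  have hΛ := Q.Λ_nonneg
  set δ := ‖f - f'‖
  have hδ : 0 ≤ δ := norm_nonneg _
  have hq : ‖Q.quad f h - Q.quad f' h'‖
      ≤ Q.B * (R * (δ * (2 * Q.Λ + 2) + (‖h - h'‖ + δ))) := by
    refine (Q.norm_quad_sub_le f h f' h').trans ?_
    have := Q.B_nonneg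
    gcongr
    have h3 : ‖h‖ + ‖f‖ ≤ (2 * Q.Λ + 2) * R := by nlinarith
    have h4 := mul_le_mul_of_nonneg_left h3 hδ
    have h5 : ‖f'‖ * (‖h - h'‖ + δ) ≤ R * (‖h - h'‖ + δ) := by gcongr
    linarith
  have h1 : ‖h - h'‖ ≤ Q.Λ * δ
      + Q.ε * (2 / κ * (Q.B * (R * (δ * (2 * Q.Λ + 2) + (‖h - h'‖ + δ))))) := by
    have h3 := Q.norm_eps_resOp_le hq
    calc ‖h - h'‖ = ‖Q.linOp (f - f') - Q.ε • Q.resOp (Q.quad f h - Q.quad f' h')‖ := by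
          conv_lhs => rw [hr, hr']
          simp only [map_sub, smul_sub]
          congr 1; abel
      _ ≤ _ := (norm_sub_le _ _).trans (add_le_add (Q.norm_linOp_le _) h3)
  have h2 := mul_le_mul_of_nonneg_right hR
    (show 0 ≤ δ * (2 * Q.Λ + 2) + (‖h - h'‖ + δ) by positivity)
  linarith

lemma rel_unique {f h h' : L2 E} (hf : Q.Small ‖f‖) (hr : Q.Rel f h) (hr' : Q.Rel f h') :
    h = h' := by
  have := Q.norm_sub_le_of_rel hf le_rfl le_rfl hr hr'
  rw [sub_self, norm_zero, mul_zero, norm_le_zero_iff, sub_eq_zero] at this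
  exact this

open Classical in
/-- The time derivative in terms of the unknown. -/
def vel (f : L2 E) : L2 E := if h : ∃ h, Q.Rel f h then h.choose else 0

lemma rel_vel {f : L2 E} (hf : Q.Small ‖f‖) : Q.Rel f (Q.vel f) := by
  have h := Q.exists_rel hf
  rw [vel, dif_pos h]
  exact h.choose_spec

/-- The nonlinear part of the evolution, as a function of `f` and the time derivative. -/
def force (f h : L2 E) : L2 E := -(Q.ε • Q.forceOp (Q.quad f h))

/-- The splitting behind the change to the moving frame: an unbounded linear term plus the image
under `emb` of a term that is bounded on the space of `f`. -/
lemma Rel.eq {f h : L2 E} (hr : Q.Rel f h) : h = Q.linOp f + Q.emb (Q.force f h) := by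
  conv_lhs => rw [hr]
  rw [force, map_neg, map_smul, emb_forceOp, sub_eq_add_neg]

lemma reflOp_aOp (f : L2 E) : reflOp Q.c (Q.aOp f) = Q.aOp (reflOp Q.c f) :=
  reflOp_mulOp Q.isMult_aOp (fun ξ x => by simp [Q.θ_neg]) f

lemma reflOp_dOp (f : L2 E) : reflOp Q.c (Q.dOp f) = Q.dOp (reflOp Q.c f) :=
  reflOp_mulOp Q.isMult_dOp (fun ξ x => by simp [Q.θ_neg, jb_neg, q_neg, Q.c_I]) f

lemma c_Minv (ξ : ℝ) (x : E) : Q.c (Q.Minv ξ x) = Q.Minv ξ (Q.c x) :=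
  (congrArg (fun A : E →L[ℝ] E => A x) (Q.Minv_c ξ)).symm

lemma reflOp_resOp (f : L2 E) : reflOp Q.c (Q.resOp f) = Q.resOp (reflOp Q.c f) :=
  reflOp_mulOp Q.isMult_resOp (fun ξ x => by simp [Q.θ_neg, Q.Minv_neg, Q.c_Minv]) f

lemma reflOp_forceOp (f : L2 E) : reflOp Q.c (Q.forceOp f) = Q.forceOp (reflOp Q.c f) :=
  reflOp_mulOp Q.isMult_forceOp (fun ξ x => by simp [Q.θ_neg, jb_neg, Q.Minv_neg, Q.c_Minv]) f

lemma reflOp_linOp (f : L2 E) : reflOp Q.c (Q.linOp f) = Q.linOp (reflOp Q.c f) :=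
  reflOp_mulOp Q.isMult_linOp (fun ξ x => by
    have := congrArg (fun A : E →L[ℝ] E => A x) (Q.c_Lsym ξ)
    simp only [mul_apply_eq_comp] at this
    simp [jb_neg, this]) f

lemma reflOp_quad (f h : L2 E) :
    reflOp Q.c (Q.quad f h) = Q.quad (reflOp Q.c f) (reflOp Q.c h) := by
  have hw := isWeight_wt Q.hs
  have hk := isKernel_kProd Q.hs
  rw [quad, map_add, reflOp_bil hw hk (kProd_neg s) Q.hS₁.comm_c,
    reflOp_bil hw hk (kProd_neg s) Q.hN₁.comm_c, reflOp_aOp, reflOp_aOp, reflOp_dOp, quad]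

lemma Rel.reflOp {f h : L2 E} (hr : Q.Rel f h) : Q.Rel (reflOp Q.c f) (reflOp Q.c h) := by
  have := congrArg (SymBoussinesq.reflOp Q.c) hr
  rw [map_sub, map_smul, reflOp_linOp, reflOp_resOp, reflOp_quad] at this
  exact this

lemma reflOp_force (f h : L2 E) :
    reflOp Q.c (Q.force f h) = Q.force (reflOp Q.c f) (reflOp Q.c h) := by
  rw [force, map_neg, map_smul, reflOp_forceOp, reflOp_quad, force]

lemma norm_reflOp_eq (f : L2 E) : ‖reflOp Q.c f‖ = ‖f‖ := norm_reflOp Q.c_c Q.norm_c f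

lemma reflOp_vel {f : L2 E} (hf : Q.Small ‖f‖) :
    reflOp Q.c (Q.vel f) = Q.vel (reflOp Q.c f) := by
  have h1 : Q.Small ‖reflOp Q.c f‖ := by rwa [norm_reflOp_eq]
  exact Q.rel_unique h1 ((Q.rel_vel hf).reflOp Q) (Q.rel_vel h1)

end Model

/-- Continuity argument: a continuous function that is at most `r` as long as it is at most `R > r`
is at most `r`. -/
lemma le_of_bootstrap {g : ℝ → ℝ} {T r R : ℝ} (hc : ContinuousOn g (Icc 0 T)) (h0 : g 0 ≤ r)
    (hrR : r < R) (h : ∀ t ∈ Icc 0 T, (∀ τ ∈ Icc 0 t, g τ ≤ R) → g t ≤ r) :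
    ∀ t ∈ Icc 0 T, g t ≤ r := by
  suffices hR : ∀ t ∈ Icc 0 T, g t ≤ R from fun t ht =>
    h t ht fun τ hτ => hR τ ⟨hτ.1, hτ.2.trans ht.2⟩
  by_contra! hcon
  obtain ⟨t₁, ht₁, hgt⟩ := hcon
  have hc1 : ContinuousOn g (Icc 0 t₁) := hc.mono (Icc_subset_Icc_right ht₁.2)
  let A := Icc 0 t₁ ∩ g ⁻¹' {R}
  have hA : IsClosed A := hc1.preimage_isClosed_of_isClosed isClosed_Icc isClosed_singleton
  have hAne : A.Nonempty := by
    obtain ⟨x, hx, hxR⟩ := intermediate_value_Icc ht₁.1 hc1 ⟨(h0.trans hrR.le), hgt.le⟩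
    exact ⟨x, hx, hxR⟩
  have hbdd : BddBelow A := ⟨0, fun x hx => hx.1.1⟩
  have hmem := hA.csInf_mem hAne hbdd
  -- The first time at which the value `R` is attained; up to it `g ≤ R`, so the hypothesis yields
  -- `g t₂ ≤ r < R`.
  set t₂ := sInf A
  have hle : ∀ τ ∈ Icc 0 t₂, g τ ≤ R := by
    intro τ hτ
    by_contra! hτR
    have hτ1 : τ ≤ t₁ := hτ.2.trans hmem.1.2
    obtain ⟨x, hx, hxR⟩ := intermediate_value_Icc hτ.1 (hc1.mono (Icc_subset_Icc_right hτ1))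
      ⟨(h0.trans hrR.le), hτR.le⟩
    have h1 : t₂ ≤ x := csInf_le hbdd ⟨⟨hx.1, hx.2.trans hτ1⟩, hxR⟩
    have h2 : x = τ := le_antisymm hx.2 (hτ.2.trans h1)
    rw [h2] at hxR
    exact hτR.ne' hxR
  have h3 := h t₂ ⟨hmem.1.1, hmem.1.2.trans ht₁.2⟩ hle
  have h4 : g t₂ = R := hmem.2
  linarith

/-- Radial retraction onto the ball of radius `R`. -/
def trunc {F : Type*} [NormedAddCommGroup F] [NormedSpace ℝ F] (R : ℝ) (f : F) : F :=
  (R / max R ‖f‖) • f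

section Trunc

variable {F : Type*} [NormedAddCommGroup F] [NormedSpace ℝ F] {R : ℝ}

lemma norm_trunc_le (hR : 0 < R) (f : F) : ‖trunc R f‖ ≤ R := by
  have h1 : 0 < max R ‖f‖ := lt_max_of_lt_left hR
  rw [trunc, norm_smul, Real.norm_of_nonneg (by positivity), div_mul_eq_mul_div,
    div_le_iff₀ h1]
  gcongr
  exact le_max_right _ _

lemma trunc_of_norm_le (hR : 0 < R) {f : F} (hf : ‖f‖ ≤ R) : trunc R f = f := by
  rw [trunc, max_eq_left hf, div_self hR.ne', one_smul]

lemma norm_trunc_sub_le (hR : 0 < R) (f g : F) : ‖trunc R f - trunc R g‖ ≤ 2 * ‖f - g‖ := by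
  set x := max R ‖f‖
  set y := max R ‖g‖
  have hx : 0 < x := lt_max_of_lt_left hR
  have hy : 0 < y := lt_max_of_lt_left hR
  have hRx : R ≤ x := le_max_left _ _
  have hgy : ‖g‖ ≤ y := le_max_right _ _
  have hxy : |y - x| ≤ ‖f - g‖ := by
    refine (abs_max_sub_max_le_max R ‖g‖ R ‖f‖).trans ?_
    rw [sub_self, abs_zero, max_eq_right (abs_nonneg _), norm_sub_rev]
    exact abs_norm_sub_norm_le g f
  -- Each term costs at most `‖f - g‖`: the first since `R / x ≤ 1`, the second since also `|y - x|
  -- ≤ ‖f - g‖` and `‖g‖ ≤ y`.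
  have e : trunc R f - trunc R g = (R / x) • (f - g) + (R / x * ((y - x) / y)) • g := by
    have : R / x * ((y - x) / y) = R / x - R / y := by field_simp
    rw [this, trunc, trunc, smul_sub, sub_smul]
    abel
  have h1 : R / x ≤ 1 := (div_le_one hx).2 hRx
  rw [e]
  calc ‖(R / x) • (f - g) + (R / x * ((y - x) / y)) • g‖
      ≤ ‖(R / x) • (f - g)‖ + ‖(R / x * ((y - x) / y)) • g‖ := norm_add_le _ _
    _ = R / x * ‖f - g‖ + R / x * (|y - x| / y * ‖g‖) := by
        rw [norm_smul, norm_smul, Real.norm_of_nonneg (by positivity : 0 ≤ R / x), norm_mul,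
          Real.norm_of_nonneg (by positivity : 0 ≤ R / x), norm_div, Real.norm_eq_abs,
          Real.norm_of_nonneg hy.le]
        ring
    _ ≤ 1 * ‖f - g‖ + 1 * (‖f - g‖ / y * y) := by gcongr
    _ = 2 * ‖f - g‖ := by field_simp; ring

end Trunc

/-! ### Local theory: the truncated equation in the moving frame, and uniqueness. -/

namespace Model

variable {E : Type*} [NormedAddCommGroup E] [InnerProductSpace ℝ E] {κ K s : ℝ}
variable (Q : Model E κ K s)
variable [FiniteDimensional ℝ E] [CompleteSpace E]

lemma norm_forceOp_smul_le {x : ℝ} {g : L2 E} (hg : ‖g‖ ≤ x) :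
    ‖Q.ε • Q.forceOp g‖ ≤ Q.ε * (2 / κ * (√Q.ε)⁻¹ * x) := by
  have := Q.hε; have := Q.hκ
  rw [norm_smul, Real.norm_of_nonneg Q.hε.le]
  gcongr
  exact (norm_mulOp_le Q.isMult_forceOp g).trans (by gcongr)

/-- The nonlinear part of the evolution, as a function of the unknown. -/
def F (f : L2 E) : L2 E := Q.force f (Q.vel f)

/-- The constant depends on `ε`. This is harmless, since these bounds serve only for solvability and
uniqueness; the quantitative control comes from the energy. -/
lemma exists_bounds_F {R : ℝ} (hR : Q.Small R) (hR0 : 0 < R) : ∃ C, 0 ≤ C ∧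
    (∀ f, ‖f‖ ≤ R → ‖Q.F f‖ ≤ C) ∧
    ∀ f f', ‖f‖ ≤ R → ‖f'‖ ≤ R → ‖Q.F f - Q.F f'‖ ≤ C * ‖f - f'‖ := by
  have hΛ := Q.Λ_nonneg
  have hB := Q.B_nonneg
  have hε := Q.hε
  have hκ := Q.hκ
  have hv : ∀ f, ‖f‖ ≤ R → ‖Q.vel f‖ ≤ (2 * Q.Λ + 1) * R := fun f hf =>
    (Q.norm_le_of_rel (hR.mono Q hf) (Q.rel_vel (hR.mono Q hf))).trans (by gcongr)
  refine ⟨Q.ε * (2 / κ * (√Q.ε)⁻¹ * (Q.B * R * ((2 * Q.Λ + 1) * R + R)))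
    + Q.ε * (2 / κ * (√Q.ε)⁻¹ * (Q.B * (((2 * Q.Λ + 1) * R + R) + R * ((4 * Q.Λ + 3) + 1)))),
    by positivity, fun f hf => ?_, fun f f' hf hf' => ?_⟩
  · rw [F, force, norm_neg]
    refine (Q.norm_forceOp_smul_le (x := Q.B * R * ((2 * Q.Λ + 1) * R + R)) ?_).trans ?_
    · refine (Q.norm_quad_le _ _).trans ?_
      have := hv f hf
      gcongr
    · refine le_add_of_nonneg_right ?_
      positivity
  · rw [F, F, force, force, neg_sub_neg, ← smul_sub, ← map_sub]
    have h1 := Q.norm_sub_le_of_rel hR hf' hf (Q.rel_vel (hR.mono Q hf'))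
      (Q.rel_vel (hR.mono Q hf))
    refine (Q.norm_forceOp_smul_le (x := Q.B * (((2 * Q.Λ + 1) * R + R)
      + R * ((4 * Q.Λ + 3) + 1)) * ‖f - f'‖) ?_).trans ?_
    · refine (Q.norm_quad_sub_le _ _ _ _).trans ?_
      rw [norm_sub_rev f f', mul_assoc]
      gcongr
      have := hv f' hf'
      calc ‖f' - f‖ * (‖Q.vel f'‖ + ‖f'‖) + ‖f‖ * (‖Q.vel f' - Q.vel f‖ + ‖f' - f‖)
          ≤ ‖f' - f‖ * ((2 * Q.Λ + 1) * R + R)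
            + R * ((4 * Q.Λ + 3) * ‖f' - f‖ + ‖f' - f‖) := by gcongr
        _ = _ := by ring
    · rw [add_mul]
      have : 0 ≤ Q.ε * (2 / κ * (√Q.ε)⁻¹ * (Q.B * R * ((2 * Q.Λ + 1) * R + R))) * ‖f - f'‖ := by
        positivity
      linarith

/-- The truncated nonlinear part in the moving frame of the linear evolution. -/
def field (R t : ℝ) (y : L2 E) : L2 E := Q.G (-t) (Q.F (trunc R (Q.G t y)))

lemma exists_field_bounds {R : ℝ} (hR : Q.Small R) (hR0 : 0 < R) : ∃ C, 0 ≤ C ∧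
    (∀ t y, ‖Q.field R t y‖ ≤ C) ∧ ∀ t y y', ‖Q.field R t y - Q.field R t y'‖ ≤ C * ‖y - y'‖ := by
  obtain ⟨C, hC, h1, h2⟩ := Q.exists_bounds_F hR hR0
  have hΓ : 0 ≤ Q.Γ := Real.sqrt_nonneg _
  refine ⟨Q.Γ * C + Q.Γ * (C * (2 * Q.Γ)), by positivity, fun t y => ?_, fun t y y' => ?_⟩
  · refine (Q.norm_G_le _ _).trans ?_
    have := h1 _ (norm_trunc_le hR0 (Q.G t y))
    refine le_add_of_le_of_nonneg (by gcongr) (by positivity)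
  · rw [field, field, ← map_sub]
    refine (Q.norm_G_le _ _).trans ?_
    have h3 := h2 _ _ (norm_trunc_le hR0 (Q.G t y)) (norm_trunc_le hR0 (Q.G t y'))
    have h4 := norm_trunc_sub_le hR0 (Q.G t y) (Q.G t y')
    rw [← map_sub] at h4
    have h5 := Q.norm_G_le t (y - y')
    rw [add_mul]
    refine le_add_of_nonneg_of_le (by positivity) ?_
    calc Q.Γ * ‖Q.F (trunc R (Q.G t y)) - Q.F (trunc R (Q.G t y'))‖
        ≤ Q.Γ * (C * (2 * (Q.Γ * ‖y - y'‖))) := by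
          gcongr
          refine h3.trans ?_
          gcongr
          exact h4.trans (by gcongr)
      _ = _ := by ring

lemma continuous_trunc_F {R : ℝ} (hR : Q.Small R) (hR0 : 0 < R) :
    Continuous fun f => Q.F (trunc R f) := by
  obtain ⟨C, hC, h1, h2⟩ := Q.exists_bounds_F hR hR0
  refine (LipschitzWith.of_dist_le_mul (K := Real.toNNReal (C * 2)) fun f g => ?_).continuous
  rw [dist_eq_norm, dist_eq_norm, Real.coe_toNNReal _ (by positivity), mul_assoc]
  refine (h2 _ _ (norm_trunc_le hR0 f) (norm_trunc_le hR0 g)).trans ?_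
  gcongr
  exact norm_trunc_sub_le hR0 f g

lemma continuous_field {R : ℝ} (hR : Q.Small R) (hR0 : 0 < R) (y : L2 E) :
    Continuous fun t => Q.field R t y := by
  refine continuous_iff_continuousAt.2 fun t => Q.tendsto_G continuous_neg.continuousAt ?_
  exact ((Q.continuous_trunc_F hR hR0).tendsto _).comp ((Q.continuous_G_apply y).tendsto t)

lemma exists_field_solution {R : ℝ} (hR : Q.Small R) (hR0 : 0 < R) {T : ℝ} (hT : 0 ≤ T)
    (y₀ : L2 E) : ∃ y : ℝ → L2 E, y 0 = y₀ ∧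
      ∀ t ∈ Icc 0 T, HasDerivWithinAt y (Q.field R t (y t)) (Icc 0 T) t := by
  obtain ⟨C, hC, h1, h2⟩ := Q.exists_field_bounds hR hR0
  -- Truncation makes the field bounded by `C` everywhere, so the radius `C * T` lets the solution
  -- live on the whole interval, however long.
  have h : IsPicardLindelof (Q.field R) (⟨0, left_mem_Icc.2 hT⟩ : Icc 0 T) y₀
      (Real.toNNReal (C * T)) 0 (Real.toNNReal C) (Real.toNNReal C) := by
    constructor
    · intro t _
      refine LipschitzOnWith.of_dist_le_mul fun y _ y' _ => ?_
      rw [dist_eq_norm, dist_eq_norm, Real.coe_toNNReal _ hC]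
      exact h2 t y y'
    · intro y _
      exact (Q.continuous_field hR hR0 y).continuousOn
    · intro t _ y _
      rw [Real.coe_toNNReal _ hC]
      exact h1 t y
    · simp [Real.coe_toNNReal _ hC, Real.coe_toNNReal _ (mul_nonneg hC hT), hT]
  exact h.exists_eq_forall_mem_Icc_hasDerivWithinAt₀

lemma field_unique {R : ℝ} (hR : Q.Small R) (hR0 : 0 < R) {T : ℝ} {y z : ℝ → L2 E}
    (hy : ∀ t ∈ Icc 0 T, HasDerivWithinAt y (Q.field R t (y t)) (Icc 0 T) t)
    (hz : ∀ t ∈ Icc 0 T, HasDerivWithinAt z (Q.field R t (z t)) (Icc 0 T) t) (h0 : y 0 = z 0) :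
    ∀ t ∈ Icc 0 T, y t = z t := by
  obtain ⟨C, hC, -, h2⟩ := Q.exists_field_bounds hR hR0
  have hright : ∀ {y : ℝ → L2 E},
      (∀ t ∈ Icc 0 T, HasDerivWithinAt y (Q.field R t (y t)) (Icc 0 T) t) →
      ∀ t ∈ Ico 0 T, HasDerivWithinAt y (Q.field R t (y t)) (Ici t) t := fun hy t ht =>
    (hy t ⟨ht.1, ht.2.le⟩).mono_of_mem_nhdsWithin
      (mem_of_superset (Icc_mem_nhdsGE ht.2) (Icc_subset_Icc_left ht.1))
  have hlip : ∀ t, LipschitzWith (Real.toNNReal C) (Q.field R t) := fun t =>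
    LipschitzWith.of_dist_le_mul fun y y' => by
      rw [dist_eq_norm, dist_eq_norm, Real.coe_toNNReal _ hC]; exact h2 t y y'
  intro t ht
  have h := dist_le_of_trajectories_ODE hlip
    (fun t ht => (hy t ht).continuousWithinAt) (hright hy)
    (fun t ht => (hz t ht).continuousWithinAt) (hright hz) (dist_le_zero.2 h0) t ht
  rw [zero_mul] at h
  exact dist_le_zero.1 h

/-- A solution on the Fourier side: `f = ⟨ξ⟩^s θ Û` and `h = ⟨ξ⟩^{s-1} θ V̂` with `V = ∂ₜU`. -/
structure FourierSol (T : ℝ) (f h : ℝ → L2 E) : Prop where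
  cont : ContinuousOn f (Icc 0 T)
  cont_deriv : ContinuousOn h (Icc 0 T)
  hasDeriv : ∀ t ∈ Icc 0 T, HasDerivWithinAt (fun τ => Q.emb (f τ)) (h t) (Icc 0 T) t
  rel : ∀ t ∈ Icc 0 T, Q.Rel (f t) (h t)

lemma continuousOn_G {T : ℝ} {x : ℝ → L2 E} (hx : ContinuousOn x (Icc 0 T)) :
    ContinuousOn (fun t => Q.G (-t) (x t)) (Icc 0 T) := fun t ht =>
  Q.tendsto_G (continuous_neg.continuousAt.mono_left nhdsWithin_le_nhds) (hx t ht)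

lemma continuousOn_force {S : Set ℝ} {f h : ℝ → L2 E} (hf : ContinuousOn f S)
    (hh : ContinuousOn h S) : ContinuousOn (fun t => Q.force (f t) (h t)) S := by
  unfold force quad
  fun_prop

/-- In the moving frame, a solution is differentiable in the strong norm. -/
lemma FourierSol.hasDerivWithinAt {T : ℝ} {f h : ℝ → L2 E} (hsol : Q.FourierSol T f h) :
    ∀ t ∈ Icc 0 T, HasDerivWithinAt (fun τ => Q.G (-τ) (f τ)) (Q.G (-t) (Q.force (f t) (h t)))
      (Icc 0 T) t := by
  intro t ht
  have hT : 0 ≤ T := ht.1.trans ht.2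
  let φ : ℝ → L2 E := fun τ => Q.G (-τ) (Q.force (f τ) (h τ))
  have hφ : ContinuousOn φ (Icc 0 T) := Q.continuousOn_G (Q.continuousOn_force hsol.cont
    hsol.cont_deriv)
  -- The extension is continuous on the whole line, so that its primitive is differentiable at every
  -- time, end points included.
  let φ' : ℝ → L2 E := IccExtend hT ((Icc 0 T).domRestrict φ)
  have hφ' : Continuous φ' := hφ.domRestrict.Icc_extend'
  have hφφ' : ∀ τ ∈ Icc 0 T, φ' τ = φ τ := fun τ hτ => IccExtend_of_mem hT _ hτ
  -- The definition of a solution gives a derivative only after `emb`. The primitive `z` is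
  -- differentiable in the strong norm; after `emb` it has the same derivative and initial value as
  -- the moving frame curve, and `emb` is injective.
  let z : ℝ → L2 E := fun τ => Q.G (-0) (f 0) + ∫ r in (0 : ℝ)..τ, φ' r
  have hz : ∀ τ, HasDerivAt z (φ' τ) τ := fun τ =>
    (intervalIntegral.integral_hasDerivAt_right (hφ'.intervalIntegrable _ _)
      (hφ'.stronglyMeasurableAtFilter _ _) hφ'.continuousAt).const_add _
  have hy : ∀ τ ∈ Icc 0 T, HasDerivWithinAt (fun τ => Q.emb (Q.G (-τ) (f τ))) (Q.emb (φ τ))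
      (Icc 0 T) τ := by
    intro τ hτ
    have h1 := Q.hasDerivWithinAt_G_apply (-1) (hsol.hasDeriv τ hτ) rfl
    simp only [neg_one_mul, G_emb] at h1
    convert h1 using 1
    have h2 := (hsol.rel τ hτ).eq Q
    conv_rhs => rw [h2]
    rw [map_add, G_linOp, G_emb, neg_one_smul]
    simp [φ]
  have hd : ∀ τ ∈ Icc 0 T, HasDerivWithinAt (fun τ => Q.emb (z τ) - Q.emb (Q.G (-τ) (f τ))) 0
      (Icc 0 T) τ := by
    intro τ hτ
    have h1 := (Q.emb.hasFDerivAt.comp_hasDerivAt τ (hz τ)).hasDerivWithinAt.sub (hy τ hτ)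
    rw [hφφ' τ hτ, sub_self] at h1
    exact h1
  have heq : ∀ τ ∈ Icc 0 T, z τ = Q.G (-τ) (f τ) := by
    intro τ hτ
    have h1 := constant_of_has_deriv_right_zero
      (fun τ hτ => (hd τ hτ).continuousWithinAt)
      (fun τ hτ => (hd τ ⟨hτ.1, hτ.2.le⟩).mono_of_mem_nhdsWithin
        (mem_of_superset (Icc_mem_nhdsGE hτ.2) (Icc_subset_Icc_left hτ.1))) τ hτ
    have h2 : z 0 = Q.G (-0) (f 0) := by simp [z]
    rw [h2, sub_self, sub_eq_zero] at h1
    exact Q.emb_injective h1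
  have h3 := (hz t).hasDerivWithinAt (s := Icc 0 T)
  rw [hφφ' t ht] at h3
  exact h3.congr (fun τ hτ => (heq τ hτ).symm) (heq t ht).symm

/-- A solution that stays in the ball of radius `R` solves the truncated equation. -/
lemma FourierSol.field {T R : ℝ} (hR : Q.Small R) (hR0 : 0 < R) {f h : ℝ → L2 E}
    (hsol : Q.FourierSol T f h) (hf : ∀ t ∈ Icc 0 T, ‖f t‖ ≤ R) :
    ∀ t ∈ Icc 0 T, HasDerivWithinAt (fun τ => Q.G (-τ) (f τ))
      (Q.field R t (Q.G (-t) (f t))) (Icc 0 T) t := by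
  intro t ht
  have h1 := hsol.hasDerivWithinAt Q t ht
  have h2 : h t = Q.vel (f t) := Q.rel_unique (hR.mono Q (hf t ht)) (hsol.rel t ht)
    (Q.rel_vel (hR.mono Q (hf t ht)))
  rwa [Model.field, G_G_neg, trunc_of_norm_le hR0 (hf t ht), F, ← h2]

lemma FourierSol.mono {T T' : ℝ} (hT : T' ≤ T) {f h : ℝ → L2 E} (hsol : Q.FourierSol T f h) :
    Q.FourierSol T' f h := by
  have hsub : Icc 0 T' ⊆ Icc 0 T := Icc_subset_Icc_right hT
  exact ⟨hsol.cont.mono hsub, hsol.cont_deriv.mono hsub,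
    fun t ht => (hsol.hasDeriv t (hsub ht)).mono hsub, fun t ht => hsol.rel t (hsub ht)⟩

/-- Uniqueness: a solution that is bounded by `r < R` is the only one. -/
lemma FourierSol.unique {T r R : ℝ} (hR : Q.Small R) (hrR : r < R) {f h f' h' : ℝ → L2 E}
    (hsol : Q.FourierSol T f h) (hf : ∀ t ∈ Icc 0 T, ‖f t‖ ≤ r)
    (hsol' : Q.FourierSol T f' h') (h0 : f' 0 = f 0) :
    ∀ t ∈ Icc 0 T, f' t = f t ∧ h' t = h t := by
  have key : ∀ t ∈ Icc 0 T, (∀ τ ∈ Icc 0 t, ‖f' τ‖ ≤ R) → f' t = f t := by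
    intro t ht hb
    have hR0 : 0 < R := (norm_nonneg _).trans_lt ((hf t ht).trans_lt hrR)
    have h1 := (hsol.mono Q ht.2).field Q hR hR0
      (fun τ hτ => (hf τ ⟨hτ.1, hτ.2.trans ht.2⟩).trans hrR.le)
    have h2 := (hsol'.mono Q ht.2).field Q hR hR0 hb
    have h3 := Q.field_unique hR hR0 h2 h1 (by simp [h0]) t ⟨ht.1, le_rfl⟩
    have h4 := congrArg (Q.G t) h3
    simpa only [G_G_neg] using h4
  -- No bound on the competitor is assumed. While it stays in the ball of radius `R` it equals `f`
  -- and is thus bounded by `r < R`; continuity then prevents it from leaving.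
  have hle : ∀ t ∈ Icc 0 T, ‖f' t‖ ≤ r := by
    by_cases hT : 0 ≤ T
    · refine le_of_bootstrap hsol'.cont.norm ?_ hrR fun t ht hb => ?_
      · rw [h0]; exact hf 0 (left_mem_Icc.2 hT)
      · rw [key t ht hb]; exact hf t ht
    · intro t ht
      exact absurd (ht.1.trans ht.2) hT
  intro t ht
  have h1 : f' t = f t := key t ht fun τ hτ => (hle τ ⟨hτ.1, hτ.2.trans ht.2⟩).trans hrR.le
  refine ⟨h1, Q.rel_unique (hR.mono Q ((hf t ht).trans hrR.le)) ?_ (hsol.rel t ht)⟩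
  rw [← h1]
  exact hsol'.rel t ht

end Model

/-! ### Commutator and integration by parts -/

section Identities

variable {E : Type*} [NormedAddCommGroup E] [InnerProductSpace ℝ E] [CompleteSpace E]
variable {s : ℝ} {b : E →L[ℝ] E →L[ℝ] E}

/-- `⟨ξ⟩^s = (⟨ξ⟩^s - ⟨η⟩^s) + ⟨η⟩^s`: the weight is commuted past the coefficient. -/
lemma jb_mul_kProd (s ξ η : ℝ) : jb ξ * kProd s ξ η = kComm s ξ η + kMul s ξ η * jb η := by
  have h1 : jb ξ * jb ξ ^ (s - 1) = jb ξ ^ s := by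
    conv_lhs => rw [← Real.rpow_one (jb ξ), ← Real.rpow_mul (jb_pos ξ).le, one_mul, jb_rpow_mul]
    congr 1; ring
  have h2 : jb η ^ s * jb η ^ (-(s - 1)) = jb η := by
    rw [jb_rpow_mul, show s + -(s - 1) = 1 by ring, Real.rpow_one]
  rw [kProd, kComm, kMul]
  linear_combination (jb (ξ - η) ^ (-s) * jb η ^ (-(s - 1))) * h1 + jb (ξ - η) ^ (-s) * h2

lemma kMul_mul_jb (s ξ η : ℝ) : kMul s ξ η * jb (ξ - η) = kMul (s - 1) ξ η := by
  rw [kMul, kMul]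
  conv_lhs => rw [← Real.rpow_one (jb (ξ - η)), ← Real.rpow_mul (jb_pos _).le, one_mul, jb_rpow_mul]
  congr 1; ring

/-- The product splits into the commutator and the multiplication operator. -/
lemma inner_bil_kProd (hs : 3 / 2 < s) (b : E →L[ℝ] E →L[ℝ] E) {a g g' x x' : L2 E}
    (hg : g' =ᵐ[volume] fun ξ => jb ξ • g ξ) (hx : x' =ᵐ[volume] fun ξ => jb ξ • x ξ) :
    ⟪bil (wt s) (kProd s) b a g, x'⟫
      = ⟪bil (wt s) (kComm s) b a g, x⟫ + ⟪bil (wt s) (kMul s) b a g', x⟫ := by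
  have hw := isWeight_wt hs
  have h1 := isKernel_kProd hs
  have h2 := isKernel_kComm hs
  have h3 : IsKernel (wt s) (kMul s) 1 := isKernel_kMul (by linarith)
  rw [← inner_add_left, L2.inner_def, L2.inner_def]
  refine integral_congr_ae ?_
  filter_upwards [bil_ae hw h1 b a g, bil_ae hw h2 b a g, bil_ae hw h3 b a g',
    Lp.coeFn_add (bil (wt s) (kComm s) b a g) (bil (wt s) (kMul s) b a g'), hx,
    ae_integrable_convI hw h2 b a g, ae_integrable_convI hw h3 b a g'] with ξ e1 e2 e3 e4 e5 i1 i2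
  rw [e4, Pi.add_apply, e1, e2, e3, e5, inner_smul_right, ← real_inner_smul_left]
  congr 1
  rw [convK, convK, convK, ← integral_add i1 i2, ← integral_smul]
  refine integral_congr_ae ?_
  filter_upwards [hg] with η e6
  simp only [convI]
  rw [smul_smul, jb_mul_kProd, add_smul, e6, map_smul, smul_smul]

/-- A derivative on the first factor is absorbed by the kernel, which becomes the borderline `kMul
(s - 1)`, still dominated by the weight. -/
lemma bil_kMul_sub_one (hs : 3 / 2 < s) (b : E →L[ℝ] E →L[ℝ] E) {g g' x : L2 E}
    (hg : g' =ᵐ[volume] fun ξ => jb ξ • g ξ) :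
    bil (wt s) (kMul s) b g' x = bil (wt s) (kMul (s - 1)) b g x := by
  refine bil_eq_bil (isWeight_wt hs) (isKernel_kMul (by linarith)) (isKernel_kMul le_rfl) fun ξ => ?_
  have h1 : ∀ᵐ η, g' (ξ - η) = jb (ξ - η) • g (ξ - η) :=
    (Measure.measurePreserving_sub_left volume ξ).quasiMeasurePreserving.ae hg
  filter_upwards [h1] with η h2
  rw [convI, convI, h2, map_smul, smul_apply, smul_smul, kMul_mul_jb]

/-- Integration by parts: for real `a`, `(b(a) ∂a, a) = -(b(∂a) a, a) / 2`. -/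
lemma inner_bil_kMul_deriv (hs : 3 / 2 < s) {I c : E →L[ℝ] E} {K : ℝ}
    (hI : ∀ x y, ⟪I x, y⟫ = -⟪x, I y⟫) (hb : IsQuadCoeff I c K b) {a d d' : L2 E}
    (ha : ∀ᵐ ξ, a (-ξ) = c (a ξ)) (hd : d' =ᵐ[volume] fun ξ => Model.q ξ • I (a ξ))
    (hd' : d' =ᵐ[volume] fun ξ => jb ξ • d ξ) :
    2 * ⟪bil (wt s) (kMul s) b a d', a⟫ = -⟪bil (wt s) (kMul (s - 1)) b d a, a⟫ := by
  have hw := isWeight_wt hs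
  have h3 : IsKernel (wt s) (kMul s) 1 := isKernel_kMul (by linarith)
  rw [← bil_kMul_sub_one hs b hd']
  have hsymm := inner_bil_symm hw h3 (kMul_comm s) hb.symm ha d' a
  -- The Leibniz rule `q(ξ) = q(ξ - η) + q(η)` together with the skewness of `I`. By `hsymm` the
  -- left-hand side equals one of the terms on the right, which is the source of the factor 2.
  have hparts : ⟪bil (wt s) (kMul s) b a a, d'⟫
      = -⟪bil (wt s) (kMul s) b d' a + bil (wt s) (kMul s) b a d', a⟫ := by
    rw [← inner_neg_left, L2.inner_def, L2.inner_def]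
    refine integral_congr_ae ?_
    filter_upwards [bil_ae hw h3 b a a, bil_ae hw h3 b d' a, bil_ae hw h3 b a d',
      Lp.coeFn_add (bil (wt s) (kMul s) b d' a) (bil (wt s) (kMul s) b a d'),
      Lp.coeFn_neg (bil (wt s) (kMul s) b d' a + bil (wt s) (kMul s) b a d'), hd,
      ae_integrable_convI hw h3 b a a,
      ae_integrable_convI hw h3 b d' a, ae_integrable_convI hw h3 b a d']
      with ξ e1 e2 e3 e4 e5 e6 i0 i1 i2
    rw [e5, Pi.neg_apply, e4, Pi.add_apply, e1, e2, e3, e6, inner_smul_right,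
      ← neg_eq_iff_eq_neg.2 (hI _ _), inner_neg_left, mul_neg, ← real_inner_smul_left]
    congr 2
    rw [convK, convK, convK, ← integral_add i1 i2, ← I.integral_comp_comm i0, ← integral_smul]
    refine integral_congr_ae ?_
    have h1 : ∀ᵐ η, d' (ξ - η) = Model.q (ξ - η) • I (a (ξ - η)) :=
      (Measure.measurePreserving_sub_left volume ξ).quasiMeasurePreserving.ae hd
    filter_upwards [h1, hd] with η f1 f2
    simp only [convI]
    rw [f1, f2, map_smul, map_smul, map_smul, smul_apply, hb.I_left, hb.I_right, smul_smul,
      smul_smul, smul_smul, ← add_smul]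
    congr 1
    simp only [Model.q]; ring
  rw [inner_add_left] at hparts
  linarith

end Identities

namespace Model

variable {E : Type*} [NormedAddCommGroup E] [InnerProductSpace ℝ E] {κ K s : ℝ}
variable (Q : Model E κ K s)
variable [FiniteDimensional ℝ E] [CompleteSpace E]

/-! ### The energy estimate -/

/-- `f = ⟨ξ⟩^s θ Û ↦ ⟨ξ⟩^{s+1} Û` -/
def jaOp : L2 E →L[ℝ] L2 E := mulOp fun ξ => (jb ξ * (Q.θ ξ)⁻¹) • (1 : E →L[ℝ] E)

/-- `f = ⟨ξ⟩^s θ Û ↦ ⟨ξ⟩^s i q Û` -/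
def jdOp : L2 E →L[ℝ] L2 E := mulOp fun ξ => (q ξ * (Q.θ ξ)⁻¹) • Q.I

/-- Multiplication by `θ⁻² M`. -/
def mOp : L2 E →L[ℝ] L2 E := mulOp fun ξ => ((Q.θ ξ)⁻¹ ^ 2) • Q.M ξ

lemma isMult_jaOp : IsMult (fun ξ => (jb ξ * (Q.θ ξ)⁻¹) • (1 : E →L[ℝ] E)) (√Q.ε)⁻¹ :=
  isMult_smul_one (continuous_jb.mul Q.continuous_inv_θ) fun ξ => by
    have := jb_pos ξ
    have := Q.θ_pos ξ
    rw [abs_of_pos (by positivity)]; exact Q.jb_div_θ_le ξ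

lemma isMult_jdOp : IsMult (fun ξ => (q ξ * (Q.θ ξ)⁻¹) • Q.I) (√Q.ε)⁻¹ :=
  isMult_smul (continuous_q.mul Q.continuous_inv_θ) continuous_const fun ξ => by
    have h1 := Q.θ_pos ξ
    rw [abs_mul, abs_of_pos (inv_pos.2 h1)]
    calc |q ξ| * (Q.θ ξ)⁻¹ * ‖Q.I‖ ≤ jb ξ * (Q.θ ξ)⁻¹ * 1 := by
          have := jb_pos ξ
          gcongr
          · exact abs_le_jb ξ
          · exact Q.norm_I_le
      _ ≤ _ := by rw [mul_one]; exact Q.jb_div_θ_le ξ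

lemma isMult_mOp : IsMult (fun ξ => ((Q.θ ξ)⁻¹ ^ 2) • Q.M ξ) K :=
  isMult_smul (Q.continuous_inv_θ.pow 2) Q.continuous_M fun ξ => by
    have h1 := Q.θ_pos ξ
    rw [abs_of_pos (by positivity)]
    calc (Q.θ ξ)⁻¹ ^ 2 * ‖Q.M ξ‖ ≤ (Q.θ ξ)⁻¹ ^ 2 * (K * Q.θ ξ ^ 2) := by
          gcongr; exact Q.norm_M_le ξ
      _ = K := by field_simp

lemma aOp_ae (f : L2 E) : Q.aOp f =ᵐ[volume] fun ξ => (Q.θ ξ)⁻¹ • f ξ := by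
  filter_upwards [mulOp_ae Q.isMult_aOp f] with ξ h
  rw [aOp, h]; simp

lemma dOp_ae (f : L2 E) :
    Q.dOp f =ᵐ[volume] fun ξ => (q ξ * (jb ξ)⁻¹ * (Q.θ ξ)⁻¹) • Q.I (f ξ) := by
  filter_upwards [mulOp_ae Q.isMult_dOp f] with ξ h
  rw [dOp, h]; simp

lemma jaOp_ae (f : L2 E) : Q.jaOp f =ᵐ[volume] fun ξ => jb ξ • Q.aOp f ξ := by
  filter_upwards [mulOp_ae Q.isMult_jaOp f, Q.aOp_ae f] with ξ h h2
  rw [jaOp, h, h2]; simp [smul_smul]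

lemma jdOp_ae (f : L2 E) : Q.jdOp f =ᵐ[volume] fun ξ => q ξ • Q.I (Q.aOp f ξ) := by
  filter_upwards [mulOp_ae Q.isMult_jdOp f, Q.aOp_ae f] with ξ h h2
  rw [jdOp, h, h2]; simp [smul_smul]

lemma jdOp_ae' (f : L2 E) : Q.jdOp f =ᵐ[volume] fun ξ => jb ξ • Q.dOp f ξ := by
  filter_upwards [mulOp_ae Q.isMult_jdOp f, Q.dOp_ae f] with ξ h h2
  have := (jb_pos ξ).ne'
  rw [jdOp, h, h2, smul_smul, smul_apply]
  congr 1
  field_simp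

lemma jaOp_emb (f : L2 E) : Q.jaOp (Q.emb f) = Q.aOp f := by
  apply Lp.ext
  filter_upwards [Q.jaOp_ae (Q.emb f), Q.aOp_ae (Q.emb f), Q.emb_ae f, Q.aOp_ae f]
    with ξ h1 h2 h3 h4
  have := (jb_pos ξ).ne'
  rw [h1, h2, h3, h4, smul_smul, smul_smul]
  congr 1
  field_simp

lemma inner_mOp_G (t : ℝ) (y z : L2 E) : ⟪Q.mOp (Q.G t y), Q.G t z⟫ = ⟪Q.mOp y, z⟫ := by
  rw [L2.inner_def, L2.inner_def]
  refine integral_congr_ae ?_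
  filter_upwards [mulOp_ae Q.isMult_mOp (Q.G t y), mulOp_ae (Q.isMult_prop t) y,
    mulOp_ae (Q.isMult_prop t) z, mulOp_ae Q.isMult_mOp y] with ξ h1 h2 h3 h4
  rw [mOp, h1, h4, G, h2, h3, smul_apply, smul_apply, inner_smul_left, inner_smul_left,
    inner_M_prop]

lemma mOp_symm (y z : L2 E) : ⟪Q.mOp y, z⟫ = ⟪Q.mOp z, y⟫ := by
  rw [mOp, inner_mulOp_left Q.isMult_mOp Q.isMult_mOp (fun ξ x y => by
    simp [inner_smul_left, inner_smul_right, Q.M_symm]), real_inner_comm]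

lemma coercive_mOp (f : L2 E) : κ / 2 * ‖f‖ ^ 2 ≤ ⟪Q.mOp f, f⟫ := by
  rw [← real_inner_self_eq_norm_sq, L2.inner_def, L2.inner_def, ← integral_const_mul]
  refine integral_mono_ae ?_ ?_ ?_
  · exact (L2.integrable_inner f f).const_mul _
  · exact L2.integrable_inner (Q.mOp f) f
  · filter_upwards [mulOp_ae Q.isMult_mOp f] with ξ h
    rw [mOp, h, smul_apply, inner_smul_left, real_inner_self_eq_norm_sq]
    have h1 := Q.coercive_M ξ (f ξ)
    have h2 := Q.θ_pos ξ
    have h3 := mul_le_mul_of_nonneg_left h1 (by positivity : 0 ≤ (Q.θ ξ)⁻¹ ^ 2)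
    refine le_trans (le_of_eq ?_) h3
    field_simp

/-- `θ⁻² M · ⟨ξ⟩ θ M⁻¹ = ⟨ξ⟩ θ⁻¹`: the inverse of `M` disappears, and the product is paired with
`⟨ξ⟩^{s+1} Û`. This is one derivative too many for a bound uniform in `ε`. -/
lemma inner_mOp_force (f h : L2 E) :
    ⟪Q.mOp (Q.force f h), f⟫ = -(Q.ε * ⟪Q.quad f h, Q.jaOp f⟫) := by
  have h1 : ∀ g, Q.mOp (Q.forceOp g) = Q.jaOp g := by
    intro g
    rw [mOp, forceOp, mulOp_mulOp Q.isMult_mOp Q.isMult_forceOp, jaOp]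
    congr 2
    ext1 ξ
    rw [smul_mul_smul_comm, M_mul_Minv]
    have := (Q.θ_pos ξ).ne'
    congr 1
    field_simp
  rw [force, map_neg, map_smul, h1, inner_neg_left, real_inner_smul_left, jaOp,
    inner_mulOp_left Q.isMult_jaOp Q.isMult_jaOp
      (fun ξ x y => by simp [inner_smul_left, inner_smul_right])]

/-- The energy. -/
def energy (f : L2 E) : ℝ :=
  ⟪Q.mOp f, f⟫ + Q.ε * ⟪bil (wt s) (kMul s) Q.S₁ (Q.aOp f) (Q.aOp f), Q.aOp f⟫

/-- The time derivative of the energy. -/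
def energyDeriv (f h : L2 E) : ℝ :=
  Q.ε * (⟪bil (wt s) (kMul (s - 1)) Q.S₁ (Q.aOp h) (Q.aOp f), Q.aOp f⟫
    - 2 * ⟪bil (wt s) (kComm s) Q.S₁ (Q.aOp f) (Q.aOp h), Q.aOp f⟫
    - 2 * ⟪bil (wt s) (kComm s) Q.N₁ (Q.aOp f) (Q.dOp f), Q.aOp f⟫
    + ⟪bil (wt s) (kMul (s - 1)) Q.N₁ (Q.dOp f) (Q.aOp f), Q.aOp f⟫)

/-- The cancellation for which the cubic term is added to the energy. By `inner_bil_kProd` the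
pairing with `⟨ξ⟩^{s+1} Û` produces `-2 (S₁(a) ⟨ξ⟩^s V̂, a)` beside a commutator; the last two terms
from the cubic part are equal by symmetry and cancel it. The `N₁` term is integrated by parts. All
surviving terms contain only `aOp` and `dOp`, which are bounded by 1. -/
lemma energyDeriv_eq {f h : L2 E} (hf : reflOp Q.c f = f) :
    2 * ⟪Q.mOp (Q.force f h), f⟫
      + Q.ε * (⟪bil (wt s) (kMul s) Q.S₁ (Q.jaOp h) (Q.aOp f), Q.aOp f⟫
        + ⟪bil (wt s) (kMul s) Q.S₁ (Q.aOp f) (Q.jaOp h), Q.aOp f⟫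
        + ⟪bil (wt s) (kMul s) Q.S₁ (Q.aOp f) (Q.aOp f), Q.jaOp h⟫) = Q.energyDeriv f h := by
  have hs := Q.hs
  have ha : ∀ᵐ ξ, Q.aOp f (-ξ) = Q.c (Q.aOp f ξ) := by
    rw [← reflOp_eq_self_iff Q.c_c, reflOp_aOp, hf]
  have e1 := inner_bil_kProd hs Q.S₁ (a := Q.aOp f) (Q.jaOp_ae h) (Q.jaOp_ae f)
  have e2 := inner_bil_kProd hs Q.N₁ (a := Q.aOp f) (Q.jdOp_ae' f) (Q.jaOp_ae f)
  have e3 := inner_bil_kMul_deriv hs Q.I_skew Q.hN₁ ha (Q.jdOp_ae f) (Q.jdOp_ae' f)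
  have e4 := inner_bil_symm (isWeight_wt hs) (isKernel_kMul (by linarith)) (kMul_comm s)
    Q.hS₁.symm ha (Q.aOp f) (Q.jaOp h)
  have e5 := bil_kMul_sub_one hs Q.S₁ (x := Q.aOp f) (Q.jaOp_ae h)
  rw [inner_mOp_force, e4, e5, quad, inner_add_left, e1, e2, energyDeriv]
  linear_combination (-Q.ε) * e3

/-- The constants in the estimates of the commutator and of the products. -/
def D (_ : Model E κ K s) : ℝ := weightConst (wt s) * ((s * 2 ^ (s - 1) + 1) * K)

lemma D_nonneg : 0 ≤ Q.D := by
  have := weightConst_nonneg (wt s); have := Q.K_nonneg; have := Q.hs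
  have : 0 < s := by linarith
  unfold D; positivity

lemma abs_inner_bil_le {k : ℝ → ℝ → ℝ} {C : ℝ} (hk : IsKernel (wt s) k C)
    (hC : C ≤ s * 2 ^ (s - 1) + 1) {b : E →L[ℝ] E →L[ℝ] E} (hb : ‖b‖ ≤ K) {f g x : L2 E}
    {x₁ x₂ x₃ : ℝ} (hf : ‖f‖ ≤ x₁) (hg : ‖g‖ ≤ x₂) (hx : ‖x‖ ≤ x₃) :
    |⟪bil (wt s) k b f g, x⟫| ≤ Q.D * x₁ * x₂ * x₃ := by
  refine (abs_real_inner_le_norm _ _).trans ?_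
  have h0 := weightConst_nonneg (wt s)
  have h1 : 0 ≤ x₁ := (norm_nonneg _).trans hf
  have h2 : 0 ≤ x₂ := (norm_nonneg _).trans hg
  have h3 := hk.nonneg
  have h4 := Q.D_nonneg
  have h5 : 0 ≤ s * 2 ^ (s - 1) + 1 := h3.trans hC
  gcongr
  refine (norm_bil_le (isWeight_wt Q.hs) hk b f g).trans ?_
  unfold D
  gcongr

lemma one_le_kernelConst (Q : Model E κ K s) : (1 : ℝ) ≤ s * 2 ^ (s - 1) + 1 := by
  have := Q.hs
  have : 0 < s := by linarith
  have : 0 ≤ s * 2 ^ (s - 1) := by positivity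
  linarith

lemma abs_cubic_le (f : L2 E) :
    |⟪bil (wt s) (kMul s) Q.S₁ (Q.aOp f) (Q.aOp f), Q.aOp f⟫| ≤ Q.D * ‖f‖ * ‖f‖ * ‖f‖ :=
  Q.abs_inner_bil_le (isKernel_kMul (by linarith)) Q.one_le_kernelConst Q.hS₁.bound
    (Q.norm_aOp_le f) (Q.norm_aOp_le f) (Q.norm_aOp_le f)

/-- The four terms have coefficients 1 and 2 with `‖h‖`, 2 and 1 with `‖f‖`: hence the 3. No
negative power of `ε` occurs. -/
lemma abs_energyDeriv_le (f h : L2 E) :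
    |Q.energyDeriv f h| ≤ Q.ε * (3 * Q.D * (‖h‖ + ‖f‖) * ‖f‖ ^ 2) := by
  have hm : IsKernel (wt s) (kMul (s - 1)) 1 := isKernel_kMul le_rfl
  have hc := isKernel_kComm Q.hs
  have hC : s * 2 ^ (s - 1) ≤ s * 2 ^ (s - 1) + 1 := by linarith
  have h1 := Q.abs_inner_bil_le hm Q.one_le_kernelConst Q.hS₁.bound
    (Q.norm_aOp_le h) (Q.norm_aOp_le f) (Q.norm_aOp_le f)
  have h2 := Q.abs_inner_bil_le hc hC Q.hS₁.bound
    (Q.norm_aOp_le f) (Q.norm_aOp_le h) (Q.norm_aOp_le f)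
  have h3 := Q.abs_inner_bil_le hc hC Q.hN₁.bound
    (Q.norm_aOp_le f) (Q.norm_dOp_le f) (Q.norm_aOp_le f)
  have h4 := Q.abs_inner_bil_le hm Q.one_le_kernelConst Q.hN₁.bound
    (Q.norm_dOp_le f) (Q.norm_aOp_le f) (Q.norm_aOp_le f)
  rw [energyDeriv, abs_mul, abs_of_pos Q.hε]
  refine mul_le_mul_of_nonneg_left ?_ Q.hε.le
  rw [abs_le] at *
  constructor <;> nlinarith

end Model

/-- Grönwall's inequality for a nonnegative multiple of the function. -/
lemma le_exp_of_deriv_le {e e' : ℝ → ℝ} {T k : ℝ}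
    (he : ∀ t ∈ Icc 0 T, HasDerivWithinAt e (e' t) (Icc 0 T) t)
    (h : ∀ t ∈ Icc 0 T, e' t ≤ k * e t) : ∀ t ∈ Icc 0 T, e t ≤ e 0 * Real.exp (k * t) := by
  intro t ht
  have h1 := le_gronwallBound_of_liminf_deriv_right_le (f := e) (f' := e') (δ := e 0) (K := k)
    (ε := 0) (a := 0) (b := T) (fun t ht => (he t ht).continuousWithinAt)
    (fun t ht r hr => by
      have h2 : HasDerivWithinAt e (e' t) (Ici t) t :=
        (he t ⟨ht.1, ht.2.le⟩).mono_of_mem_nhdsWithin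
          (mem_of_superset (Icc_mem_nhdsGE ht.2) (Icc_subset_Icc_left ht.1))
      exact h2.liminf_right_slope_le hr)
    le_rfl (fun t ht => by simpa using h t ⟨ht.1, ht.2.le⟩) t ht
  rwa [gronwallBound_ε0, sub_zero] at h1

/-! ### Energy bounds and existence up to time `T / ε`. -/

namespace Model

variable {E : Type*} [NormedAddCommGroup E] [InnerProductSpace ℝ E] {κ K s : ℝ}
variable (Q : Model E κ K s)
variable [FiniteDimensional ℝ E] [CompleteSpace E]

/-- Bound on `ε ‖f‖` under which the energy is coercive and the equation can be solved for the
time derivative. -/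
def ρ : ℝ := (1 + 4 / κ * (Q.B + Q.D))⁻¹

lemma ρ_pos : 0 < Q.ρ := by
  have := Q.hκ; have := Q.B_nonneg; have := Q.D_nonneg
  unfold ρ; positivity

lemma mul_le_of_le_ρ {x : ℝ} (hx0 : 0 ≤ x) (hx : x ≤ Q.ρ) :
    x * (4 / κ * Q.B) ≤ 1 ∧ x * (4 / κ * Q.D) ≤ 1 := by
  have hκ := Q.hκ; have hB := Q.B_nonneg; have hD := Q.D_nonneg
  have h1 : x * (1 + 4 / κ * (Q.B + Q.D)) ≤ 1 := by
    have h2 := mul_le_mul_of_nonneg_right hx (by positivity : 0 ≤ 1 + 4 / κ * (Q.B + Q.D))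
    rwa [ρ, inv_mul_cancel₀ (by positivity)] at h2
  have h2 : 0 ≤ x * (4 / κ * Q.B) := by positivity
  have h3 : 0 ≤ x * (4 / κ * Q.D) := by positivity
  constructor <;> linarith

lemma small_of_le_ρ {R : ℝ} (hR0 : 0 ≤ R) (hR : Q.ε * R ≤ Q.ρ) : Q.Small R := by
  have h := (Q.mul_le_of_le_ρ (mul_nonneg Q.hε.le hR0) hR).1
  have e : Q.ε * (2 / κ * (Q.B * R)) = 1 / 2 * (Q.ε * R * (4 / κ * Q.B)) := by ring
  rw [Small, e]
  linarith

/-- The choice of `ρ` lets the cubic correction use up at most half of the coercivity `κ / 2` of the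
quadratic part. -/
lemma abs_eps_cubic_le {R : ℝ} (hR : Q.ε * R ≤ Q.ρ) {f : L2 E} (hf : ‖f‖ ≤ R) :
    |Q.ε * ⟪bil (wt s) (kMul s) Q.S₁ (Q.aOp f) (Q.aOp f), Q.aOp f⟫| ≤ κ / 4 * ‖f‖ ^ 2 := by
  have hκ := Q.hκ
  have hR0 : 0 ≤ R := (norm_nonneg _).trans hf
  have h := (Q.mul_le_of_le_ρ (mul_nonneg Q.hε.le hR0) hR).2
  have h1 : Q.ε * R * Q.D ≤ κ / 4 := by
    have e : Q.ε * R * (4 / κ * Q.D) = 4 / κ * (Q.ε * R * Q.D) := by ring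
    rw [e, div_mul_eq_mul_div, div_le_one hκ] at h
    linarith
  rw [abs_mul, abs_of_pos Q.hε]
  have hε := Q.hε
  have hD := Q.D_nonneg
  calc Q.ε * |⟪bil (wt s) (kMul s) Q.S₁ (Q.aOp f) (Q.aOp f), Q.aOp f⟫|
      ≤ Q.ε * (Q.D * ‖f‖ * ‖f‖ * ‖f‖) := by gcongr; exact Q.abs_cubic_le f
    _ = Q.ε * ‖f‖ * Q.D * ‖f‖ ^ 2 := by ring
    _ ≤ Q.ε * R * Q.D * ‖f‖ ^ 2 := by gcongr
    _ ≤ _ := by gcongr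

lemma le_energy {R : ℝ} (hR : Q.ε * R ≤ Q.ρ) {f : L2 E} (hf : ‖f‖ ≤ R) :
    κ / 4 * ‖f‖ ^ 2 ≤ Q.energy f := by
  have h1 := Q.coercive_mOp f
  have h2 := (abs_le.1 (Q.abs_eps_cubic_le hR hf)).1
  rw [energy]; linarith

lemma energy_le {R : ℝ} (hR : Q.ε * R ≤ Q.ρ) {f : L2 E} (hf : ‖f‖ ≤ R) :
    Q.energy f ≤ (K + κ / 4) * ‖f‖ ^ 2 := by
  have h1 : ⟪Q.mOp f, f⟫ ≤ K * ‖f‖ ^ 2 := by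
    refine (real_inner_le_norm _ _).trans ?_
    rw [sq, ← mul_assoc]
    gcongr
    exact norm_mulOp_le Q.isMult_mOp f
  have h2 := (abs_le.1 (Q.abs_eps_cubic_le hR hf)).2
  rw [energy]; linarith

/-- The rate of growth of the energy is `ε R` times this constant. -/
def rate : ℝ := 4 / κ * (3 * Q.D * (2 * Q.Λ + 2))

lemma rate_nonneg : 0 ≤ Q.rate := by
  have := Q.hκ; have := Q.Λ_nonneg; have := Q.D_nonneg
  unfold rate; positivity

/-- `‖h‖ + ‖f‖ ≤ (2Λ + 2) R` and `‖f‖² ≤ (4/κ)` times the energy; these are the factors of `rate`.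
-/
lemma energyDeriv_le {R : ℝ} (hR : Q.ε * R ≤ Q.ρ) {f h : L2 E} (hf : ‖f‖ ≤ R) (hr : Q.Rel f h) :
    Q.energyDeriv f h ≤ Q.ε * R * Q.rate * Q.energy f := by
  have hκ := Q.hκ
  have hε := Q.hε
  have hD := Q.D_nonneg
  have hΛ := Q.Λ_nonneg
  have hR0 : 0 ≤ R := (norm_nonneg _).trans hf
  have hsm : Q.Small ‖f‖ := (Q.small_of_le_ρ hR0 hR).mono Q hf
  have h1 := Q.norm_le_of_rel hsm hr
  have h2 := Q.le_energy hR hf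
  calc Q.energyDeriv f h ≤ Q.ε * (3 * Q.D * (‖h‖ + ‖f‖) * ‖f‖ ^ 2) :=
        (le_abs_self _).trans (Q.abs_energyDeriv_le f h)
    _ ≤ Q.ε * (3 * Q.D * ((2 * Q.Λ + 1) * R + R) * ‖f‖ ^ 2) := by
        gcongr
        exact h1.trans (by gcongr)
    _ = Q.ε * R * Q.rate * (κ / 4 * ‖f‖ ^ 2) := by rw [rate]; field_simp; ring
    _ ≤ _ := by
        have := Q.rate_nonneg
        gcongr

/-- The energy along a curve that solves the equation in the moving frame. -/
lemma hasDerivWithinAt_energy {y : ℝ → L2 E} {S : Set ℝ} {t : ℝ} {h : L2 E}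
    (hy : HasDerivWithinAt y (Q.G (-t) (Q.force (Q.G t (y t)) h)) S t)
    (hrel : Q.Rel (Q.G t (y t)) h) (hreal : reflOp Q.c (y t) = y t) :
    HasDerivWithinAt (fun τ => Q.energy (Q.G τ (y τ))) (Q.energyDeriv (Q.G t (y t)) h) S t := by
  set f := Q.G t (y t)
  have hf : reflOp Q.c f = f := by simp only [f]; rw [reflOp_G, hreal]
  have h1 : HasDerivWithinAt (fun τ => ⟪Q.mOp (Q.G τ (y τ)), Q.G τ (y τ)⟫)
      (2 * ⟪Q.mOp (Q.force f h), f⟫) S t := by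
    -- The quadratic part is invariant under `G`, so it may be differentiated along `y`, which is
    -- differentiable in the strong norm, whereas `G τ (y τ)` need not be.
    simp_rw [inner_mOp_G]
    have hm := Q.mOp.hasFDerivAt.comp_hasDerivWithinAt t hy
    have h2 := hm.inner ℝ hy
    refine h2.congr_deriv ?_
    rw [Function.comp_apply, Q.mOp_symm (y t), ← two_mul, ← Q.inner_mOp_G t, G_G_neg]
  -- `aOp = jaOp ∘ emb` with `jaOp` bounded for fixed `ε`: the curve is differentiable after `emb`,
  -- which is enough for the cubic term.
  have ha : HasDerivWithinAt (fun τ => Q.aOp (Q.G τ (y τ))) (Q.jaOp h) S t := by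
    have h2 : HasDerivWithinAt (fun τ => Q.emb (y τ)) _ S t :=
      Q.emb.hasFDerivAt.comp_hasDerivWithinAt t hy
    have h3 := Q.hasDerivWithinAt_G_apply 1 h2 rfl
    simp only [one_mul, one_smul, G_emb] at h3
    rw [G_G_neg, add_comm, ← hrel.eq Q] at h3
    have h4 := Q.jaOp.hasFDerivAt.comp_hasDerivWithinAt t h3
    simp only [Function.comp_def, jaOp_emb] at h4
    exact h4
  have hb : HasDerivWithinAt (fun τ => bil (wt s) (kMul s) Q.S₁ (Q.aOp (Q.G τ (y τ)))
      (Q.aOp (Q.G τ (y τ)))) (bil (wt s) (kMul s) Q.S₁ (Q.jaOp h) (Q.aOp f)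
        + bil (wt s) (kMul s) Q.S₁ (Q.aOp f) (Q.jaOp h)) S t := by
    have h5 := ((bil (wt s) (kMul s) Q.S₁).isBoundedBilinearMap.hasFDerivAt
      (Q.aOp f, Q.aOp f)).comp_hasDerivWithinAt t (ha.prodMk ha)
    refine h5.congr_deriv ?_
    simp [add_comm]
  have hc := (hb.inner ℝ ha).const_mul Q.ε
  have := h1.add hc
  refine this.congr_deriv ?_
  rw [← Q.energyDeriv_eq hf, inner_add_left]
  ring

/-- The amplification factor of the norm. -/
def amp (_ : Model E κ K s) : ℝ := √(12 / κ * (K + κ / 4))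

lemma one_le_amp : 1 ≤ Q.amp := by
  have hκ := Q.hκ; have hK := Q.K_nonneg
  rw [amp, Real.one_le_sqrt]
  have e : 12 / κ * (K + κ / 4) = 12 / κ * K + 3 := by field_simp; ring
  rw [e]
  have : 0 ≤ 12 / κ * K := by positivity
  linarith

/-- Existence of the solution up to time `T / ε`, with a uniform bound. -/
theorem exists_fourierSol {f₀ : L2 E} (hf₀ : reflOp Q.c f₀ = f₀) {R T : ℝ} (hT : 0 < T)
    (hR : Q.amp * ‖f₀‖ < R) (hRρ : Q.ε * R ≤ Q.ρ) (hRT : R * Q.rate * T ≤ 1) :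
    ∃ f h : ℝ → L2 E, Q.FourierSol (T / Q.ε) f h ∧ f 0 = f₀ ∧
      ∀ t ∈ Icc 0 (T / Q.ε), ‖f t‖ ≤ Q.amp * ‖f₀‖ ∧ reflOp Q.c (f t) = f t ∧
        reflOp Q.c (h t) = h t := by
  have hamp := Q.one_le_amp
  have hR0 : 0 < R := lt_of_le_of_lt (mul_nonneg (by linarith) (norm_nonneg _)) hR
  have hsm := Q.small_of_le_ρ hR0.le hRρ
  have hε := Q.hε
  have hκ := Q.hκ
  have hT' : 0 < T / Q.ε := by positivity
  obtain ⟨y, hy0, hy⟩ := Q.exists_field_solution hsm hR0 hT'.le f₀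
  have hsmt : ∀ f : L2 E, Q.Small ‖trunc R f‖ := fun f => hsm.mono Q (norm_trunc_le hR0 f)
  have hreal : ∀ t ∈ Icc 0 (T / Q.ε), reflOp Q.c (y t) = y t := by
    -- The reflected curve solves the same truncated equation with the same datum.
    refine Q.field_unique hsm hR0 (fun t ht => ?_) hy (by rw [hy0, hf₀])
    have h1 := (reflOp Q.c).hasFDerivAt.comp_hasDerivWithinAt t (hy t ht)
    have htr : ∀ g : L2 E, reflOp Q.c (trunc R g) = trunc R (reflOp Q.c g) := fun g => by
      rw [trunc, map_smul, trunc, norm_reflOp_eq]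
    have h2 : reflOp Q.c (Q.field R t (y t)) = Q.field R t (reflOp Q.c (y t)) := by
      rw [field, reflOp_G, F, reflOp_force, Q.reflOp_vel (hsmt _), htr, reflOp_G, field, F]
    rwa [h2] at h1
  have hycont : ContinuousOn y (Icc 0 (T / Q.ε)) := fun t ht => (hy t ht).continuousWithinAt
  have hfcont : ContinuousOn (fun t => Q.G t (y t)) (Icc 0 (T / Q.ε)) := fun t ht =>
    Q.tendsto_G (tendsto_id.mono_left nhdsWithin_le_nhds) (hycont t ht)
  have hfreal : ∀ t ∈ Icc 0 (T / Q.ε), reflOp Q.c (Q.G t (y t)) = Q.G t (y t) := fun t ht => by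
    rw [reflOp_G, hreal t ht]
  have hf0 : Q.G 0 (y 0) = f₀ := by rw [G_zero, hy0]
  have hbound : ∀ t ∈ Icc 0 (T / Q.ε), ‖Q.G t (y t)‖ ≤ Q.amp * ‖f₀‖ := by
    -- While `‖f‖ ≤ R` the truncation is inactive and the energy estimate holds; it returns the
    -- better bound `amp ‖f₀‖ < R`.
    refine le_of_bootstrap hfcont.norm ?_ hR fun t ht hb => ?_
    · rw [hf0]; nlinarith [norm_nonneg f₀]
    · have hsub : Icc 0 t ⊆ Icc 0 (T / Q.ε) := Icc_subset_Icc_right ht.2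
      have hrel : ∀ τ ∈ Icc 0 t, Q.Rel (Q.G τ (y τ)) (Q.vel (Q.G τ (y τ))) := fun τ hτ =>
        Q.rel_vel (hsm.mono Q (hb τ hτ))
      have hen := le_exp_of_deriv_le (T := t) (k := Q.ε * R * Q.rate)
        (e := fun τ => Q.energy (Q.G τ (y τ)))
        (e' := fun τ => Q.energyDeriv (Q.G τ (y τ)) (Q.vel (Q.G τ (y τ))))
        (fun τ hτ => by
          have h1 := (hy τ (hsub hτ)).mono hsub
          rw [field, trunc_of_norm_le hR0 (hb τ hτ), F] at h1
          exact Q.hasDerivWithinAt_energy h1 (hrel τ hτ) (hreal τ (hsub hτ)))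
        (fun τ hτ => Q.energyDeriv_le hRρ (hb τ hτ) (hrel τ hτ)) t ⟨ht.1, le_rfl⟩
      have h0 : (0 : ℝ) ∈ Icc 0 t := ⟨le_rfl, ht.1⟩
      have h2 := Q.energy_le hRρ (hb 0 h0)
      have h3 := Q.le_energy hRρ (hb t ⟨ht.1, le_rfl⟩)
      rw [hf0] at h2
      simp only [hf0] at hen
      -- The exponent is at most 1 up to time `T / ε`, and `e ≤ 3`. With the factor `4 / κ` from
      -- coercivity this is the `12 / κ` in `amp`.
      have hexp : Real.exp (Q.ε * R * Q.rate * t) ≤ 3 := by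
        have h4 : Q.ε * R * Q.rate * t ≤ 1 := by
          have h5 : Q.ε * t ≤ T := by
            have := (le_div_iff₀ hε).1 ht.2
            linarith
          calc Q.ε * R * Q.rate * t = R * Q.rate * (Q.ε * t) := by ring
            _ ≤ R * Q.rate * T := by have := Q.rate_nonneg; gcongr
            _ ≤ 1 := hRT
        refine (Real.exp_le_exp.2 h4).trans ?_
        linarith [Real.exp_one_lt_d9]
      have hK := Q.K_nonneg
      have hE0 : Q.energy f₀ * Real.exp (Q.ε * R * Q.rate * t)
          ≤ (K + κ / 4) * ‖f₀‖ ^ 2 * 3 := by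
        refine mul_le_mul h2 hexp (Real.exp_pos _).le (by positivity)
      have h6 : ‖Q.G t (y t)‖ ^ 2 ≤ 12 / κ * (K + κ / 4) * ‖f₀‖ ^ 2 := by
        have h7 : κ / 4 * ‖Q.G t (y t)‖ ^ 2 ≤ (K + κ / 4) * ‖f₀‖ ^ 2 * 3 := h3.trans (hen.trans hE0)
        have h8 := mul_le_mul_of_nonneg_left h7 (by positivity : 0 ≤ 4 / κ)
        calc ‖Q.G t (y t)‖ ^ 2 = 4 / κ * (κ / 4 * ‖Q.G t (y t)‖ ^ 2) := by field_simp
          _ ≤ _ := h8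
          _ = _ := by ring
      refine le_of_sq_le_sq ?_ (mul_nonneg (by linarith) (norm_nonneg _))
      rwa [mul_pow, amp, Real.sq_sqrt (by positivity)]
  have hboundR : ∀ t ∈ Icc 0 (T / Q.ε), ‖Q.G t (y t)‖ ≤ R := fun t ht =>
    (hbound t ht).trans hR.le
  have hrel : ∀ t ∈ Icc 0 (T / Q.ε), Q.Rel (Q.G t (y t)) (Q.vel (Q.G t (y t))) := fun t ht =>
    Q.rel_vel (hsm.mono Q (hboundR t ht))
  refine ⟨fun t => Q.G t (y t), fun t => Q.vel (Q.G t (y t)), ⟨hfcont, ?_, ?_, hrel⟩, hf0,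
    fun t ht => ⟨hbound t ht, hfreal t ht, ?_⟩⟩
  · have hlip : LipschitzOnWith (Real.toNNReal (4 * Q.Λ + 3)) Q.vel (Metric.closedBall 0 R) := by
      refine LipschitzOnWith.of_dist_le_mul fun f hf f' hf' => ?_
      rw [mem_closedBall_zero_iff] at hf hf'
      rw [dist_eq_norm, dist_eq_norm,
        Real.coe_toNNReal _ (by have := Q.Λ_nonneg; positivity)]
      exact Q.norm_sub_le_of_rel hsm hf hf' (Q.rel_vel (hsm.mono Q hf)) (Q.rel_vel (hsm.mono Q hf'))
    exact hlip.continuousOn.comp hfcont fun t ht => mem_closedBall_zero_iff.2 (hboundR t ht)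
  · intro t ht
    have h1 := hy t ht
    rw [field, trunc_of_norm_le hR0 (hboundR t ht), F] at h1
    have h2 : HasDerivWithinAt (fun τ => Q.emb (y τ)) _ (Icc 0 (T / Q.ε)) t :=
      Q.emb.hasFDerivAt.comp_hasDerivWithinAt t h1
    have h3 := Q.hasDerivWithinAt_G_apply 1 h2 rfl
    simp only [one_mul, one_smul, G_emb] at h3
    rwa [G_G_neg, add_comm, ← (hrel t ht).eq Q] at h3
  · rw [Q.reflOp_vel (hsm.mono Q (hboundR t ht)), hfreal t ht]

end Model

/-! ### The Fourier transform and test functions -/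

section Fourier

open ComplexConjugate

/-- The inverse Fourier transform of a real test function. -/
def testHat (φ : ℝ → ℝ) : ℝ → ℂ := 𝓕⁻ (fun x => (φ x : ℂ))

/-- A test function as a complex-valued Schwartz function. -/
def IsTest.schwartz {φ : ℝ → ℝ} (hφ : IsTest φ) : SchwartzMap ℝ ℂ :=
  HasCompactSupport.toSchwartzMap (f := fun x => (φ x : ℂ)) (hφ.2.comp_left Complex.ofReal_zero)
    (Complex.ofRealCLM.contDiff.comp hφ.1)

lemma IsTest.schwartz_apply {φ : ℝ → ℝ} (hφ : IsTest φ) (x : ℝ) : hφ.schwartz x = φ x := rfl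

lemma IsTest.coe_schwartz {φ : ℝ → ℝ} (hφ : IsTest φ) :
    (hφ.schwartz : ℝ → ℂ) = fun x => (φ x : ℂ) := rfl

lemma IsTest.coe_fourierInv_schwartz {φ : ℝ → ℝ} (hφ : IsTest φ) :
    ((𝓕⁻ hφ.schwartz : SchwartzMap ℝ ℂ) : ℝ → ℂ) = testHat φ := by
  rw [SchwartzMap.fourierInv_coe]; rfl

lemma IsTest.deriv {φ : ℝ → ℝ} (hφ : IsTest φ) : IsTest (deriv φ) :=
  ⟨(contDiff_infty_iff_deriv.1 hφ.1).2, hφ.2.deriv⟩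

lemma IsTest.integrable {φ : ℝ → ℝ} (hφ : IsTest φ) : Integrable φ :=
  hφ.1.continuous.integrable_of_hasCompactSupport hφ.2

lemma IsTest.integrable_ofReal {φ : ℝ → ℝ} (hφ : IsTest φ) :
    Integrable (fun x => (φ x : ℂ)) := hφ.integrable.ofReal

lemma IsTest.memLp {φ : ℝ → ℝ} (hφ : IsTest φ) (p : ℝ≥0∞) : MemLp φ p :=
  hφ.1.continuous.memLp_of_hasCompactSupport hφ.2

lemma IsTest.continuous_testHat {φ : ℝ → ℝ} (hφ : IsTest φ) : Continuous (testHat φ) := by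
  rw [← hφ.coe_fourierInv_schwartz]; exact SchwartzMap.continuous _

lemma IsTest.memLp_testHat {φ : ℝ → ℝ} (hφ : IsTest φ) (p : ℝ≥0∞) : MemLp (testHat φ) p := by
  rw [← hφ.coe_fourierInv_schwartz]; exact SchwartzMap.memLp _ p volume

lemma testHat_apply (φ : ℝ → ℝ) (ξ : ℝ) :
    testHat φ ξ = ∫ x : ℝ, Real.fourierChar (x * ξ) • (φ x : ℂ) := by
  rw [testHat, Real.fourierInv_eq]
  simp [mul_comm]

lemma testHat_deriv {φ : ℝ → ℝ} (hφ : IsTest φ) (ξ : ℝ) :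
    testHat (deriv φ) ξ = -(Complex.I * (2 * Real.pi * ξ : ℝ)) * testHat φ ξ := by
  have h := SchwartzMap.fourierInv_lineDerivOp_eq hφ.schwartz (1 : ℝ)
  have h1 : (LineDeriv.lineDerivOp (1 : ℝ) hφ.schwartz : SchwartzMap ℝ ℂ) = hφ.deriv.schwartz := by
    ext x
    rw [SchwartzMap.lineDerivOp_apply_eq_fderiv, hφ.deriv.schwartz_apply, hφ.coe_schwartz]
    have hd : HasDerivAt φ (_root_.deriv φ x) x :=
      ((hφ.1.differentiable (by simp)) x).hasDerivAt
    have := hd.ofReal_comp.hasFDerivAt.fderiv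
    rw [this]; simp
  rw [h1] at h
  have h2 := congrArg (fun g : SchwartzMap ℝ ℂ => g ξ) h
  simp only [hφ.deriv.coe_fourierInv_schwartz] at h2
  rw [h2]
  simp only [smul_apply]
  rw [SchwartzMap.smulLeftCLM_apply_apply (by fun_prop)]
  rw [hφ.coe_fourierInv_schwartz]
  simp
  ring

lemma testHat_deriv_deriv {φ : ℝ → ℝ} (hφ : IsTest φ) (ξ : ℝ) :
    testHat (deriv (deriv φ)) ξ = -((2 * Real.pi * ξ : ℝ) ^ 2 : ℝ) * testHat φ ξ := by
  rw [testHat_deriv hφ.deriv, testHat_deriv hφ]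
  push_cast
  linear_combination (2 * Real.pi * ξ : ℂ) ^ 2 * testHat φ ξ * Complex.I_sq

lemma IsTest.sub {φ ψ : ℝ → ℝ} (hφ : IsTest φ) (hψ : IsTest ψ) : IsTest (fun x => φ x - ψ x) :=
  ⟨hφ.1.sub hψ.1, hφ.2.sub hψ.2⟩

/-- Quadratic growth is absorbed by passing from `φ` to another test function, `φ - φ''`. -/
lemma jb_sq_mul_testHat {φ : ℝ → ℝ} (hφ : IsTest φ) (ξ : ℝ) :
    ((jb ξ ^ 2 : ℝ) : ℂ) * testHat φ ξ = testHat (fun x => φ x - deriv (deriv φ) x) ξ := by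
  have : testHat (fun x => φ x - deriv (deriv φ) x) ξ
      = testHat φ ξ - testHat (deriv (deriv φ)) ξ := by
    rw [testHat_apply, testHat_apply, testHat_apply, ← integral_sub]
    · simp [smul_sub]
    · exact (Real.fourierIntegral_convergent_iff (V := ℝ) (μ := volume) (-ξ)).2
        hφ.integrable_ofReal |>.congr (by simp [mul_comm])
    · exact (Real.fourierIntegral_convergent_iff (V := ℝ) (μ := volume) (-ξ)).2
        hφ.deriv.deriv.integrable_ofReal |>.congr (by simp [mul_comm])
  rw [this, testHat_deriv_deriv hφ, jb_sq]
  push_cast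
  ring

/-- Parseval's formula for the inverse transform of a test function. -/
lemma integral_mul_test (u : Lp ℂ 2 (volume : Measure ℝ)) {φ : ℝ → ℝ} (hφ : IsTest φ) :
    ∫ x, u x * (φ x : ℂ) = ∫ ξ, (𝓕 u : Lp ℂ 2 (volume : Measure ℝ)) ξ * testHat φ ξ := by
  have h := congrArg (fun D : TemperedDistribution ℝ ℂ => D (𝓕⁻ hφ.schwartz))
    (MeasureTheory.Lp.fourier_toTemperedDistribution_eq u)
  simp only [TemperedDistribution.fourier_apply, FourierTransform.fourier_fourierInv_eq,
    MeasureTheory.Lp.toTemperedDistribution_apply, smul_eq_mul] at h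
  rw [hφ.coe_fourierInv_schwartz] at h
  simpa [mul_comm, hφ.schwartz_apply] using h

lemma integral_fourierInv_mul {f g : ℝ → ℂ} (hf : Integrable f) (hg : Integrable g) :
    ∫ x, 𝓕⁻ f x * g x = ∫ ξ, f ξ * 𝓕⁻ g ξ := by
  have h := VectorFourier.integral_fourierIntegral_smul_eq_flip (L := -innerₗ ℝ)
    (μ := (volume : Measure ℝ)) (ν := (volume : Measure ℝ))
    Real.continuous_fourierChar (by simpa using! continuous_inner.neg) hf hg
  simpa [Real.fourierInv_eq, VectorFourier.fourierIntegral, mul_comm] using h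

lemma ae_eq_of_forall_test {f g : ℝ → ℂ} (hf : LocallyIntegrable f) (hg : LocallyIntegrable g)
    (h : ∀ φ, IsTest φ → ∫ x, f x * (φ x : ℂ) = ∫ x, g x * (φ x : ℂ)) : f =ᵐ[volume] g := by
  refine ae_eq_of_integral_contDiff_smul_eq hf hg fun φ h1 h2 => ?_
  simpa [mul_comm] using h φ ⟨h1, h2⟩

lemma L2.locallyIntegrable {E : Type*} [NormedAddCommGroup E] (u : Lp E 2 (volume : Measure ℝ)) :
    LocallyIntegrable u := (Lp.memLp u).locallyIntegrable (by norm_num)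

lemma continuous_fourierInv {f : ℝ → ℂ} (hf : Integrable f) : Continuous (𝓕⁻ f) := by
  have := VectorFourier.fourierIntegral_continuous (μ := (volume : Measure ℝ)) (L := -innerₗ ℝ)
    Real.continuous_fourierChar (by simpa using! continuous_inner.neg) hf
  convert! this using 1

/-- Fourier inversion for `L²` functions with integrable transform. -/
lemma ae_eq_fourierInv (u : Lp ℂ 2 (volume : Measure ℝ))
    (hu : Integrable (𝓕 u : Lp ℂ 2 (volume : Measure ℝ))) :
    u =ᵐ[volume] 𝓕⁻ ((𝓕 u : Lp ℂ 2 (volume : Measure ℝ)) : ℝ → ℂ) := by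
  refine ae_eq_of_forall_test (L2.locallyIntegrable u)
    (continuous_fourierInv hu).locallyIntegrable fun φ hφ => ?_
  rw [integral_mul_test u hφ, integral_fourierInv_mul hu hφ.integrable_ofReal]
  rfl

open scoped Convolution in
lemma fourierInv_convolution {f g : ℝ → ℂ} (hf : Integrable f) (hg : Integrable g) (x : ℝ) :
    𝓕⁻ (fun ξ => ∫ η, f (ξ - η) * g η) x = 𝓕⁻ f x * 𝓕⁻ g x := by
  have h := Real.fourier_mul_convolution_eq hf hg (-x)
  rw [Real.fourierInv_eq_fourier_neg, Real.fourierInv_eq_fourier_neg,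
    Real.fourierInv_eq_fourier_neg, ← h]
  refine congrArg (fun F : ℝ → ℂ => 𝓕 F (-x)) (funext fun ξ => ?_)
  rw [convolution_mul_swap]

lemma integrable_convolution_mul {f g : ℝ → ℂ} (hf : Integrable f) (hg : Integrable g) :
    Integrable (fun ξ => ∫ η, f (ξ - η) * g η) := by
  have := hf.integrable_convolution (ContinuousLinearMap.mul ℂ ℂ) hg
  refine this.congr (ae_of_all _ fun ξ => ?_)
  rw [convolution_mul_swap]

/-- The transform of a product is the convolution of the transforms. -/
lemma integral_mul_mul_test (u v : Lp ℂ 2 (volume : Measure ℝ))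
    (hu : Integrable (𝓕 u : Lp ℂ 2 (volume : Measure ℝ)))
    (hv : Integrable (𝓕 v : Lp ℂ 2 (volume : Measure ℝ))) {φ : ℝ → ℝ} (hφ : IsTest φ) :
    ∫ x, u x * v x * (φ x : ℂ)
      = ∫ ξ, (∫ η, (𝓕 u : Lp ℂ 2 (volume : Measure ℝ)) (ξ - η)
          * (𝓕 v : Lp ℂ 2 (volume : Measure ℝ)) η) * testHat φ ξ := by
  rw [testHat, ← integral_fourierInv_mul (integrable_convolution_mul hu hv) hφ.integrable_ofReal]
  refine integral_congr_ae ?_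
  filter_upwards [ae_eq_fourierInv u hu, ae_eq_fourierInv v hv] with x h1 h2
  rw [fourierInv_convolution hu hv, h1, h2]

lemma testHat_comp_sub (φ : ℝ → ℝ) (y ξ : ℝ) :
    testHat (fun x => φ (x - y)) ξ = Real.fourierChar (y * ξ) • testHat φ ξ := by
  rw [testHat_apply, testHat_apply, Circle.smul_def, ← integral_smul,
    ← integral_add_right_eq_self (fun x => Real.fourierChar (x * ξ) • ((φ (x - y) : ℝ) : ℂ)) y]
  refine integral_congr_ae (ae_of_all _ fun x => ?_)
  simp only [add_sub_cancel_right, ← Circle.smul_def, smul_smul]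
  rw [← AddChar.map_add_eq_mul]
  ring_nf

lemma testHat_comp_mul (φ : ℝ → ℝ) {m : ℝ} (hm : 0 < m) (ξ : ℝ) :
    testHat (fun x => φ (x * m)) ξ = (m⁻¹ : ℝ) • testHat φ (ξ / m) := by
  rw [testHat_apply, testHat_apply]
  have := MeasureTheory.Measure.integral_comp_mul_right
    (fun x => Real.fourierChar (x * (ξ / m)) • (φ x : ℂ)) m
  rw [abs_of_pos (inv_pos.2 hm)] at this
  rw [← this]
  refine integral_congr_ae (ae_of_all _ fun x => ?_)
  simp only
  congr 2
  field_simp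

lemma IsTest.comp_sub {φ : ℝ → ℝ} (hφ : IsTest φ) (y : ℝ) : IsTest (fun x => φ (x - y)) :=
  ⟨hφ.1.comp (contDiff_id.sub contDiff_const),
    hφ.2.comp_homeomorph (Homeomorph.subRight y)⟩

lemma IsTest.comp_mul {φ : ℝ → ℝ} (hφ : IsTest φ) {m : ℝ} (hm : 0 < m) :
    IsTest (fun x => φ (x * m)) :=
  ⟨hφ.1.comp (contDiff_id.mul contDiff_const),
    hφ.2.comp_homeomorph (Homeomorph.mulRight₀ m hm.ne')⟩

lemma exists_isTest_testHat_zero_ne : ∃ φ, IsTest φ ∧ testHat φ 0 ≠ 0 := by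
  let f : ContDiffBump (0 : ℝ) := ⟨1, 2, one_pos, one_lt_two⟩
  refine ⟨f, ⟨f.contDiff, f.hasCompactSupport⟩, ?_⟩
  have h : testHat f 0 = ((∫ x, f x : ℝ) : ℂ) := by
    rw [testHat_apply, ← integral_complex_ofReal]
    simp
  rw [h]
  exact_mod_cast (f.integral_pos (μ := volume)).ne'

lemma ae_eq_zero_of_fourierInv_eq_zero {F : ℝ → ℂ} (hF : Integrable F) (h : ∀ y, 𝓕⁻ F y = 0) :
    F =ᵐ[volume] 0 := by
  refine ae_eq_of_forall_test hF.locallyIntegrable (locallyIntegrable_zero) fun χ hχ => ?_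
  have h1 := integral_fourierInv_mul hF (𝓕 hχ.schwartz : SchwartzMap ℝ ℂ).integrable
  rw [← SchwartzMap.fourierInv_coe, FourierTransform.fourierInv_fourier_eq] at h1
  simp only [h, zero_mul, integral_zero, hχ.schwartz_apply] at h1
  simp [← h1]

/-- A function of at most quadratic growth (in the mean) which annihilates the inverse transforms of
all real test functions vanishes. -/
lemma ae_eq_zero_of_forall_testHat {r : ℝ → ℂ} (hr : MemLp (fun ξ => ((jb ξ ^ 2)⁻¹ : ℝ) * r ξ) 2)
    (h : ∀ φ, IsTest φ → ∫ ξ, r ξ * testHat φ ξ = 0) : r =ᵐ[volume] 0 := by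
  have hr_int : ∀ φ, IsTest φ → Integrable (fun ξ => r ξ * testHat φ ξ) := by
    intro φ hφ
    have h2 := MemLp.integrable_mul hr ((hφ.sub hφ.deriv.deriv).memLp_testHat 2)
    refine h2.congr (ae_of_all _ fun ξ => ?_)
    simp only [Pi.mul_apply]
    rw [← jb_sq_mul_testHat hφ]
    have : ((jb ξ : ℝ) : ℂ) ≠ 0 := by exact_mod_cast (jb_pos ξ).ne'
    push_cast
    field_simp
  -- Translating `φ` multiplies `testHat φ` by characters, so the hypothesis says that the
  -- integrable function `r · testHat φ` has vanishing inverse transform.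
  have hz : ∀ φ, IsTest φ → (fun ξ => r ξ * testHat φ ξ) =ᵐ[volume] 0 := by
    intro φ hφ
    refine ae_eq_zero_of_fourierInv_eq_zero (hr_int φ hφ) fun y => ?_
    rw [Real.fourierInv_eq, ← h _ (hφ.comp_sub y)]
    refine integral_congr_ae (ae_of_all _ fun ξ => ?_)
    simp only [testHat_comp_sub]
    simp [Circle.smul_def]
    ring
  obtain ⟨φ, hφ, hφ0⟩ := exists_isTest_testHat_zero_ne
  -- `testHat φ` may have zeros. At a given frequency a sufficiently wide dilation avoids them,
  -- since `testHat φ (ξ / (n + 1))` tends to `testHat φ 0 ≠ 0`.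
  have hall : ∀ᵐ ξ, ∀ n : ℕ, r ξ * testHat (fun x => φ (x * (n + 1 : ℝ))) ξ = 0 :=
    ae_all_iff.2 fun n => hz _ (hφ.comp_mul (by positivity))
  filter_upwards [hall] with ξ hξ
  have hlim : Tendsto (fun n : ℕ => testHat φ (ξ / ((n : ℝ) + 1))) atTop (𝓝 (testHat φ 0)) := by
    refine (hφ.continuous_testHat.tendsto 0).comp ?_
    refine Tendsto.const_div_atTop ?_ _
    exact tendsto_atTop_add_const_right _ _ tendsto_natCast_atTop_atTop
  obtain ⟨n, hn⟩ := (hlim.eventually_ne hφ0).exists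
  have := hξ n
  rw [testHat_comp_mul φ (by positivity : (0 : ℝ) < n + 1)] at this
  rcases mul_eq_zero.1 this with h | h
  · exact h
  · rcases smul_eq_zero.1 h with h | h
    · exact absurd h (by positivity)
    · exact absurd h hn

/-! ### Real-valued functions -/

lemma ofReal_compLp_ae (u : Lp ℝ 2 (volume : Measure ℝ)) :
    (Complex.ofRealCLM.compLp u : ℝ → ℂ) =ᵐ[volume] fun x => (u x : ℂ) :=
  Complex.ofRealCLM.coeFn_compLp u

lemma integral_mul_test_real (u : Lp ℝ 2 (volume : Measure ℝ)) {φ : ℝ → ℝ} (hφ : IsTest φ) :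
    ((∫ x, u x * φ x : ℝ) : ℂ) = ∫ ξ, fourierL2 u ξ * testHat φ ξ := by
  rw [fourierL2, ← integral_mul_test _ hφ, ← integral_complex_ofReal]
  refine integral_congr_ae ?_
  filter_upwards [ofReal_compLp_ae u] with x hx
  rw [hx]; simp

lemma integral_mul_mul_test_real (u v : Lp ℝ 2 (volume : Measure ℝ))
    (hu : Integrable (fourierL2 u)) (hv : Integrable (fourierL2 v)) {φ : ℝ → ℝ} (hφ : IsTest φ) :
    ((∫ x, u x * v x * φ x : ℝ) : ℂ)
      = ∫ ξ, (∫ η, fourierL2 u (ξ - η) * fourierL2 v η) * testHat φ ξ := by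
  rw [fourierL2, fourierL2, ← integral_mul_mul_test _ _ hu hv hφ, ← integral_complex_ofReal]
  refine integral_congr_ae ?_
  filter_upwards [ofReal_compLp_ae u, ofReal_compLp_ae v] with x hx hy
  rw [hx, hy]; simp

/-- `fourierL2` as a continuous linear map. -/
def fourierL2CLM : Lp ℝ 2 (volume : Measure ℝ) →L[ℝ] Lp ℂ 2 (volume : Measure ℝ) :=
  ((FourierTransform.fourierCLM ℂ (Lp ℂ 2 (volume : Measure ℝ))).restrictScalars ℝ).comp
    (Complex.ofRealCLM.compLpL 2 volume)

lemma fourierL2CLM_apply (u : Lp ℝ 2 (volume : Measure ℝ)) : fourierL2CLM u = fourierL2 u := rfl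

lemma norm_fourierL2 (u : Lp ℝ 2 (volume : Measure ℝ)) : ‖fourierL2 u‖ = ‖u‖ := by
  rw [fourierL2, MeasureTheory.Lp.norm_fourier_eq]
  refine le_antisymm (Lp.norm_le_norm_of_ae_le ?_) (Lp.norm_le_norm_of_ae_le ?_) <;>
  · filter_upwards [ofReal_compLp_ae u] with x hx
    rw [hx]; simp

lemma fourierL2_injective : Function.Injective fourierL2 := by
  intro u v h
  have h1 : fourierL2CLM (u - v) = 0 := by
    rw [map_sub, fourierL2CLM_apply, fourierL2CLM_apply, h, sub_self]
  have h2 := norm_fourierL2 (u - v)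
  rw [← fourierL2CLM_apply, h1, norm_zero] at h2
  exact sub_eq_zero.1 (norm_eq_zero.1 h2.symm)

lemma fourier_comp_neg_conj (φ : ℝ → ℝ) (x : ℝ) :
    𝓕 (fun ξ => ((φ (-ξ) : ℝ) : ℂ)) x = conj (𝓕 (fun ξ => (φ ξ : ℂ)) x) := by
  rw [Real.fourier_eq, Real.fourier_eq, ← integral_conj,
    ← integral_neg_eq_self (fun v : ℝ => Real.fourierChar (-inner ℝ v x) • ((φ (-v) : ℝ) : ℂ))]
  refine integral_congr_ae (ae_of_all _ fun ξ => ?_)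
  simp [Circle.smul_def, ← Circle.coe_inv_eq_conj, AddChar.map_neg_eq_inv]

lemma IsTest.comp_neg {φ : ℝ → ℝ} (hφ : IsTest φ) : IsTest (fun x => φ (-x)) :=
  ⟨hφ.1.comp contDiff_neg, hφ.2.comp_homeomorph (Homeomorph.neg ℝ)⟩

lemma integral_fourier_mul_test (u : Lp ℂ 2 (volume : Measure ℝ)) {φ : ℝ → ℝ} (hφ : IsTest φ) :
    ∫ ξ, (𝓕 u : Lp ℂ 2 (volume : Measure ℝ)) ξ * (φ ξ : ℂ)
      = ∫ x, u x * 𝓕 (fun ξ => (φ ξ : ℂ)) x := by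
  have h := congrArg (fun D : TemperedDistribution ℝ ℂ => D hφ.schwartz)
    (MeasureTheory.Lp.fourier_toTemperedDistribution_eq u)
  simp only [TemperedDistribution.fourier_apply,
    MeasureTheory.Lp.toTemperedDistribution_apply, smul_eq_mul] at h
  rw [SchwartzMap.fourier_coe] at h
  simpa [mul_comm, hφ.schwartz_apply, hφ.coe_schwartz] using h.symm

/-- The transform of a real-valued function is Hermitian. -/
lemma fourierL2_neg (u : Lp ℝ 2 (volume : Measure ℝ)) :
    ∀ᵐ ξ, fourierL2 u (-ξ) = conj (fourierL2 u ξ) := by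
  have hneg : MemLp (fun ξ => fourierL2 u (-ξ)) 2 :=
    (Lp.memLp (fourierL2 u)).comp_measurePreserving (Measure.measurePreserving_neg volume)
  refine ae_eq_of_forall_test (f := fun ξ => fourierL2 u (-ξ))
    (g := fun ξ => conj (fourierL2 u ξ)) (hneg.locallyIntegrable (by norm_num))
    ((Lp.memLp (fourierL2 u)).star.locallyIntegrable (by norm_num)) fun φ hφ => ?_
  have h1 : ∫ ξ, fourierL2 u (-ξ) * (φ ξ : ℂ) = ∫ ξ, fourierL2 u ξ * ((φ (-ξ) : ℝ) : ℂ) := by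
    rw [← integral_neg_eq_self (fun ξ => fourierL2 u ξ * ((φ (-ξ) : ℝ) : ℂ))]
    simp
  have h2 : ∫ ξ, conj (fourierL2 u ξ) * (φ ξ : ℂ) = conj (∫ ξ, fourierL2 u ξ * (φ ξ : ℂ)) := by
    rw [← integral_conj]; simp
  rw [h1, h2, fourierL2, integral_fourier_mul_test _ hφ, integral_fourier_mul_test _ hφ.comp_neg,
    ← integral_conj]
  refine integral_congr_ae ?_
  filter_upwards [ofReal_compLp_ae u] with x hx
  rw [hx, fourier_comp_neg_conj]; simp

/-- A Hermitian `L²` function is the transform of a real-valued one. -/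
lemma exists_fourierL2_eq (g : Lp ℂ 2 (volume : Measure ℝ)) (hg : ∀ᵐ ξ, g (-ξ) = conj (g ξ)) :
    ∃ u, fourierL2 u = g := by
  set w : Lp ℂ 2 (volume : Measure ℝ) := 𝓕⁻ g
  set u := Complex.reCLM.compLp w
  set v := Complex.imCLM.compLp w
  have hw : w = Complex.ofRealCLM.compLp u + Complex.I • Complex.ofRealCLM.compLp v := by
    refine Lp.ext ?_
    filter_upwards [ofReal_compLp_ae u, ofReal_compLp_ae v, Complex.reCLM.coeFn_compLp w,
      Complex.imCLM.coeFn_compLp w, Lp.coeFn_add (Complex.ofRealCLM.compLp u)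
        (Complex.I • Complex.ofRealCLM.compLp v),
      Lp.coeFn_smul Complex.I (Complex.ofRealCLM.compLp v)] with x h1 h2 h3 h4 h5 h6
    rw [h5, Pi.add_apply, h6, Pi.smul_apply, h1, h2, h3, h4]
    simp [mul_comm Complex.I, Complex.re_add_im]
  have hgw : g = fourierL2 u + Complex.I • fourierL2 v := by
    have : g = 𝓕 w := (FourierTransform.fourier_fourierInv_eq g).symm
    rw [this, hw, FourierTransform.fourier_add, FourierTransform.fourier_smul]; rfl
  refine ⟨u, ?_⟩
  -- All three transforms `ĝ = û + i v̂`, `û`, `v̂` are Hermitian here; comparing the values at `ξ`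
  -- and `-ξ` gives `2i` times the conjugate of `v̂` equal to 0.
  have hv : fourierL2 v = 0 := by
    have hadd : ∀ᵐ ξ, g ξ = fourierL2 u ξ + Complex.I * fourierL2 v ξ := by
      filter_upwards [Lp.coeFn_add (fourierL2 u) (Complex.I • fourierL2 v),
        Lp.coeFn_smul Complex.I (fourierL2 v)] with x h5 h6
      rw [hgw, h5, Pi.add_apply, h6, Pi.smul_apply, smul_eq_mul]
    rw [Lp.eq_zero_iff_ae_eq_zero]
    filter_upwards [hg, hadd, ae_neg hadd, fourierL2_neg u, fourierL2_neg v] with ξ h1 h2 h3 h4 h5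
    rw [h3, h2, h4, h5, map_add, map_mul, Complex.conj_I] at h1
    have h6 : conj (fourierL2 v ξ) = 0 := by
      have : (2 * Complex.I) * conj (fourierL2 v ξ) = 0 := by linear_combination h1
      simpa using this
    simpa using h6
  rw [hgw, hv, smul_zero, add_zero]

end Fourier

/-! ### Real matrices acting on `ℂ⁴` -/

section Operators

open ComplexConjugate

/-- `ℂ⁴`, regarded as a real Hilbert space. -/
abbrev V4 : Type := PiLp 2 (fun _ : Fin 4 => ℂ)

/-- Multiplication by `i`. -/
def mulI : V4 →L[ℝ] V4 := LinearMap.toContinuousLinearMap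
  { toFun := fun x => WithLp.toLp 2 fun i => Complex.I * x i
    map_add' := fun x y => by ext i; simp [mul_add]
    map_smul' := fun r x => by ext i; simp [mul_left_comm] }

/-- Complex conjugation. -/
def conjOp : V4 →L[ℝ] V4 := LinearMap.toContinuousLinearMap
  { toFun := fun x => WithLp.toLp 2 fun i => conj (x i)
    map_add' := fun x y => by ext i; simp
    map_smul' := fun r x => by ext i; simp }

/-- The action of a real matrix on `ℂ⁴`, depending linearly on the matrix. -/
def matOp : Matrix (Fin 4) (Fin 4) ℝ →ₗ[ℝ] V4 →L[ℝ] V4 where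
  toFun A := LinearMap.toContinuousLinearMap
    { toFun := fun x => WithLp.toLp 2 fun i => ∑ j, (A i j : ℂ) * x j
      map_add' := fun x y => by ext i; simp [mul_add, Finset.sum_add_distrib]
      map_smul' := fun r x => by ext i; simp [mul_left_comm, Finset.mul_sum] }
  map_add' A B := by
    ext x i
    simp [add_mul, Finset.sum_add_distrib]
  map_smul' r A := by
    ext x i
    simp [mul_assoc, Finset.mul_sum]

@[simp] lemma mulI_apply (x : V4) (i : Fin 4) : mulI x i = Complex.I * x i := rfl
@[simp] lemma conjOp_apply (x : V4) (i : Fin 4) : conjOp x i = conj (x i) := rfl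
@[simp] lemma matOp_apply (A : Matrix (Fin 4) (Fin 4) ℝ) (x : V4) (i : Fin 4) :
    matOp A x i = ∑ j, (A i j : ℂ) * x j := rfl

/-- The complex bilinear operator `(u, x) ↦ ∑ₖ uₖ Tₖ x`, depending linearly on the matrices
`Tₖ`. -/
def bilMatOp : (Fin 4 → Matrix (Fin 4) (Fin 4) ℝ) →ₗ[ℝ] V4 →L[ℝ] V4 →L[ℝ] V4 where
  toFun T := LinearMap.toContinuousLinearMap
    { toFun := fun u => LinearMap.toContinuousLinearMap
        { toFun := fun x => WithLp.toLp 2 fun i => ∑ k, ∑ j, (T k i j : ℂ) * (u k * x j)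
          map_add' := fun x y => by ext i; simp [mul_add, Finset.sum_add_distrib]
          map_smul' := fun r x => by ext i; simp [mul_left_comm, Finset.mul_sum] }
      map_add' := fun u v => by
        ext x i; simp [add_mul, mul_add, Finset.sum_add_distrib]
      map_smul' := fun r u => by
        ext x i; simp [mul_left_comm, mul_assoc, Finset.mul_sum] }
  map_add' A B := by
    ext u x i
    simp [add_mul, Finset.sum_add_distrib]
  map_smul' r A := by
    ext u x i
    simp [mul_assoc, Finset.mul_sum]

@[simp] lemma bilMatOp_apply (T : Fin 4 → Matrix (Fin 4) (Fin 4) ℝ) (u x : V4) (i : Fin 4) :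
    bilMatOp T u x i = ∑ k, ∑ j, (T k i j : ℂ) * (u k * x j) := rfl

lemma inner_V4 (x y : V4) : ⟪x, y⟫ = ∑ i, (conj (x i) * y i).re := by
  rw [PiLp.inner_apply]; simp [Complex.inner, mul_comm]

lemma inner_mulI (x y : V4) : ⟪mulI x, y⟫ = -⟪x, mulI y⟫ := by
  rw [inner_V4, inner_V4, ← Finset.sum_neg_distrib]
  refine Finset.sum_congr rfl fun i _ => ?_
  simp; ring

lemma norm_mulI (x : V4) : ‖mulI x‖ ≤ ‖x‖ := by
  rw [PiLp.norm_eq_of_L2, PiLp.norm_eq_of_L2]; simp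

lemma conjOp_conjOp (x : V4) : conjOp (conjOp x) = x := by ext i; simp

lemma norm_conjOp (x : V4) : ‖conjOp x‖ = ‖x‖ := by
  rw [PiLp.norm_eq_of_L2, PiLp.norm_eq_of_L2]; simp

lemma conjOp_mulI (x : V4) : conjOp (mulI x) = -mulI (conjOp x) := by ext i; simp

lemma inner_matOp {A : Matrix (Fin 4) (Fin 4) ℝ} (hA : A.IsSymm) (x y : V4) :
    ⟪matOp A x, y⟫ = ⟪x, matOp A y⟫ := by
  rw [inner_V4, inner_V4]
  simp only [matOp_apply, map_sum, map_mul, Complex.conj_ofReal, Finset.sum_mul, Finset.mul_sum,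
    Complex.re_sum]
  rw [Finset.sum_comm]
  refine Finset.sum_congr rfl fun j _ => Finset.sum_congr rfl fun i _ => ?_
  rw [← hA.apply i j]
  ring_nf

lemma isLinCoeff_matOp {A : Matrix (Fin 4) (Fin 4) ℝ} (hA : A.IsSymm) {K : ℝ}
    (hK : ‖matOp A‖ ≤ K) : IsLinCoeff mulI conjOp K (matOp A) where
  symm := inner_matOp hA
  comm_I x := by ext i; simp [Finset.mul_sum, mul_left_comm]
  comm_c x := by ext i; simp
  bound := hK

lemma isQuadCoeff_bilMatOp {T : Fin 4 → Matrix (Fin 4) (Fin 4) ℝ} (hT : ∀ k, (T k).IsSymm) {K : ℝ}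
    (hK : ‖bilMatOp T‖ ≤ K) : IsQuadCoeff mulI conjOp K (bilMatOp T) where
  symm u x y := by
    rw [inner_V4, inner_V4]
    simp only [bilMatOp_apply, map_sum, map_mul, Complex.conj_ofReal, Finset.sum_mul,
      Finset.mul_sum, Complex.re_sum, conjOp_apply]
    rw [Finset.sum_comm]
    conv_rhs => rw [Finset.sum_comm]
    refine Finset.sum_congr rfl fun k _ => ?_
    rw [Finset.sum_comm]
    refine Finset.sum_congr rfl fun j _ => Finset.sum_congr rfl fun i _ => ?_
    rw [← (hT k).apply i j]
    ring_nf
  I_left u x := by ext i; simp [Finset.mul_sum, mul_left_comm, mul_assoc]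
  I_right u x := by ext i; simp [Finset.mul_sum, mul_left_comm]
  comm_c u x := by ext i; simp
  bound := hK

lemma continuous_matOp : Continuous matOp := matOp.continuous_of_finiteDimensional

lemma continuous_bilMatOp : Continuous bilMatOp :=
  LinearMap.continuous_of_finiteDimensional (E := Fin 4 → Matrix (Fin 4) (Fin 4) ℝ)
    (F' := V4 →L[ℝ] V4 →L[ℝ] V4) bilMatOp

/-- A real symmetric matrix acts separately on real and imaginary parts, and at least one of them is
nonzero. -/
lemma inner_matOp_self_pos {A : Matrix (Fin 4) (Fin 4) ℝ} (hA : A.PosDef) {x : V4} (hx : x ≠ 0) :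
    0 < ⟪matOp A x, x⟫ := by
  set a : Fin 4 → ℝ := fun i => (x i).re
  set b : Fin 4 → ℝ := fun i => (x i).im
  have h : ⟪matOp A x, x⟫ = a ⬝ᵥ (A *ᵥ a) + b ⬝ᵥ (A *ᵥ b) := by
    rw [inner_V4]
    simp only [matOp_apply, map_sum, map_mul, Complex.conj_ofReal, Finset.sum_mul,
      Complex.re_sum, dotProduct, Matrix.mulVec, Finset.mul_sum, ← Finset.sum_add_distrib]
    refine Finset.sum_congr rfl fun j _ => Finset.sum_congr rfl fun i _ => ?_
    simp [a, b]; ring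
  rw [h]
  have hnn : ∀ v : Fin 4 → ℝ, 0 ≤ v ⬝ᵥ (A *ᵥ v) := fun v => by
    simpa using hA.posSemidef.dotProduct_mulVec_nonneg v
  by_cases ha : a = 0
  · have hb : b ≠ 0 := by
      rintro hb
      refine hx ?_
      ext i
      exact Complex.ext (congrFun ha i) (congrFun hb i)
    have := hA.dotProduct_mulVec_pos hb
    simp only [star_trivial] at this
    linarith [hnn a]
  · have := hA.dotProduct_mulVec_pos ha
    simp only [star_trivial] at this
    linarith [hnn b]

/-- Uniform coercivity of a continuous family of positive definite matrices. -/
lemma exists_coercive {X : Type*} [TopologicalSpace X] {S : Set X} (hS : IsCompact S)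
    {A : X → Matrix (Fin 4) (Fin 4) ℝ} (hA : ContinuousOn A S) (hpos : ∀ p ∈ S, (A p).PosDef) :
    ∃ κ > 0, ∀ p ∈ S, ∀ x : V4, κ * ‖x‖ ^ 2 ≤ ⟪matOp (A p) x, x⟫ := by
  rcases S.eq_empty_or_nonempty with rfl | hne
  · exact ⟨1, one_pos, by simp⟩
  have hcomp : IsCompact (S ×ˢ Metric.sphere (0 : V4) 1) := hS.prod (isCompact_sphere _ _)
  have hcont : ContinuousOn (fun z : X × V4 => ⟪matOp (A z.1) z.2, z.2⟫)
      (S ×ˢ Metric.sphere (0 : V4) 1) := by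
    have h1 : ContinuousOn (fun z : X × V4 => matOp (A z.1)) (S ×ˢ Metric.sphere (0 : V4) 1) :=
      continuous_matOp.comp_continuousOn (hA.comp continuousOn_fst fun z hz => hz.1)
    exact (h1.clm_apply continuousOn_snd).inner continuousOn_snd
  have hne' : (S ×ˢ Metric.sphere (0 : V4) 1).Nonempty :=
    hne.prod (NormedSpace.sphere_nonempty.2 zero_le_one)
  -- The form attains a positive minimum over parameters and unit vectors; homogeneity extends the
  -- bound to all vectors.
  obtain ⟨z, hz, hmin⟩ := hcomp.exists_isMinOn hne' hcont
  have hz2 : ‖z.2‖ = 1 := by simpa using hz.2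
  refine ⟨_, inner_matOp_self_pos (hpos z.1 hz.1) (x := z.2) (by
    intro h; rw [h, norm_zero] at hz2; exact zero_ne_one hz2), fun p hp x => ?_⟩
  by_cases hx : x = 0
  · simp [hx]
  have hx' : 0 < ‖x‖ := norm_pos_iff.2 hx
  have hmem : (p, ‖x‖⁻¹ • x) ∈ S ×ˢ Metric.sphere (0 : V4) 1 :=
    ⟨hp, by simp [norm_smul, hx'.ne']⟩
  have h := hmin hmem
  simp only [mem_ofPred_eq, map_smul, inner_smul_left, inner_smul_right, conj_trivial] at h
  calc _ ≤ (‖x‖⁻¹ * (‖x‖⁻¹ * ⟪matOp (A p) x, x⟫)) * ‖x‖ ^ 2 := by gcongr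
    _ = _ := by field_simp

end Operators

/-! ### The coefficients of the system -/

section Coefficients

lemma isSymm_S0 (γ δ : ℝ) : (S0 γ δ).IsSymm := by
  ext i j; fin_cases i <;> fin_cases j <;> simp [S0]

lemma posDef_S0 {γ δ : ℝ} (hγ : 0 < γ) (hγ1 : γ < 1) (hδ : 0 < δ) : (S0 γ δ).PosDef := by
  refine Matrix.PosDef.of_dotProduct_mulVec_pos ?_ fun x hx => ?_
  · rw [Matrix.IsHermitian, Matrix.conjTranspose_eq_transpose_of_trivial]; exact isSymm_S0 γ δ
  -- Completing the square in the first two unknowns shows that `γ < 1` is what positivity requires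
  -- of the upper block.
  · have h : star x ⬝ᵥ (S0 γ δ *ᵥ x)
        = γ * (x 0 + x 1) ^ 2 + (1 - γ) * x 1 ^ 2 + γ * x 2 ^ 2 + 1 / δ * x 3 ^ 2 := by
      simp [S0, dotProduct, Matrix.mulVec, Fin.sum_univ_four]
      ring
    rw [h]
    have h1 : 0 < 1 - γ := by linarith
    by_contra hle
    have p1 : 0 ≤ γ * (x 0 + x 1) ^ 2 := by positivity
    have p2 : 0 ≤ (1 - γ) * x 1 ^ 2 := by positivity
    have p3 : 0 ≤ γ * x 2 ^ 2 := by positivity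
    have p4 : 0 ≤ 1 / δ * x 3 ^ 2 := by positivity
    have q1 : γ * (x 0 + x 1) ^ 2 = 0 := by linarith
    have q2 : (1 - γ) * x 1 ^ 2 = 0 := by linarith
    have q3 : γ * x 2 ^ 2 = 0 := by linarith
    have q4 : 1 / δ * x 3 ^ 2 = 0 := by linarith
    have r1 : x 0 + x 1 = 0 := by simpa [hγ.ne'] using q1
    have r2 : x 1 = 0 := by simpa [h1.ne'] using q2
    have r3 : x 2 = 0 := by simpa [hγ.ne'] using q3
    have r4 : x 3 = 0 := by simpa [hδ.ne'] using q4
    refine hx ?_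
    ext i
    fin_cases i
    · simpa [r2] using r1
    · exact r2
    · exact r3
    · exact r4

lemma isSymm_Sig0 (γ δ : ℝ) : (Sig0 γ δ).IsSymm := by
  ext i j
  fin_cases i <;> fin_cases j <;> simp [Sig0, S0, A0, Matrix.mul_apply, Fin.sum_univ_four]
  all_goals try ring

/-- Here the precise entries of `S2tilde` matter. The summand `K S₀` only contributes `K Σ₀`, which
is symmetric. The symmetry of `S2`, by contrast, comes with its positive definiteness. -/
lemma isSymm_Sig2 (p : Params) {γ δ : ℝ} (hδ : δ ≠ 0) : (Sig2 p γ δ).IsSymm := by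
  ext i j
  fin_cases i <;> fin_cases j <;>
    simp [Sig2, S0, A0, A1, S2tilde]
  all_goals
    simp only [aCoef, bCoef, Params.β₁, Params.α₁, Params.α₂, Params.β₂]
    field_simp
    ring

lemma isSymm_S1 (γ : ℝ) (u : Fin 4 → ℝ) : (S1 γ u).IsSymm := by
  ext i j; fin_cases i <;> fin_cases j <;> simp [S1]

/-- The part `S₁(U) 𝒜₀` compensates the asymmetry of `S₀ 𝒜(U)`. -/
lemma isSymm_Sig1 (γ δ : ℝ) (u : Fin 4 → ℝ) : (Sig1 γ δ u).IsSymm := by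
  ext i j
  fin_cases i <;> fin_cases j <;>
    simp [Sig1, S0, A0, S1, A]
  all_goals try ring

/-- The matrices `S₁(eₖ)`. -/
def S1basis (γ : ℝ) (k : Fin 4) : Matrix (Fin 4) (Fin 4) ℝ := S1 γ (Pi.single k 1)

/-- The matrices `Σ₁(eₖ)`. -/
def Sig1basis (γ δ : ℝ) (k : Fin 4) : Matrix (Fin 4) (Fin 4) ℝ := Sig1 γ δ (Pi.single k 1)

lemma S1_eq_sum (γ : ℝ) (u : Fin 4 → ℝ) : S1 γ u = ∑ k, u k • S1basis γ k := by
  ext i j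
  simp only [Fin.sum_univ_four, S1basis]
  fin_cases i <;> fin_cases j <;> simp [S1, mul_comm]

lemma A_eq_sum (u : Fin 4 → ℝ) : A u = ∑ k, u k • A (Pi.single k 1) := by
  ext i j
  simp only [Fin.sum_univ_four]
  fin_cases i <;> fin_cases j <;> simp [A]

lemma Sig1_eq_sum (γ δ : ℝ) (u : Fin 4 → ℝ) : Sig1 γ δ u = ∑ k, u k • Sig1basis γ δ k := by
  simp only [Sig1basis, Sig1, smul_add, Finset.sum_add_distrib]
  conv_lhs => rw [S1_eq_sum, A_eq_sum, Finset.sum_mul, Finset.mul_sum]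
  simp [S1basis]

section Continuity

variable {S : Set (ℝ × ℝ)}

lemma continuousOn_matrix {X : Type*} [TopologicalSpace X] {S : Set X}
    {A : X → Matrix (Fin 4) (Fin 4) ℝ} (h : ∀ i j, ContinuousOn (fun z => A z i j) S) :
    ContinuousOn A S :=
  continuousOn_pi.2 fun i => continuousOn_pi.2 fun j => h i j

lemma continuousOn_S0 (hS : ∀ z ∈ S, z.2 ≠ 0) : ContinuousOn (fun z : ℝ × ℝ => S0 z.1 z.2) S := by
  refine continuousOn_matrix fun i j => ?_
  fin_cases i <;> fin_cases j <;> simp [S0] <;> fun_prop (disch := assumption)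

lemma continuousOn_A0 (hS : ∀ z ∈ S, z.2 ≠ 0) : ContinuousOn (fun z : ℝ × ℝ => A0 z.1 z.2) S := by
  refine continuousOn_matrix fun i j => ?_
  fin_cases i <;> fin_cases j <;> simp [A0] <;> fun_prop (disch := assumption)

lemma continuousOn_α₁ (hS : ∀ z ∈ S, z.2 ≠ 0) (p : Params) : ContinuousOn (fun z : ℝ × ℝ => p.α₁ z.2) S := by
  unfold Params.α₁
  exact (continuousOn_const.div (by fun_prop) fun z hz => mul_ne_zero two_ne_zero (hS z hz)).sub
    continuousOn_const

lemma continuousOn_α₂ (hS : ∀ z ∈ S, z.2 ≠ 0) (p : Params) : ContinuousOn (fun z : ℝ × ℝ => p.α₂ z.2) S := by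
  unfold Params.α₂
  exact (continuousOn_const.div (by fun_prop) fun z hz =>
    mul_ne_zero three_ne_zero (pow_ne_zero 2 (hS z hz))).sub continuousOn_const

lemma continuousOn_β₂ (hS : ∀ z ∈ S, z.2 ≠ 0) (p : Params) : ContinuousOn (fun z : ℝ × ℝ => p.β₂ z.1 z.2) S := by
  unfold Params.β₂
  exact continuousOn_const.add (continuousOn_fst.div continuousOn_snd hS)

lemma continuousOn_A1 (hS : ∀ z ∈ S, z.2 ≠ 0) (p : Params) : ContinuousOn (fun z : ℝ × ℝ => A1 p z.1 z.2) S := by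
  have h1 := continuousOn_α₁ hS p
  have h2 := continuousOn_α₂ hS p
  have h3 := continuousOn_β₂ hS p
  refine continuousOn_matrix fun i j => ?_
  fin_cases i <;> fin_cases j <;> simp [A1] <;> fun_prop (disch := assumption)

lemma continuousOn_A2 (hS : ∀ z ∈ S, z.2 ≠ 0) (p : Params) : ContinuousOn (fun z : ℝ × ℝ => A2 p z.1 z.2) S := by
  have h1 := continuousOn_α₁ hS p
  have h2 := continuousOn_α₂ hS p
  have h3 := continuousOn_β₂ hS p
  refine continuousOn_matrix fun i j => ?_
  fin_cases i <;> fin_cases j <;> simp [A2] <;> fun_prop (disch := assumption)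

lemma continuousOn_S2tilde (hS : ∀ z ∈ S, z.2 ≠ 0) (p : Params) : ContinuousOn (fun z : ℝ × ℝ => S2tilde p z.1 z.2) S := by
  have h1 := continuousOn_α₁ hS p
  have h2 := continuousOn_α₂ hS p
  have h3 := continuousOn_β₂ hS p
  have h4 : ContinuousOn (fun z : ℝ × ℝ => aCoef p z.1 z.2) S := by unfold aCoef; fun_prop
  have h5 : ContinuousOn (fun z : ℝ × ℝ => bCoef p z.1 z.2) S := by unfold bCoef; fun_prop
  have h6 : ContinuousOn (fun z : ℝ × ℝ => p.l₃ / (2 * z.2)) S :=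
    continuousOn_const.div (by fun_prop) fun z hz => mul_ne_zero two_ne_zero (hS z hz)
  refine ContinuousOn.add (continuousOn_matrix fun i j => ?_) ((continuousOn_S0 hS).const_smul p.K)
  fin_cases i <;> fin_cases j <;> simp <;> fun_prop (disch := assumption)

lemma continuousOn_S2 (hS : ∀ z ∈ S, z.2 ≠ 0) (p : Params) : ContinuousOn (fun z : ℝ × ℝ => S2 p z.1 z.2) S :=
  ((continuousOn_S0 hS).mul (continuousOn_A2 hS p)).add (continuousOn_S2tilde hS p)

lemma continuousOn_Sig0 (hS : ∀ z ∈ S, z.2 ≠ 0) : ContinuousOn (fun z : ℝ × ℝ => Sig0 z.1 z.2) S :=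
  (continuousOn_S0 hS).mul (continuousOn_A0 hS)

lemma continuousOn_Sig2 (hS : ∀ z ∈ S, z.2 ≠ 0) (p : Params) : ContinuousOn (fun z : ℝ × ℝ => Sig2 p z.1 z.2) S :=
  ((continuousOn_S0 hS).mul (continuousOn_A1 hS p)).add
    ((continuousOn_S2tilde hS p).mul (continuousOn_A0 hS))

lemma continuousOn_S1 (u : Fin 4 → ℝ) : ContinuousOn (fun z : ℝ × ℝ => S1 z.1 u) S := by
  refine continuousOn_matrix fun i j => ?_
  fin_cases i <;> fin_cases j <;> simp [S1] <;> fun_prop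

lemma continuousOn_Sig1 (hS : ∀ z ∈ S, z.2 ≠ 0) (u : Fin 4 → ℝ) :
    ContinuousOn (fun z : ℝ × ℝ => Sig1 z.1 z.2 u) S :=
  ((continuousOn_S1 u).mul (continuousOn_A0 hS)).add ((continuousOn_S0 hS).mul continuousOn_const)

end Continuity

/-- Bounds on the coefficients at `(γ, δ)`. -/
structure CoeffBound (p : Params) (κ K γ δ : ℝ) : Prop where
  δ_ne : δ ≠ 0
  symm_S2 : (S2 p γ δ).IsSymm
  coercive_S0 : ∀ x : V4, κ * ‖x‖ ^ 2 ≤ ⟪matOp (S0 γ δ) x, x⟫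
  coercive_S2 : ∀ x : V4, κ * ‖x‖ ^ 2 ≤ ⟪matOp (S2 p γ δ) x, x⟫
  norm_S0 : ‖matOp (S0 γ δ)‖ ≤ K
  norm_S2 : ‖matOp (S2 p γ δ)‖ ≤ K
  norm_Sig0 : ‖matOp (Sig0 γ δ)‖ ≤ K
  norm_Sig2 : ‖matOp (Sig2 p γ δ)‖ ≤ K
  norm_S1 : ‖bilMatOp (S1basis γ)‖ ≤ K
  norm_Sig1 : ‖bilMatOp (Sig1basis γ δ)‖ ≤ K

/-- The coefficients are bounded and coercive uniformly on the rectangle of parameters. -/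
lemma exists_coeffBound (p : Params) {γmin γmax δmin δmax : ℝ}
    (hγmin : 0 < γmin) (hγmax : γmax < 1) (hδmin : 0 < δmin)
    (hS2 : ∀ γ ∈ Icc γmin γmax, ∀ δ ∈ Icc δmin δmax, (S2 p γ δ).PosDef) :
    ∃ κ K : ℝ, 0 < κ ∧ 0 ≤ K ∧
      ∀ γ ∈ Icc γmin γmax, ∀ δ ∈ Icc δmin δmax, CoeffBound p κ K γ δ := by
  set S : Set (ℝ × ℝ) := Icc γmin γmax ×ˢ Icc δmin δmax
  have hS : IsCompact S := isCompact_Icc.prod isCompact_Icc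
  have hne : ∀ z ∈ S, z.2 ≠ 0 := fun z hz => (hδmin.trans_le hz.2.1).ne'
  obtain ⟨κ₀, hκ₀, h₀⟩ := exists_coercive hS (continuousOn_S0 hne) fun z hz =>
    posDef_S0 (hγmin.trans_le hz.1.1) (hz.1.2.trans_lt hγmax) (hδmin.trans_le hz.2.1)
  obtain ⟨κ₂, hκ₂, h₂⟩ := exists_coercive hS (continuousOn_S2 hne p) fun z hz =>
    hS2 z.1 hz.1 z.2 hz.2
  have hbd : ∀ {A : ℝ × ℝ → Matrix (Fin 4) (Fin 4) ℝ}, ContinuousOn A S →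
      ∃ K, ∀ z ∈ S, ‖matOp (A z)‖ ≤ K := fun hA =>
    hS.exists_bound_of_continuousOn (continuous_matOp.comp_continuousOn hA)
  have hbd' : ∀ {T : ℝ × ℝ → Fin 4 → Matrix (Fin 4) (Fin 4) ℝ},
      (∀ k, ContinuousOn (fun z => T z k) S) → ∃ K, ∀ z ∈ S, ‖bilMatOp (T z)‖ ≤ K := by
    intro T hT
    have h : ContinuousOn (fun z => bilMatOp (T z)) S :=
      continuous_bilMatOp.comp_continuousOn (continuousOn_pi.2 hT)
    exact hS.exists_bound_of_continuousOn (E := V4 →L[ℝ] V4 →L[ℝ] V4) h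
  obtain ⟨K1, hK1⟩ := hbd (continuousOn_S0 hne)
  obtain ⟨K2, hK2⟩ := hbd (continuousOn_S2 hne p)
  obtain ⟨K3, hK3⟩ := hbd (continuousOn_Sig0 hne)
  obtain ⟨K4, hK4⟩ := hbd (continuousOn_Sig2 hne p)
  obtain ⟨K5, hK5⟩ := hbd' (T := fun z => S1basis z.1) fun k => continuousOn_S1 _
  obtain ⟨K6, hK6⟩ := hbd' (T := fun z => Sig1basis z.1 z.2) fun k => continuousOn_Sig1 hne _
  have a1 := le_abs_self K1
  have a2 := le_abs_self K2
  have a3 := le_abs_self K3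
  have a4 := le_abs_self K4
  have a5 := le_abs_self K5
  have a6 := le_abs_self K6
  have b1 := abs_nonneg K1
  have b2 := abs_nonneg K2
  have b3 := abs_nonneg K3
  have b4 := abs_nonneg K4
  have b5 := abs_nonneg K5
  have b6 := abs_nonneg K6
  refine ⟨min κ₀ κ₂, |K1| + |K2| + |K3| + |K4| + |K5| + |K6|, lt_min hκ₀ hκ₂, by positivity,
    fun γ hγ δ hδ => ?_⟩
  have hz : ((γ, δ) : ℝ × ℝ) ∈ S := ⟨hγ, hδ⟩
  have hsymm : (S2 p γ δ).IsSymm := by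
    have := (hS2 γ hγ δ hδ).isHermitian
    rwa [Matrix.IsHermitian, Matrix.conjTranspose_eq_transpose_of_trivial] at this
  refine ⟨hne _ hz, hsymm, fun x => ?_, fun x => ?_, ?_, ?_, ?_, ?_, ?_, ?_⟩
  · exact (mul_le_mul_of_nonneg_right (min_le_left _ _) (sq_nonneg _)).trans (h₀ _ hz x)
  · exact (mul_le_mul_of_nonneg_right (min_le_right _ _) (sq_nonneg _)).trans (h₂ _ hz x)
  · exact (hK1 _ hz).trans (by linarith)
  · exact (hK2 _ hz).trans (by linarith)
  · exact (hK3 _ hz).trans (by linarith)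
  · exact (hK4 _ hz).trans (by linarith)
  · exact (hK5 _ hz).trans (by linarith)
  · exact (hK6 _ hz).trans (by linarith)

/-- The symmetric Boussinesq/Boussinesq system on the Fourier side. -/
def boussinesq {p : Params} {κ K γ δ : ℝ} (hc : CoeffBound p κ K γ δ) (hκ : 0 < κ) {s : ℝ}
    (hs : 3 / 2 < s) {ε : ℝ} (hε : 0 < ε) (hε1 : ε ≤ 1) : Model V4 κ K s where
  ε := ε
  I := mulI
  c := conjOp
  S₀ := matOp (S0 γ δ)
  S₂ := matOp (S2 p γ δ)
  N₀ := matOp (Sig0 γ δ)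
  N₂ := matOp (Sig2 p γ δ)
  S₁ := bilMatOp (S1basis γ)
  N₁ := bilMatOp (Sig1basis γ δ)
  hs := hs
  hκ := hκ
  hε := hε
  hε1 := hε1
  I_skew := inner_mulI
  norm_I := norm_mulI
  c_c := conjOp_conjOp
  norm_c := norm_conjOp
  c_I := conjOp_mulI
  hS₀ := isLinCoeff_matOp (isSymm_S0 γ δ) hc.norm_S0
  hS₂ := isLinCoeff_matOp hc.symm_S2 hc.norm_S2
  hN₀ := isLinCoeff_matOp (isSymm_Sig0 γ δ) hc.norm_Sig0
  hN₂ := isLinCoeff_matOp (isSymm_Sig2 p hc.δ_ne) hc.norm_Sig2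
  hS₁ := isQuadCoeff_bilMatOp (fun _ => isSymm_S1 _ _) hc.norm_S1
  hN₁ := isQuadCoeff_bilMatOp (fun _ => isSymm_Sig1 _ _ _) hc.norm_Sig1
  coercive₀ := hc.coercive_S0
  coercive₂ := hc.coercive_S2

end Coefficients

/-! ### Weighted Fourier transforms of states -/

section Profile

open ComplexConjugate

/-- The Fourier transform of a state. -/
def hatFun (U : State) (ξ : ℝ) : V4 := WithLp.toLp 2 fun i => fourierL2 (U i) ξ

@[simp] lemma hatFun_apply (U : State) (ξ : ℝ) (i : Fin 4) : hatFun U ξ i = fourierL2 (U i) ξ := rfl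

lemma memLp_hatFun (U : State) : MemLp (hatFun U) 2 :=
  memLp_piLp_iff.2 fun i => Lp.memLp (fourierL2 (U i))

lemma hatFun_sub (U V : State) : hatFun (U - V) =ᵐ[volume] fun ξ => hatFun U ξ - hatFun V ξ := by
  have h : ∀ i, ∀ᵐ ξ, fourierL2 ((U - V) i) ξ = fourierL2 (U i) ξ - fourierL2 (V i) ξ := fun i => by
    filter_upwards [Lp.coeFn_sub (fourierL2 (U i)) (fourierL2 (V i))] with ξ h
    rw [Pi.sub_apply, ← fourierL2CLM_apply, map_sub, fourierL2CLM_apply, fourierL2CLM_apply, h]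
    rfl
  filter_upwards [ae_all_iff.2 h] with ξ hξ
  ext i
  simp [← hξ i]

lemma hatFun_smul (r : ℝ) (U : State) : hatFun (r • U) =ᵐ[volume] fun ξ => r • hatFun U ξ := by
  have h : ∀ i, ∀ᵐ ξ, fourierL2 ((r • U) i) ξ = r • fourierL2 (U i) ξ := fun i => by
    filter_upwards [Lp.coeFn_smul r (fourierL2 (U i))] with ξ h
    rw [Pi.smul_apply, ← fourierL2CLM_apply, map_smul, fourierL2CLM_apply, h]
    rfl
  filter_upwards [ae_all_iff.2 h] with ξ hξ
  ext i
  simp only [hatFun_apply, hξ i, PiLp.smul_apply]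

lemma hatFun_neg (U : State) : ∀ᵐ ξ, hatFun U (-ξ) = conjOp (hatFun U ξ) := by
  filter_upwards [ae_all_iff.2 fun i => fourierL2_neg (U i)] with ξ h
  ext i
  simp [h i]

lemma hatFun_injective {U V : State} (h : hatFun U =ᵐ[volume] hatFun V) : U = V := by
  ext1 i
  refine fourierL2_injective (Lp.ext ?_)
  filter_upwards [h] with ξ hξ
  exact congrArg (fun x : V4 => x i) hξ

/-- `g` is the Fourier transform of `U`, multiplied by the weight `w`. -/
def Profile (w : ℝ → ℝ) (U : State) (g : L2 V4) : Prop := ∀ᵐ ξ, g ξ = w ξ • hatFun U ξ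

variable {w : ℝ → ℝ} {U V : State} {f g : L2 V4}

lemma Profile.sub (hU : Profile w U f) (hV : Profile w V g) : Profile w (U - V) (f - g) := by
  filter_upwards [hU, hV, hatFun_sub U V, Lp.coeFn_sub f g] with ξ h1 h2 h3 h4
  rw [h4, Pi.sub_apply, h1, h2, h3, smul_sub]

lemma Profile.smul (r : ℝ) (hU : Profile w U f) : Profile w (r • U) (r • f) := by
  filter_upwards [hU, hatFun_smul r U, Lp.coeFn_smul r f] with ξ h1 h3 h4
  rw [h4, Pi.smul_apply, h1, h3, smul_comm]

lemma Profile.unique (hf : Profile w U f) (hg : Profile w U g) : f = g := by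
  refine Lp.ext ?_
  filter_upwards [hf, hg] with ξ h1 h2
  rw [h1, h2]

lemma Profile.injective (hw : ∀ ξ, w ξ ≠ 0) (hU : Profile w U f) (hV : Profile w V f) : U = V := by
  refine hatFun_injective ?_
  filter_upwards [hU, hV] with ξ h1 h2
  exact smul_right_injective V4 (hw ξ) (h1.symm.trans h2)

lemma Profile.reflOp (hw : ∀ ξ, w (-ξ) = w ξ) (hU : Profile w U f) : reflOp conjOp f = f := by
  rw [reflOp_eq_self_iff conjOp_conjOp]
  filter_upwards [hU, ae_neg hU, hatFun_neg U] with ξ h1 h2 h3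
  rw [h2, h1, h3, hw, map_smul]

/-- Dividing by a weight that is even and at least 1 keeps `g` in `L²` and Hermitian, hence the
transform of a real function. This is the way back from the Fourier side. -/
lemma Profile.exists_of_reflOp (hc : Continuous w) (h1 : ∀ ξ, 1 ≤ w ξ) (hw : ∀ ξ, w (-ξ) = w ξ)
    (hg : SymBoussinesq.reflOp conjOp g = g) : ∃ U, Profile w U g := by
  rw [reflOp_eq_self_iff conjOp_conjOp] at hg
  have hpos : ∀ ξ, w ξ ≠ 0 := fun ξ => (zero_lt_one.trans_le (h1 ξ)).ne'
  have hmem : ∀ i, MemLp (fun ξ => ((w ξ)⁻¹ : ℝ) • g ξ i) 2 := fun i => by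
    have hgi : MemLp (fun ξ => g ξ i) 2 := memLp_piLp_iff.1 (Lp.memLp g) i
    refine hgi.of_le ((hc.inv₀ hpos).aestronglyMeasurable.smul hgi.1) (ae_of_all _ fun ξ => ?_)
    rw [norm_smul, norm_inv, Real.norm_of_nonneg (zero_le_one.trans (h1 ξ))]
    exact mul_le_of_le_one_left (norm_nonneg _) (inv_le_one_of_one_le₀ (h1 ξ))
  have hex : ∀ i, ∃ u, fourierL2 u = (hmem i).toLp _ := fun i => by
    refine exists_fourierL2_eq _ ?_
    filter_upwards [(hmem i).coeFn_toLp, ae_neg (hmem i).coeFn_toLp, hg] with ξ h2 h3 h4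
    rw [h2, h3, h4, hw]
    simp
  choose u hu using hex
  refine ⟨u, ?_⟩
  filter_upwards [ae_all_iff.2 fun i => (hmem i).coeFn_toLp] with ξ h
  ext i
  simp only [PiLp.smul_apply, hatFun_apply, hu, h i]
  rw [smul_smul, mul_inv_cancel₀ (hpos ξ), one_smul]

/-- The weight of the space `H^{r+1}_ε`. -/
def epsWt (ε r ξ : ℝ) : ℝ := jb ξ ^ r * √(1 + ε * jb ξ ^ 2)

lemma continuous_epsWt (ε r : ℝ) : Continuous (epsWt ε r) := by
  have := continuous_jb
  have := continuous_jb_rpow r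
  unfold epsWt; fun_prop

lemma epsWt_neg (ε r ξ : ℝ) : epsWt ε r (-ξ) = epsWt ε r ξ := by simp [epsWt, jb_neg]

lemma one_le_epsWt {ε r : ℝ} (hε : 0 ≤ ε) (hr : 0 ≤ r) (ξ : ℝ) : 1 ≤ epsWt ε r ξ := by
  have h1 : 1 ≤ jb ξ ^ r := Real.one_le_rpow (one_le_jb ξ) hr
  have h2 : 1 ≤ √(1 + ε * jb ξ ^ 2) := by
    rw [Real.one_le_sqrt]; nlinarith [mul_nonneg hε (sq_nonneg (jb ξ))]
  exact one_le_mul_of_one_le_of_one_le h1 h2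

lemma epsWt_sq {ε : ℝ} (hε : 0 ≤ ε) (r ξ : ℝ) :
    epsWt ε r ξ ^ 2 = (1 + (2 * Real.pi * ξ) ^ 2) ^ r + ε * (1 + (2 * Real.pi * ξ) ^ 2) ^ (r + 1) := by
  have h : (jb ξ ^ (r + 1)) = jb ξ ^ r * jb ξ := by
    rw [Real.rpow_add (jb_pos ξ), Real.rpow_one]
  rw [jb_rpow_sq, jb_rpow_sq, h, epsWt, mul_pow, Real.sq_sqrt (by positivity)]
  ring

lemma sobolevSq_eq (r : ℝ) (U : State) :
    sobolevSq r U = ∫⁻ ξ, ENNReal.ofReal ((1 + (2 * Real.pi * ξ) ^ 2) ^ r) * ‖hatFun U ξ‖ₑ ^ 2 := by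
  have hm : Measurable fun ξ : ℝ => ENNReal.ofReal ((1 + (2 * Real.pi * ξ) ^ 2) ^ r) := by
    fun_prop
  have hmi : ∀ i ∈ Finset.univ, AEMeasurable (fun ξ : ℝ =>
      ENNReal.ofReal ((1 + (2 * Real.pi * ξ) ^ 2) ^ r) * ‖fourierL2 (U i) ξ‖ₑ ^ 2) := fun i _ =>
    hm.aemeasurable.mul ((Lp.aestronglyMeasurable (fourierL2 (U i))).enorm.pow_const 2)
  rw [sobolevSq, ← lintegral_finsetSum' _ hmi]
  refine lintegral_congr fun ξ => ?_
  rw [← Finset.mul_sum]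
  congr 1
  have h := PiLp.norm_sq_eq_of_L2 (fun _ : Fin 4 => ℂ) (hatFun U ξ)
  rw [← ofReal_norm, ← ENNReal.ofReal_pow (norm_nonneg _), h,
    ENNReal.ofReal_sum_of_nonneg fun i _ => by positivity]
  refine Finset.sum_congr rfl fun i _ => ?_
  rw [← ofReal_norm, ← ENNReal.ofReal_pow (norm_nonneg _)]
  rfl

lemma epsNorm_eq {ε : ℝ} (hε : 0 ≤ ε) (r : ℝ) (U : State) :
    epsNorm ε (r + 1) U = (∫⁻ ξ, ‖epsWt ε r ξ • hatFun U ξ‖ₑ ^ 2) ^ (1 / 2 : ℝ) := by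
  have hm : ∀ r : ℝ, Measurable fun ξ : ℝ => ENNReal.ofReal ((1 + (2 * Real.pi * ξ) ^ 2) ^ r) :=
    fun r => by fun_prop
  have hmU : ∀ r : ℝ, AEMeasurable (fun ξ : ℝ =>
      ENNReal.ofReal ((1 + (2 * Real.pi * ξ) ^ 2) ^ r) * ‖hatFun U ξ‖ₑ ^ 2) := fun r =>
    (hm r).aemeasurable.mul ((memLp_hatFun U).1.enorm.pow_const 2)
  rw [epsNorm, add_sub_cancel_right, sobolevSq_eq, sobolevSq_eq,
    ← lintegral_const_mul'' _ (hmU _), ← lintegral_add_left' (hmU _)]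
  congr 1
  refine lintegral_congr fun ξ => ?_
  rw [enorm_smul, mul_pow ‖epsWt ε r ξ‖ₑ, ← mul_assoc, ← add_mul]
  congr 1
  rw [← ofReal_norm, ← ENNReal.ofReal_pow (norm_nonneg _), Real.norm_eq_abs, sq_abs, epsWt_sq hε,
    ENNReal.ofReal_add (by positivity) (by positivity), ENNReal.ofReal_mul hε]

lemma Profile.epsNorm_eq {ε r : ℝ} (hε : 0 ≤ ε) (h : Profile (epsWt ε r) U g) :
    epsNorm ε (r + 1) U = ‖g‖ₑ := by
  have h1 : ∫⁻ ξ, ‖epsWt ε r ξ • hatFun U ξ‖ₑ ^ 2 = ‖g‖ₑ ^ 2 := by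
    rw [← ofReal_norm, ← ENNReal.ofReal_pow (norm_nonneg _), ← lintegral_enorm_sq_eq]
    refine lintegral_congr_ae ?_
    filter_upwards [h] with ξ hξ
    rw [hξ]
  rw [SymBoussinesq.epsNorm_eq hε, h1, ← ENNReal.rpow_natCast, ← ENNReal.rpow_mul]
  norm_num

lemma Profile.memHs {ε r : ℝ} (hε : 0 < ε) (h : Profile (epsWt ε r) U g) : MemHs (r + 1) U := by
  have h1 := h.epsNorm_eq hε.le
  rw [epsNorm] at h1
  have h2 : (sobolevSq (r + 1 - 1) U + ENNReal.ofReal ε * sobolevSq (r + 1) U) ^ (1 / 2 : ℝ) < ⊤ := by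
    rw [h1]; exact enorm_lt_top
  rw [ENNReal.rpow_lt_top_iff_of_pos (by norm_num)] at h2
  have h3 := (le_add_self.trans_lt h2)
  rw [ENNReal.mul_lt_top_iff] at h3
  rcases h3 with h3 | h3 | h3
  · exact h3.2
  · exact absurd h3 (ENNReal.ofReal_pos.2 hε).ne'
  · rw [MemHs, h3]; exact ENNReal.zero_lt_top

lemma MemHs.exists_profile {ε r : ℝ} (hε : 0 ≤ ε) (hU : MemHs (r + 1) U) :
    ∃ g, Profile (epsWt ε r) U g := by
  have hle : sobolevSq r U ≤ sobolevSq (r + 1) U := by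
    refine Finset.sum_le_sum fun i _ => lintegral_mono fun ξ => ?_
    gcongr
    · nlinarith [sq_nonneg (2 * Real.pi * ξ)]
    · linarith
  have hmem : MemLp (fun ξ => epsWt ε r ξ • hatFun U ξ) 2 := by
    refine ⟨(continuous_epsWt ε r).aestronglyMeasurable.smul (memLp_hatFun U).1, ?_⟩
    rw [eLpNorm_eq_lintegral_rpow_enorm_toReal (by norm_num) (by norm_num)]
    have := SymBoussinesq.epsNorm_eq hε r U
    simp only [ENNReal.toReal_ofNat, ENNReal.rpow_ofNat]
    rw [← this, epsNorm, add_sub_cancel_right]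
    refine ENNReal.rpow_lt_top_of_nonneg (by norm_num) (ENNReal.add_lt_top.2
      ⟨hle.trans_lt hU, ENNReal.mul_lt_top ENNReal.ofReal_lt_top hU⟩).ne
  exact ⟨hmem.toLp _, hmem.coeFn_toLp⟩

/-- Passing to profiles is linear and isometric, so continuity in `H^{r+1}_ε` is continuity in `L²`;
likewise for derivatives in `isTimeDeriv_iff`. -/
lemma isC0_iff {ε r : ℝ} (hε : 0 < ε) {I : Set ℝ} {U : ℝ → State} {f : ℝ → L2 V4}
    (h : ∀ t ∈ I, Profile (epsWt ε r) (U t) (f t)) :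
    IsC0 ε (r + 1) I U ↔ ContinuousOn f I := by
  refine forall₂_congr fun t ht => ?_
  rw [and_iff_right ((h t ht).memHs hε), ContinuousWithinAt, tendsto_iff_edist_tendsto_0]
  refine tendsto_congr' ?_
  filter_upwards [self_mem_nhdsWithin] with τ hτ
  rw [((h τ hτ).sub (h t ht)).epsNorm_eq hε.le, edist_eq_enorm_sub]

lemma isTimeDeriv_iff {ε r : ℝ} (hε : 0 < ε) {I : Set ℝ} {U V : ℝ → State} {f h : ℝ → L2 V4}
    (hU : ∀ t ∈ I, Profile (epsWt ε r) (U t) (f t))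
    (hV : ∀ t ∈ I, Profile (epsWt ε r) (V t) (h t)) :
    IsTimeDeriv ε (r + 1) I U V ↔ ∀ t ∈ I, HasDerivWithinAt f (h t) I t := by
  refine forall₂_congr fun t ht => ?_
  rw [hasDerivWithinAt_iff_tendsto_slope, tendsto_iff_edist_tendsto_0]
  refine tendsto_congr' ?_
  filter_upwards [self_mem_nhdsWithin] with τ hτ
  rw [((((hU τ hτ.1).sub (hU t ht)).smul (τ - t)⁻¹).sub (hV t ht)).epsNorm_eq hε.le,
    edist_eq_enorm_sub]
  rfl

end Profile

/-! ### The equation on the Fourier side -/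

section Pairs

/-- `R` is the Fourier transform of `F` in the sense of distributions. -/
structure Pairs (F : ℝ → ℝ) (R : ℝ → ℂ) : Prop where
  int : ∀ φ, IsTest φ → Integrable fun x => F x * φ x
  int_hat : ∀ φ, IsTest φ → Integrable fun ξ => R ξ * testHat φ ξ
  eq : ∀ φ, IsTest φ → ((∫ x, F x * φ x : ℝ) : ℂ) = ∫ ξ, R ξ * testHat φ ξ

variable {F F' : ℝ → ℝ} {R R' : ℝ → ℂ}

lemma Pairs.zero : Pairs (fun _ => 0) (fun _ => 0) := ⟨by simp, by simp, by simp⟩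

lemma Pairs.add (h : Pairs F R) (h' : Pairs F' R') :
    Pairs (fun x => F x + F' x) (fun ξ => R ξ + R' ξ) where
  int φ hφ := by simpa only [add_mul] using! (h.int φ hφ).add (h'.int φ hφ)
  int_hat φ hφ := by simpa only [add_mul] using! (h.int_hat φ hφ).add (h'.int_hat φ hφ)
  eq φ hφ := by
    simp only [add_mul]
    rw [integral_add (h.int φ hφ) (h'.int φ hφ), integral_add (h.int_hat φ hφ) (h'.int_hat φ hφ),
      Complex.ofReal_add, h.eq φ hφ, h'.eq φ hφ]

lemma Pairs.const_mul (r : ℝ) (h : Pairs F R) :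
    Pairs (fun x => r * F x) (fun ξ => (r : ℂ) * R ξ) where
  int φ hφ := by simpa only [mul_assoc] using (h.int φ hφ).const_mul r
  int_hat φ hφ := by simpa only [mul_assoc] using (h.int_hat φ hφ).const_mul (r : ℂ)
  eq φ hφ := by
    simp only [mul_assoc]
    rw [integral_const_mul, integral_const_mul, Complex.ofReal_mul, h.eq φ hφ]

lemma Pairs.sum {ι : Type*} (t : Finset ι) {F : ι → ℝ → ℝ} {R : ι → ℝ → ℂ}
    (h : ∀ i, Pairs (F i) (R i)) :
    Pairs (fun x => ∑ i ∈ t, F i x) (fun ξ => ∑ i ∈ t, R i ξ) := by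
  classical
  induction t using Finset.induction_on with
  | empty => simpa using Pairs.zero
  | insert i t hi ih =>
    simp only [Finset.sum_insert hi]
    exact (h i).add ih

lemma pairs_fourierL2 (u : Lp ℝ 2 (volume : Measure ℝ)) : Pairs u (fourierL2 u) where
  int _ hφ := (Lp.memLp u).integrable_mul (hφ.memLp 2)
  int_hat _ hφ := (Lp.memLp _).integrable_mul (hφ.memLp_testHat 2)
  eq _ hφ := integral_mul_test_real u hφ

/-- The convolution of the transforms of `u` and `v`. -/
def convHat (u v : Lp ℝ 2 (volume : Measure ℝ)) (ξ : ℝ) : ℂ :=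
  ∫ η, fourierL2 u (ξ - η) * fourierL2 v η

lemma pairs_convHat {u v : Lp ℝ 2 (volume : Measure ℝ)} (hu : Integrable (fourierL2 u))
    (hv : Integrable (fourierL2 v)) : Pairs (fun x => u x * v x) (convHat u v) where
  int φ hφ := by
    obtain ⟨C, hC⟩ := hφ.2.exists_bound_of_continuous hφ.1.continuous
    exact ((Lp.memLp u).integrable_mul (Lp.memLp v)).mul_bdd (c := C)
      hφ.1.continuous.aestronglyMeasurable (ae_of_all _ hC)
  int_hat φ hφ := by
    have hb : ∀ ξ, ‖testHat φ ξ‖ ≤ ∫ x, ‖(φ x : ℂ)‖ := fun ξ => by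
      rw [testHat_apply]
      refine (norm_integral_le_integral_norm _).trans_eq ?_
      refine integral_congr_ae (ae_of_all _ fun x => ?_)
      simp only [Circle.smul_def, norm_smul, Circle.norm_coe, one_mul]
    exact (integrable_convolution_mul hu hv).mul_bdd (c := ∫ x, ‖(φ x : ℂ)‖)
      hφ.continuous_testHat.aestronglyMeasurable (ae_of_all _ hb)
  eq _ hφ := integral_mul_mul_test_real u v hu hv hφ

lemma Pairs.eq_deriv_deriv (h : Pairs F R) {φ : ℝ → ℝ} (hφ : IsTest φ) :
    ((∫ x, F x * deriv (deriv φ) x : ℝ) : ℂ)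
      = ∫ ξ, -(((Model.q ξ ^ 2 : ℝ) : ℂ) * R ξ * testHat φ ξ) := by
  rw [h.eq _ hφ.deriv.deriv]
  refine integral_congr_ae (ae_of_all _ fun ξ => ?_)
  simp only [testHat_deriv_deriv hφ, Model.q]
  ring

lemma Pairs.int_hat_deriv_deriv (h : Pairs F R) {φ : ℝ → ℝ} (hφ : IsTest φ) :
    Integrable fun ξ => -(((Model.q ξ ^ 2 : ℝ) : ℂ) * R ξ * testHat φ ξ) := by
  refine (h.int_hat _ hφ.deriv.deriv).congr (ae_of_all _ fun ξ => ?_)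
  simp only [testHat_deriv_deriv hφ, Model.q]
  ring

lemma Pairs.integral_sub_deriv_deriv (h : Pairs F R) (h' : Pairs F' R') (ε : ℝ) {φ : ℝ → ℝ}
    (hφ : IsTest φ) : ((∫ x, (F x * φ x - ε * F' x * deriv (deriv φ) x) : ℝ) : ℂ)
      = ∫ ξ, (R ξ + ((ε * Model.q ξ ^ 2 : ℝ) : ℂ) * R' ξ) * testHat φ ξ := by
  have e1 := integral_sub (h.int φ hφ) ((h'.int _ hφ.deriv.deriv).const_mul ε)
  simp only [← mul_assoc] at e1
  rw [e1]
  simp only [mul_assoc ε]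
  rw [integral_const_mul, Complex.ofReal_sub, Complex.ofReal_mul, h.eq φ hφ, h'.eq_deriv_deriv hφ,
    ← integral_const_mul, ← integral_sub (h.int_hat φ hφ) ((h'.int_hat_deriv_deriv hφ).const_mul _)]
  refine integral_congr_ae (ae_of_all _ fun ξ => ?_)
  push_cast
  ring

end Pairs

/-! ### The transforms of the equation and of the weak derivative. -/

section Equation

lemma mulVec_add_smul_eq (A₀ : Matrix (Fin 4) (Fin 4) ℝ) (T : Fin 4 → Matrix (Fin 4) (Fin 4) ℝ)
    (ε : ℝ) (u v : Fin 4 → ℝ) (i : Fin 4) :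
    ((A₀ + ε • ∑ k, u k • T k) *ᵥ v) i
      = ∑ j, A₀ i j * v j + ε * ∑ k, ∑ j, T k i j * (u k * v j) := by
  rw [Matrix.add_mulVec, Matrix.smul_mulVec, Matrix.sum_mulVec, Pi.add_apply, Pi.smul_apply,
    Finset.sum_apply, smul_eq_mul]
  simp only [Matrix.mulVec, dotProduct, Finset.mul_sum, Matrix.smul_apply, smul_eq_mul]
  congr 1
  refine Finset.sum_congr rfl fun k _ => Finset.sum_congr rfl fun j _ => ?_
  ring

/-- The transform of the left-hand side of the equation. -/
def residual (p : Params) (γ δ ε : ℝ) (U V W : State) (ξ : ℝ) (i : Fin 4) : ℂ :=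
  (∑ j, (S0 γ δ i j : ℂ) * fourierL2 (V j) ξ
      + ε * ∑ k, ∑ j, (S1basis γ k i j : ℂ) * convHat (U k) (V j) ξ
    + (∑ j, (Sig0 γ δ i j : ℂ) * fourierL2 (W j) ξ
      + ε * ∑ k, ∑ j, (Sig1basis γ δ k i j : ℂ) * convHat (U k) (W j) ξ))
    + ((ε * Model.q ξ ^ 2 : ℝ) : ℂ) * (∑ j, (S2 p γ δ i j : ℂ) * fourierL2 (V j) ξ
      + ∑ j, (Sig2 p γ δ i j : ℂ) * fourierL2 (W j) ξ)

lemma integral_equation_eq (p : Params) (γ δ ε : ℝ) {U V W : State}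
    (hU : ∀ i, Integrable (fourierL2 (U i))) (hV : ∀ i, Integrable (fourierL2 (V i)))
    (hW : ∀ i, Integrable (fourierL2 (W i))) {φ : ℝ → ℝ} (hφ : IsTest φ) (i : Fin 4) :
    ((∫ x, (((S0 γ δ + ε • S1 γ (U.eval x)) *ᵥ V.eval x
            + (Sig0 γ δ + ε • Sig1 γ δ (U.eval x)) *ᵥ W.eval x) i * φ x
          - ε * (S2 p γ δ *ᵥ V.eval x + Sig2 p γ δ *ᵥ W.eval x) i * deriv (deriv φ) x) : ℝ) : ℂ)
      = ∫ ξ, residual p γ δ ε U V W ξ i * testHat φ ξ := by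
  have lin : ∀ (A : Matrix (Fin 4) (Fin 4) ℝ) (V : State), Pairs (fun x => ∑ j, A i j * V j x)
      (fun ξ => ∑ j, (A i j : ℂ) * fourierL2 (V j) ξ) := fun A V =>
    Pairs.sum _ fun j => (pairs_fourierL2 (V j)).const_mul _
  have quad : ∀ (T : Fin 4 → Matrix (Fin 4) (Fin 4) ℝ) (V : State),
      (∀ i, Integrable (fourierL2 (V i))) →
      Pairs (fun x => ∑ k, ∑ j, T k i j * (U k x * V j x))
        (fun ξ => ∑ k, ∑ j, (T k i j : ℂ) * convHat (U k) (V j) ξ) := fun T V hV =>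
    Pairs.sum _ fun k => Pairs.sum _ fun j => (pairs_convHat (hU k) (hV j)).const_mul _
  have h1 := ((lin (S0 γ δ) V).add ((quad (S1basis γ) V hV).const_mul ε)).add
    ((lin (Sig0 γ δ) W).add ((quad (Sig1basis γ δ) W hW).const_mul ε))
  have h2 := (lin (S2 p γ δ) V).add (lin (Sig2 p γ δ) W)
  refine Eq.trans ?_ (h1.integral_sub_deriv_deriv h2 ε hφ)
  congr 2
  ext x
  rw [S1_eq_sum, Sig1_eq_sum, Pi.add_apply, mulVec_add_smul_eq, mulVec_add_smul_eq]
  rfl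

/-- The Sobolev embedding in the form used here: `⟨ξ⟩^{-r}` is in `L²` since `r ≥ s - 1 > 1/2`. It
makes products of the unknowns genuine convolutions of integrable transforms. -/
lemma Profile.integrable_fourierL2 {s r : ℝ} (hs : 3 / 2 < s) (hr : s - 1 ≤ r) {U : State}
    {g : L2 V4} (h : Profile (fun ξ => jb ξ ^ r) U g) (i : Fin 4) :
    Integrable (fourierL2 (U i)) := by
  have h1 : MemLp (fun ξ => jb ξ ^ (-r)) 2 := by
    refine (isWeight_wt hs).memLp.of_le (continuous_jb_rpow _).aestronglyMeasurable
      (ae_of_all _ fun ξ => ?_)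
    rw [wt, Real.norm_of_nonneg (jb_rpow_pos _ _).le, Real.norm_of_nonneg (jb_rpow_pos _ _).le]
    exact jb_rpow_le_rpow (by linarith) ξ
  have h2 : MemLp (fun ξ => g ξ i) 2 := memLp_piLp_iff.1 (Lp.memLp g) i
  refine (h1.ofReal (K := ℂ)).integrable_mul h2 |>.congr ?_
  filter_upwards [h] with ξ hξ
  simp only [Pi.mul_apply, hξ, PiLp.smul_apply, hatFun_apply, Complex.real_smul]
  rw [← mul_assoc]
  have : ((jb ξ ^ (-r) : ℝ) : ℂ) * ((jb ξ ^ r : ℝ) : ℂ) = 1 := by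
    rw [← Complex.ofReal_mul, jb_rpow_mul]; simp
  simp only [Complex.coe_algebraMap, this, one_mul]

/-- Products in physical space are convolutions on the Fourier side. -/
lemma bil_kProd_ae {s : ℝ} (hs : 3 / 2 < s) (T : Fin 4 → Matrix (Fin 4) (Fin 4) ℝ) {U V : State}
    {a v : L2 V4} (ha : Profile (fun ξ => jb ξ ^ s) U a)
    (hv : Profile (fun ξ => jb ξ ^ (s - 1)) V v) :
    ∀ᵐ ξ, ∀ i, bil (wt s) (kProd s) (bilMatOp T) a v ξ i
      = ((jb ξ ^ (s - 1) : ℝ) : ℂ) * ∑ k, ∑ j, (T k i j : ℂ) * convHat (U k) (V j) ξ := by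
  have hU := fun k => Profile.integrable_fourierL2 hs (by linarith) ha k
  have hV := fun j => Profile.integrable_fourierL2 hs le_rfl hv j
  have hex : ∀ k j, ∀ᵐ ξ, Integrable fun η => fourierL2 (U k) (ξ - η) * fourierL2 (V j) η := by
    intro k j
    filter_upwards [(hU k).ae_convolution_exists (ContinuousLinearMap.mul ℂ ℂ) (hV j)] with ξ h
    exact h.integrable_swap
  filter_upwards [bil_ae (isWeight_wt hs) (isKernel_kProd hs) (bilMatOp T) a v,
    ae_integrable_convI (isWeight_wt hs) (isKernel_kProd hs) (bilMatOp T) a v,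
    ae_all_iff.2 fun k => ae_all_iff.2 (hex k)] with ξ h1 h2 h3 i
  have h4 : convK (kProd s) (bilMatOp T) a v ξ i = ∫ η, convI (kProd s) (bilMatOp T) a v ξ η i :=
    ((PiLp.proj 2 (𝕜 := ℝ) (fun _ : Fin 4 => ℂ) i).integral_comp_comm h2).symm
  have h5 : (fun η => convI (kProd s) (bilMatOp T) a v ξ η i) =ᵐ[volume] fun η =>
      ((jb ξ ^ (s - 1) : ℝ) : ℂ)
        * ∑ k, ∑ j, (T k i j : ℂ) * (fourierL2 (U k) (ξ - η) * fourierL2 (V j) η) := by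
    have hsub := (Measure.measurePreserving_sub_left (volume : Measure ℝ) ξ).quasiMeasurePreserving.ae ha
    filter_upwards [hsub, hv] with η e1 e2
    have e3 : jb (ξ - η) ^ (-s) * jb (ξ - η) ^ s = 1 := by rw [jb_rpow_mul]; simp
    have e4 : jb η ^ (-(s - 1)) * jb η ^ (s - 1) = 1 := by rw [jb_rpow_mul]; simp
    have e5 : kProd s ξ η * (jb (ξ - η) ^ s * jb η ^ (s - 1)) = jb ξ ^ (s - 1) := by
      rw [kProd]
      linear_combination (jb ξ ^ (s - 1) * jb η ^ (-(s - 1)) * jb η ^ (s - 1)) * e3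
        + jb ξ ^ (s - 1) * e4
    rw [convI, e1, e2, map_smul, map_smul, smul_apply, smul_smul, smul_smul,
      show kProd s ξ η * jb η ^ (s - 1) * jb (ξ - η) ^ s = jb ξ ^ (s - 1) by rw [← e5]; ring]
    simp
  rw [h1, h4, integral_congr_ae h5, integral_const_mul]
  congr 1
  rw [integral_finsetSum _ fun k _ => integrable_finsetSum _ fun j _ => (h3 k j).const_mul _]
  refine Finset.sum_congr rfl fun k _ => ?_
  rw [integral_finsetSum _ fun j _ => (h3 k j).const_mul _]
  refine Finset.sum_congr rfl fun j _ => ?_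
  rw [integral_const_mul, convHat]

/-- Both conditions say that `Ŵ - i q Û`, a function of at most linear growth in the mean,
annihilates the inverse transforms of all test functions; `ae_eq_zero_of_forall_testHat` applies. -/
lemma isWeakDeriv_iff {U W : State} :
    IsWeakDeriv U W ↔ ∀ᵐ ξ, hatFun W ξ = Model.q ξ • mulI (hatFun U ξ) := by
  have key : ∀ φ, IsTest φ → ∀ i,
      ((∫ x, U i x * deriv φ x = -∫ x, W i x * φ x) ↔
        ∫ ξ, (fourierL2 (W i) ξ - (Complex.I * Model.q ξ) * fourierL2 (U i) ξ) * testHat φ ξ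
          = 0) := by
    intro φ hφ i
    have e : ∫ ξ, (fourierL2 (W i) ξ - (Complex.I * Model.q ξ) * fourierL2 (U i) ξ) * testHat φ ξ
        = ((∫ x, W i x * φ x : ℝ) : ℂ) + ((∫ x, U i x * deriv φ x : ℝ) : ℂ) := by
      rw [(pairs_fourierL2 (W i)).eq φ hφ, (pairs_fourierL2 (U i)).eq _ hφ.deriv,
        ← integral_add ((pairs_fourierL2 (W i)).int_hat φ hφ)
          ((pairs_fourierL2 (U i)).int_hat _ hφ.deriv)]
      refine integral_congr_ae (ae_of_all _ fun ξ => ?_)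
      simp only [testHat_deriv hφ, Model.q]
      ring
    rw [e, ← Complex.ofReal_add, Complex.ofReal_eq_zero]
    constructor <;> intro h <;> linarith
  constructor
  · intro h
    have hz : ∀ i, ∀ᵐ ξ,
        fourierL2 (W i) ξ - (Complex.I * Model.q ξ) * fourierL2 (U i) ξ = 0 := by
      intro i
      refine ae_eq_zero_of_forall_testHat ?_ fun φ hφ => (key φ hφ i).1 (h φ hφ i)
      have hcont : Continuous fun ξ => ((jb ξ ^ 2)⁻¹ : ℝ) :=
        (continuous_jb.pow 2).inv₀ fun ξ => (pow_pos (jb_pos ξ) 2).ne'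
      have hsum : MemLp (fun ξ => ‖fourierL2 (W i) ξ‖ + ‖fourierL2 (U i) ξ‖) 2 :=
        (Lp.memLp (fourierL2 (W i))).norm.add (Lp.memLp (fourierL2 (U i))).norm
      refine hsum.of_le ((Complex.continuous_ofReal.comp hcont).aestronglyMeasurable.mul
        ((Lp.aestronglyMeasurable _).sub (((continuous_const.mul (Complex.continuous_ofReal.comp
          Model.continuous_q)).aestronglyMeasurable).mul (Lp.aestronglyMeasurable _))))
        (ae_of_all _ fun ξ => ?_)
      have hj := jb_pos ξ
      have h1 : |Model.q ξ| ≤ jb ξ ^ 2 := by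
        rw [jb_sq, Model.q]
        nlinarith [sq_nonneg (|2 * Real.pi * ξ| - 1), sq_abs (2 * Real.pi * ξ)]
      have h2 : 1 ≤ jb ξ ^ 2 := one_le_pow₀ (one_le_jb ξ)
      rw [norm_mul, Complex.norm_real, Real.norm_of_nonneg (by positivity), inv_mul_le_iff₀
        (by positivity), Real.norm_of_nonneg (by positivity)]
      refine (norm_sub_le _ _).trans ?_
      rw [norm_mul, norm_mul, Complex.norm_I, Complex.norm_real, Real.norm_eq_abs, one_mul, mul_add]
      gcongr
      exact le_mul_of_one_le_left (norm_nonneg _) h2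
    filter_upwards [ae_all_iff.2 hz] with ξ hξ
    ext i
    simp only [hatFun_apply, PiLp.smul_apply, mulI_apply, Complex.real_smul]
    linear_combination hξ i
  · intro h φ hφ i
    rw [key φ hφ i]
    refine integral_eq_zero_of_ae ?_
    filter_upwards [h] with ξ hξ
    have := congrArg (fun x : V4 => x i) hξ
    simp only [hatFun_apply, PiLp.smul_apply, mulI_apply, Complex.real_smul] at this
    rw [this, Pi.zero_apply]
    ring

end Equation

/-! ### The relation between `f` and `h`, frequency by frequency. -/

namespace Model

variable {E : Type*} [NormedAddCommGroup E] [InnerProductSpace ℝ E] [FiniteDimensional ℝ E]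
  [CompleteSpace E] {κ K s : ℝ} (Q : Model E κ K s)

/-- `Rel` is the equation after multiplication by the invertible `θ M⁻¹`; here this is undone. -/
lemma rel_iff (f h : L2 E) : Q.Rel f h ↔
    ∀ᵐ ξ, Q.M ξ (Q.aOp h ξ) + Q.N ξ (Q.dOp f ξ) + Q.ε • Q.quad f h ξ = 0 := by
  have hpt : ∀ ξ (x y z : E), x = (jb ξ)⁻¹ • Q.Lsym ξ y - Q.ε • Q.θ ξ • Q.Minv ξ z ↔
      Q.M ξ ((Q.θ ξ)⁻¹ • x) + Q.N ξ ((q ξ * (jb ξ)⁻¹ * (Q.θ ξ)⁻¹) • Q.I y) + Q.ε • z = 0 := by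
    intro ξ x y z
    have hθ := (Q.θ_pos ξ).ne'
    have hML : Q.M ξ (Q.Lsym ξ y) = (-q ξ) • Q.I (Q.N ξ y) :=
      congrArg (fun A : E →L[ℝ] E => A y) (Q.M_mul_Lsym ξ)
    have hMM : Q.M ξ (Q.Minv ξ z) = z := congrArg (fun A : E →L[ℝ] E => A z) (Q.M_mul_Minv ξ)
    have hNI : Q.N ξ (Q.I y) = Q.I (Q.N ξ y) := congrArg (fun A : E →L[ℝ] E => A y) (Q.N_I ξ)
    have hinj : ∀ w, Q.M ξ w = 0 → w = 0 := fun w hw => by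
      have : Q.Minv ξ (Q.M ξ w) = w := congrArg (fun A : E →L[ℝ] E => A w) (Q.Minv_mul_M ξ)
      rw [← this, hw, map_zero]
    have e : Q.M ξ (x - ((jb ξ)⁻¹ • Q.Lsym ξ y - Q.ε • Q.θ ξ • Q.Minv ξ z))
        = Q.θ ξ • (Q.M ξ ((Q.θ ξ)⁻¹ • x) + Q.N ξ ((q ξ * (jb ξ)⁻¹ * (Q.θ ξ)⁻¹) • Q.I y)
          + Q.ε • z) := by
      simp only [map_sub, map_smul, hML, hMM, hNI, smul_add, smul_smul]
      rw [mul_inv_cancel₀ hθ, show Q.θ ξ * (q ξ * (jb ξ)⁻¹ * (Q.θ ξ)⁻¹) = (jb ξ)⁻¹ * q ξ by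
        field_simp]
      module
    rw [← sub_eq_zero (a := x)]
    constructor
    · intro h
      rw [h, map_zero] at e
      exact (smul_eq_zero.1 e.symm).resolve_left hθ
    · intro h
      rw [h, smul_zero] at e
      exact hinj _ e
  rw [Rel, Lp.ext_iff]
  refine Filter.eventually_congr ?_
  filter_upwards [Lp.coeFn_sub (Q.linOp f) (Q.ε • Q.resOp (Q.quad f h)),
    Lp.coeFn_smul Q.ε (Q.resOp (Q.quad f h)), mulOp_ae Q.isMult_linOp f,
    mulOp_ae Q.isMult_resOp (Q.quad f h), Q.aOp_ae h, Q.dOp_ae f] with ξ h1 h2 h3 h4 h5 h6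
  rw [h1, Pi.sub_apply, h2, Pi.smul_apply, linOp, h3, resOp, h4, h5, h6, ← hpt]
  simp

end Model

/-! ### Equivalence of the two formulations of the equation. -/

section Bridge

variable {p : Params} {κ K γ δ : ℝ} (hc : CoeffBound p κ K γ δ) (hκ : 0 < κ) {s : ℝ}
  (hs : 3 / 2 < s) {ε : ℝ} (hε : 0 < ε) (hε1 : ε ≤ 1)

lemma boussinesq_θ (ξ : ℝ) : (boussinesq hc hκ hs hε hε1).θ ξ = √(1 + ε * jb ξ ^ 2) := rfl

variable {U V W : State} {f h : L2 V4}

lemma Profile.aOp {r : ℝ} (hU : Profile (epsWt ε r) U f) :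
    Profile (fun ξ => jb ξ ^ r) U ((boussinesq hc hκ hs hε hε1).aOp f) := by
  filter_upwards [hU, (boussinesq hc hκ hs hε hε1).aOp_ae f] with ξ h1 h2
  have hθ := ((boussinesq hc hκ hs hε hε1).θ_pos ξ).ne'
  rw [h2, h1, smul_smul, epsWt, ← boussinesq_θ hc hκ hs hε hε1]
  congr 1
  field_simp

lemma inv_jb_mul_rpow (r ξ : ℝ) : (jb ξ)⁻¹ * jb ξ ^ r = jb ξ ^ (r - 1) := by
  rw [Real.rpow_sub_one (jb_pos ξ).ne']; ring

lemma Profile.emb {r : ℝ} (hU : Profile (epsWt ε r) U f) :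
    Profile (epsWt ε (r - 1)) U ((boussinesq hc hκ hs hε hε1).emb f) := by
  filter_upwards [hU, (boussinesq hc hκ hs hε hε1).emb_ae f] with ξ h1 h2
  rw [h2, h1, smul_smul, epsWt, epsWt, ← mul_assoc, inv_jb_mul_rpow]

lemma Profile.dOp_of_hat {r : ℝ} (hU : Profile (epsWt ε r) U f)
    (hW : ∀ᵐ ξ, hatFun W ξ = Model.q ξ • mulI (hatFun U ξ)) :
    Profile (fun ξ => jb ξ ^ (r - 1)) W ((boussinesq hc hκ hs hε hε1).dOp f) := by
  filter_upwards [hU, (boussinesq hc hκ hs hε hε1).dOp_ae f, hW] with ξ h1 h2 h3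
  have hθ := ((boussinesq hc hκ hs hε hε1).θ_pos ξ).ne'
  rw [h2, h1, h3, map_smul, smul_smul, smul_smul, epsWt, ← boussinesq_θ hc hκ hs hε hε1,
    ← inv_jb_mul_rpow]
  change _ • mulI (hatFun U ξ) = _
  congr 1
  field_simp

lemma Profile.hat_of_dOp {r : ℝ} (hU : Profile (epsWt ε r) U f)
    (hW : Profile (fun ξ => jb ξ ^ (r - 1)) W ((boussinesq hc hκ hs hε hε1).dOp f)) :
    ∀ᵐ ξ, hatFun W ξ = Model.q ξ • mulI (hatFun U ξ) := by
  filter_upwards [hU, (boussinesq hc hκ hs hε hε1).dOp_ae f, hW] with ξ h1 h2 h3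
  have hθ := ((boussinesq hc hκ hs hε hε1).θ_pos ξ).ne'
  refine smul_right_injective V4 (jb_rpow_pos (r - 1) ξ).ne' ?_
  simp only
  rw [← h3, h2, h1, map_smul, smul_smul, smul_smul, epsWt, ← boussinesq_θ hc hκ hs hε hε1,
    ← inv_jb_mul_rpow]
  change _ • mulI (hatFun U ξ) = _
  congr 1
  field_simp

/-- The residual of the equation, in terms of the Fourier-side operators. -/
lemma residual_ae (hU : Profile (epsWt ε s) U f) (hV : Profile (epsWt ε (s - 1)) V h)
    (hW : Profile (fun ξ => jb ξ ^ (s - 1)) W ((boussinesq hc hκ hs hε hε1).dOp f)) :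
    ∀ᵐ ξ, ∀ i, ((boussinesq hc hκ hs hε hε1).M ξ ((boussinesq hc hκ hs hε hε1).aOp h ξ)
        + (boussinesq hc hκ hs hε hε1).N ξ ((boussinesq hc hκ hs hε hε1).dOp f ξ)
        + ε • (boussinesq hc hκ hs hε hε1).quad f h ξ) i
      = ((jb ξ ^ (s - 1) : ℝ) : ℂ) * residual p γ δ ε U V W ξ i := by
  have ha := hU.aOp hc hκ hs hε hε1
  have hv := hV.aOp hc hκ hs hε hε1
  filter_upwards [hv, hW, bil_kProd_ae hs (S1basis γ) ha hv, bil_kProd_ae hs (Sig1basis γ δ) ha hW,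
    Lp.coeFn_add (bil (wt s) (kProd s) (bilMatOp (S1basis γ))
      ((boussinesq hc hκ hs hε hε1).aOp f) ((boussinesq hc hκ hs hε hε1).aOp h))
      (bil (wt s) (kProd s) (bilMatOp (Sig1basis γ δ))
      ((boussinesq hc hκ hs hε hε1).aOp f) ((boussinesq hc hκ hs hε hε1).dOp f))]
    with ξ h1 h2 h3 h4 h5 i
  have hq : ((boussinesq hc hκ hs hε hε1).quad f h ξ) i
      = ((jb ξ ^ (s - 1) : ℝ) : ℂ) * ∑ k, ∑ j, (S1basis γ k i j : ℂ) * convHat (U k) (V j) ξ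
      + ((jb ξ ^ (s - 1) : ℝ) : ℂ)
        * ∑ k, ∑ j, (Sig1basis γ δ k i j : ℂ) * convHat (U k) (W j) ξ := by
    rw [← h3 i, ← h4 i]
    exact congrArg (fun x : V4 => x i) h5
  have hlin : ∀ (A B : Matrix (Fin 4) (Fin 4) ℝ) (X : State),
      ((matOp A + (ε * Model.q ξ ^ 2) • matOp B) (jb ξ ^ (s - 1) • hatFun X ξ)) i
        = ((jb ξ ^ (s - 1) : ℝ) : ℂ) * (∑ j, (A i j : ℂ) * fourierL2 (X j) ξ
          + ((ε * Model.q ξ ^ 2 : ℝ) : ℂ) * ∑ j, (B i j : ℂ) * fourierL2 (X j) ξ) := by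
    intro A B X
    rw [map_smul, add_apply, smul_apply, PiLp.smul_apply, PiLp.add_apply, PiLp.smul_apply,
      matOp_apply, matOp_apply, Complex.real_smul, Complex.real_smul]
    rfl
  rw [PiLp.add_apply, PiLp.add_apply, PiLp.smul_apply, hq, h1, h2]
  have hM := hlin (S0 γ δ) (S2 p γ δ) V
  have hN := hlin (Sig0 γ δ) (Sig2 p γ δ) W
  change ((matOp (S0 γ δ) + (ε * Model.q ξ ^ 2) • matOp (S2 p γ δ))
      (jb ξ ^ (s - 1) • hatFun V ξ)) i + ((matOp (Sig0 γ δ) + (ε * Model.q ξ ^ 2) •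
      matOp (Sig2 p γ δ)) (jb ξ ^ (s - 1) • hatFun W ξ)) i + _ = _
  rw [hM, hN, residual, Complex.real_smul]
  ring

/-- Verifies the growth condition of `ae_eq_zero_of_forall_testHat`: `M` and `N` are at most `K θ²`,
and `θ² ≤ 2⟨ξ⟩²` since `ε ≤ 1`. -/
lemma memLp_residual (hU : Profile (epsWt ε s) U f) (hV : Profile (epsWt ε (s - 1)) V h)
    (hW : Profile (fun ξ => jb ξ ^ (s - 1)) W ((boussinesq hc hκ hs hε hε1).dOp f)) (i : Fin 4) :
    MemLp (fun ξ => ((jb ξ ^ 2)⁻¹ : ℝ) * residual p γ δ ε U V W ξ i) 2 := by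
  set Q := boussinesq hc hκ hs hε hε1
  have hcont : Continuous fun ξ => (jb ξ ^ 2)⁻¹ * jb ξ ^ (-(s - 1)) :=
    ((continuous_jb.pow 2).inv₀ fun ξ => (pow_pos (jb_pos ξ) 2).ne').mul (continuous_jb_rpow _)
  have hle : ∀ ξ, (jb ξ ^ 2)⁻¹ * jb ξ ^ (-(s - 1)) ≤ (jb ξ ^ 2)⁻¹ := fun ξ =>
    mul_le_of_le_one_right (by positivity) (jb_rpow_le_one (by linarith) ξ)
  have h0 : ∀ ξ, 0 ≤ (jb ξ ^ 2)⁻¹ * jb ξ ^ (-(s - 1)) := fun ξ =>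
    mul_nonneg (by positivity) (jb_rpow_pos _ ξ).le
  have hθ : ∀ ξ, (jb ξ ^ 2)⁻¹ * jb ξ ^ (-(s - 1)) * Q.θ ξ ^ 2 ≤ 2 := fun ξ => by
    have h1 : 1 ≤ jb ξ ^ 2 := one_le_pow₀ (one_le_jb ξ)
    refine (mul_le_mul_of_nonneg_right (hle ξ) (sq_nonneg _)).trans ?_
    rw [inv_mul_le_iff₀ (by positivity), Q.θ_sq]
    nlinarith [Q.hε1]
  have hmult : ∀ m : ℝ → V4 →L[ℝ] V4, Continuous m → (∀ ξ, ‖m ξ‖ ≤ K * Q.θ ξ ^ 2) →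
      IsMult (fun ξ => ((jb ξ ^ 2)⁻¹ * jb ξ ^ (-(s - 1))) • m ξ) (K * 2) := fun m hm hb =>
    ⟨hcont.smul hm, fun ξ => by
      rw [norm_smul, Real.norm_of_nonneg (h0 ξ)]
      calc _ ≤ ((jb ξ ^ 2)⁻¹ * jb ξ ^ (-(s - 1))) * (K * Q.θ ξ ^ 2) :=
            mul_le_mul_of_nonneg_left (hb ξ) (h0 ξ)
        _ = K * ((jb ξ ^ 2)⁻¹ * jb ξ ^ (-(s - 1)) * Q.θ ξ ^ 2) := by ring
        _ ≤ K * 2 := mul_le_mul_of_nonneg_left (hθ ξ) Q.K_nonneg⟩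
  have hM := hmult Q.M Q.continuous_M Q.norm_M_le
  have hN := hmult Q.N Q.continuous_N Q.norm_N_le
  have h1 : IsMult (fun ξ => ((jb ξ ^ 2)⁻¹ * jb ξ ^ (-(s - 1))) • (1 : V4 →L[ℝ] V4)) 1 :=
    Model.isMult_smul_one hcont fun ξ => by
      rw [abs_of_nonneg (h0 ξ)]
      exact (hle ξ).trans (inv_le_one_of_one_le₀ (one_le_pow₀ (one_le_jb ξ)))
  set G : L2 V4 := mulOp (fun ξ => ((jb ξ ^ 2)⁻¹ * jb ξ ^ (-(s - 1))) • Q.M ξ) (Q.aOp h)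
    + mulOp (fun ξ => ((jb ξ ^ 2)⁻¹ * jb ξ ^ (-(s - 1))) • Q.N ξ) (Q.dOp f)
    + mulOp (fun ξ => ((jb ξ ^ 2)⁻¹ * jb ξ ^ (-(s - 1))) • (1 : V4 →L[ℝ] V4))
      (ε • Q.quad f h) with hG
  have hGi : MemLp (fun ξ => G ξ i) 2 := memLp_piLp_iff.1 (Lp.memLp G) i
  refine hGi.ae_eq ?_
  filter_upwards [residual_ae hc hκ hs hε hε1 hU hV hW, mulOp_ae hM (Q.aOp h),
    mulOp_ae hN (Q.dOp f), mulOp_ae h1 (ε • Q.quad f h), Lp.coeFn_smul ε (Q.quad f h),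
    Lp.coeFn_add (mulOp (fun ξ => ((jb ξ ^ 2)⁻¹ * jb ξ ^ (-(s - 1))) • Q.M ξ) (Q.aOp h)
      + mulOp (fun ξ => ((jb ξ ^ 2)⁻¹ * jb ξ ^ (-(s - 1))) • Q.N ξ) (Q.dOp f))
      (mulOp (fun ξ => ((jb ξ ^ 2)⁻¹ * jb ξ ^ (-(s - 1))) • (1 : V4 →L[ℝ] V4)) (ε • Q.quad f h)),
    Lp.coeFn_add (mulOp (fun ξ => ((jb ξ ^ 2)⁻¹ * jb ξ ^ (-(s - 1))) • Q.M ξ) (Q.aOp h))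
      (mulOp (fun ξ => ((jb ξ ^ 2)⁻¹ * jb ξ ^ (-(s - 1))) • Q.N ξ) (Q.dOp f))]
    with ξ e1 e2 e3 e4 e5 e6 e7
  rw [hG, e6, Pi.add_apply, e7, Pi.add_apply, e2, e3, e4, e5, Pi.smul_apply]
  simp only [smul_apply, one_apply_eq_self, ← smul_add]
  rw [PiLp.smul_apply, e1 i, Complex.real_smul, ← mul_assoc, ← Complex.ofReal_mul, mul_assoc,
    jb_rpow_mul]
  simp

/-- The equation in physical space is equivalent to the relation on the Fourier side. -/
lemma equation_iff (hU : Profile (epsWt ε s) U f) (hV : Profile (epsWt ε (s - 1)) V h) :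
    (∃ W, IsWeakDeriv U W ∧ Equation p γ δ ε U V W) ↔ (boussinesq hc hκ hs hε hε1).Rel f h := by
  set Q := boussinesq hc hκ hs hε hε1 with hQ
  have main : ∀ W, Profile (fun ξ => jb ξ ^ (s - 1)) W (Q.dOp f) →
      (Equation p γ δ ε U V W ↔ Q.Rel f h) := by
    intro W hW
    have ha := hU.aOp hc hκ hs hε hε1
    have hv := hV.aOp hc hκ hs hε hε1
    have iU := fun k => Profile.integrable_fourierL2 hs (by linarith) ha k
    have iV := fun k => Profile.integrable_fourierL2 hs le_rfl hv k
    have iW := fun k => Profile.integrable_fourierL2 hs le_rfl hW k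
    have hE : Equation p γ δ ε U V W ↔ ∀ φ, IsTest φ → ∀ i,
        ∫ ξ, residual p γ δ ε U V W ξ i * testHat φ ξ = 0 := by
      refine forall₃_congr fun φ hφ i => ?_
      rw [← integral_equation_eq p γ δ ε iU iV iW hφ i, Complex.ofReal_eq_zero]
    have hz : Equation p γ δ ε U V W ↔ ∀ᵐ ξ, ∀ i, residual p γ δ ε U V W ξ i = 0 := by
      rw [hE]
      constructor
      · intro h0
        exact ae_all_iff.2 fun i => ae_eq_zero_of_forall_testHat
          (memLp_residual hc hκ hs hε hε1 hU hV hW i) fun φ hφ => h0 φ hφ i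
      · intro h0 φ hφ i
        refine integral_eq_zero_of_ae ?_
        filter_upwards [h0] with ξ hξ
        rw [hξ i, zero_mul]; rfl
    rw [hz, Q.rel_iff]
    refine Filter.eventually_congr ?_
    filter_upwards [residual_ae hc hκ hs hε hε1 hU hV hW] with ξ hξ
    have hj : ((jb ξ ^ (s - 1) : ℝ) : ℂ) ≠ 0 := by exact_mod_cast (jb_rpow_pos _ _).ne'
    constructor
    · intro h0
      ext i
      refine (hξ i).trans ?_
      rw [h0 i, mul_zero]; rfl
    · intro h0 i
      have h1 := hξ i
      have h2 : (Q.M ξ (Q.aOp h ξ) + Q.N ξ (Q.dOp f ξ) + ε • Q.quad f h ξ) i = 0 :=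
        congrArg (fun x : V4 => x i) h0
      rw [h2] at h1
      exact (mul_eq_zero.1 h1.symm).resolve_left hj
  constructor
  · rintro ⟨W, hW, hE⟩
    exact (main W (hU.dOp_of_hat hc hκ hs hε hε1 (isWeakDeriv_iff.1 hW))).1 hE
  · intro hR
    -- Since `⟨ξ⟩^{s-1} i q Û` is Hermitian, it is the profile of a real state, which is the weak
    -- derivative required.
    have hrefl : reflOp conjOp (Q.dOp f) = Q.dOp f :=
      (Q.reflOp_dOp f).trans (congrArg Q.dOp (hU.reflOp (epsWt_neg ε s)))
    obtain ⟨W, hW⟩ := Profile.exists_of_reflOp (w := fun ξ => jb ξ ^ (s - 1))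
      (continuous_jb_rpow _) (fun ξ => Real.one_le_rpow (one_le_jb ξ) (by linarith))
      (fun ξ => by simp only [jb_neg]) hrefl
    exact ⟨W, isWeakDeriv_iff.2 (hU.hat_of_dOp hc hκ hs hε hε1 hW), (main W hW).2 hR⟩

end Bridge

/-! ### Solutions in physical space and the choice of the constants. -/

section Solutions

variable {p : Params} {κ K γ δ : ℝ} (hc : CoeffBound p κ K γ δ) (hκ : 0 < κ) {s : ℝ}
  (hs : 3 / 2 < s) {ε : ℝ} (hε : 0 < ε) (hε1 : ε ≤ 1)

lemma isSolution_iff {T' : ℝ} {U0 : State} {U V : ℝ → State} {f h : ℝ → L2 V4}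
    (hU : ∀ t ∈ Ico 0 T', Profile (epsWt ε s) (U t) (f t))
    (hV : ∀ t ∈ Ico 0 T', Profile (epsWt ε (s - 1)) (V t) (h t)) :
    IsSolution p γ δ ε s T' U0 U V ↔
      ContinuousOn f (Ico 0 T') ∧ ContinuousOn h (Ico 0 T') ∧
      (∀ t ∈ Ico 0 T', HasDerivWithinAt (fun τ => (boussinesq hc hκ hs hε hε1).emb (f τ)) (h t)
        (Ico 0 T') t) ∧ U 0 = U0 ∧
      ∀ t ∈ Ico 0 T', (boussinesq hc hκ hs hε hε1).Rel (f t) (h t) := by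
  have h1 := isC0_iff hε hU
  have h2 := isC0_iff hε hV
  have h3 := isTimeDeriv_iff hε (fun t ht => (hU t ht).emb hc hκ hs hε hε1) hV
  have h4 := fun t ht => equation_iff hc hκ hs hε hε1 (hU t ht) (hV t ht)
  rw [sub_add_cancel] at h2 h3
  rw [← h1, ← h2, ← h3]
  constructor
  · intro hsol
    exact ⟨hsol.cont, hsol.cont_deriv, hsol.hasDeriv, hsol.initial,
      fun t ht => (h4 t ht).1 (hsol.equation t ht)⟩
  · rintro ⟨a1, a2, a3, a4, a5⟩
    exact ⟨a1, a2, a3, a4, fun t ht => (h4 t ht).2 (a5 t ht)⟩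

/-- A bounded solution on the Fourier side yields the unique solution of the Cauchy problem. -/
lemma exists_isSolution_of_fourierSol {T' r R : ℝ} (hT' : 0 < T')
    {U0 : State} {f h : ℝ → L2 V4} (hR : (boussinesq hc hκ hs hε hε1).Small R) (hrR : r < R)
    (hsol : (boussinesq hc hκ hs hε hε1).FourierSol T' f h) (h0 : Profile (epsWt ε s) U0 (f 0))
    (hf : ∀ t ∈ Icc 0 T', ‖f t‖ ≤ r ∧ reflOp conjOp (f t) = f t ∧ reflOp conjOp (h t) = h t) :
    ∃ U V : ℝ → State, IsSolution p γ δ ε s T' U0 U V ∧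
      (∀ U' V' : ℝ → State, IsSolution p γ δ ε s T' U0 U' V' →
        ∀ t ∈ Ico 0 T', U' t = U t ∧ V' t = V t) ∧
      ∀ t ∈ Ico 0 T', Profile (epsWt ε s) (U t) (f t) ∧ Profile (epsWt ε (s - 1)) (V t) (h t) := by
  have hs0 : 0 ≤ s := by linarith
  have hs1 : 0 ≤ s - 1 := by linarith
  -- Outside the time interval the value is arbitrary; 0 is taken.
  have hexU : ∀ t, ∃ U, t ∈ Ico 0 T' → Profile (epsWt ε s) U (f t) := fun t => by
    by_cases ht : t ∈ Ico 0 T'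
    · obtain ⟨U, hU⟩ := Profile.exists_of_reflOp (continuous_epsWt ε s) (one_le_epsWt hε.le hs0)
        (epsWt_neg ε s) (hf t ⟨ht.1, ht.2.le⟩).2.1
      exact ⟨U, fun _ => hU⟩
    · exact ⟨0, fun h => absurd h ht⟩
  have hexV : ∀ t, ∃ V, t ∈ Ico 0 T' → Profile (epsWt ε (s - 1)) V (h t) := fun t => by
    by_cases ht : t ∈ Ico 0 T'
    · obtain ⟨U, hU⟩ := Profile.exists_of_reflOp (continuous_epsWt ε (s - 1))
        (one_le_epsWt hε.le hs1) (epsWt_neg ε (s - 1)) (hf t ⟨ht.1, ht.2.le⟩).2.2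
      exact ⟨U, fun _ => hU⟩
    · exact ⟨0, fun h => absurd h ht⟩
  choose U hU using hexU
  choose V hV using hexV
  have hwt : ∀ ξ, epsWt ε s ξ ≠ 0 := fun ξ => (zero_lt_one.trans_le (one_le_epsWt hε.le hs0 ξ)).ne'
  have hwt' : ∀ ξ, epsWt ε (s - 1) ξ ≠ 0 := fun ξ =>
    (zero_lt_one.trans_le (one_le_epsWt hε.le hs1 ξ)).ne'
  have hsub : Ico 0 T' ⊆ Icc 0 T' := Ico_subset_Icc_self
  have hz : (0 : ℝ) ∈ Ico 0 T' := ⟨le_rfl, hT'⟩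
  refine ⟨U, V, (isSolution_iff hc hκ hs hε hε1 hU hV).2 ⟨hsol.cont.mono hsub,
    hsol.cont_deriv.mono hsub, fun t ht => (hsol.hasDeriv t (hsub ht)).mono hsub,
    (hU 0 hz).injective hwt h0, fun t ht => hsol.rel t (hsub ht)⟩, ?_,
    fun t ht => ⟨hU t ht, hV t ht⟩⟩
  intro U' V' hsol' t ht
  have hexf : ∀ τ, ∃ g, τ ∈ Ico 0 T' → Profile (epsWt ε s) (U' τ) g := fun τ => by
    by_cases hτ : τ ∈ Ico 0 T'
    · obtain ⟨g, hg⟩ := MemHs.exists_profile hε.le (hsol'.cont τ hτ).1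
      exact ⟨g, fun _ => hg⟩
    · exact ⟨0, fun h => absurd h hτ⟩
  have hexh : ∀ τ, ∃ g, τ ∈ Ico 0 T' → Profile (epsWt ε (s - 1)) (V' τ) g := fun τ => by
    by_cases hτ : τ ∈ Ico 0 T'
    · have := (hsol'.cont_deriv τ hτ).1
      rw [← sub_add_cancel s 1] at this
      obtain ⟨g, hg⟩ := MemHs.exists_profile hε.le this
      exact ⟨g, fun _ => hg⟩
    · exact ⟨0, fun h => absurd h hτ⟩
  choose f' hf' using hexf
  choose h' hh' using hexh
  obtain ⟨a1, a2, a3, a4, a5⟩ := (isSolution_iff hc hκ hs hε hε1 hf' hh').1 hsol'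
  -- The competitor is controlled only on the half-open interval, so uniqueness is applied on `[0,
  -- t]` for each `t < T'`.
  have hsub' : Icc 0 t ⊆ Ico 0 T' := fun τ hτ => ⟨hτ.1, hτ.2.trans_lt ht.2⟩
  have hF' : (boussinesq hc hκ hs hε hε1).FourierSol t f' h' :=
    ⟨a1.mono hsub', a2.mono hsub', fun τ hτ => (a3 τ (hsub' hτ)).mono hsub',
      fun τ hτ => a5 τ (hsub' hτ)⟩
  have h00 : f' 0 = f 0 := by
    have := hf' 0 hz
    rw [a4] at this
    exact this.unique h0
  obtain ⟨e1, e2⟩ := Model.FourierSol.unique _ hR hrR (hsol.mono _ ht.2.le)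
    (fun τ hτ => (hf τ (hsub (hsub' hτ))).1) hF' h00 t ⟨ht.1, le_rfl⟩
  have hU't := hf' t ht
  have hV't := hh' t ht
  rw [e1] at hU't
  rw [e2] at hV't
  exact ⟨hU't.injective hwt (hU t ht), hV't.injective hwt' (hV t ht)⟩

lemma epsNorm_mono {ε ε' : ℝ} (h : ε ≤ ε') (r : ℝ) (U : State) :
    epsNorm ε r U ≤ epsNorm ε' r U := by
  unfold epsNorm
  gcongr

/-- The constants of the energy method depend on `κ`, `K` and `s` only. -/
lemma exists_constants (κ K s : ℝ) : ∃ ρ rate amp Λ : ℝ, 0 < ρ ∧ 0 ≤ rate ∧ 1 ≤ amp ∧ 0 ≤ Λ ∧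
    ∀ Q : Model V4 κ K s, Q.ρ = ρ ∧ Q.rate = rate ∧ Q.amp = amp ∧ Q.Λ = Λ := by
  by_cases hne : Nonempty (Model V4 κ K s)
  · obtain ⟨Q⟩ := hne
    exact ⟨Q.ρ, Q.rate, Q.amp, Q.Λ, Q.ρ_pos, Q.rate_nonneg, Q.one_le_amp, Q.Λ_nonneg,
      fun Q' => ⟨rfl, rfl, rfl, rfl⟩⟩
  -- Without any model for these `κ`, `K`, `s` the last condition is void and admissible values are
  -- chosen at will.
  · exact ⟨1, 0, 1, 0, one_pos, le_rfl, le_rfl, le_rfl, fun Q => absurd ⟨Q⟩ hne⟩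

/-- Existence, uniqueness and bounds on `[0, T/ε)`. -/
lemma exists_unique_isSolution {U0 : State} {f₀ : L2 V4} (h0 : Profile (epsWt ε s) U0 f₀)
    {R T : ℝ} (hT : 0 < T) (hR : (boussinesq hc hκ hs hε hε1).amp * ‖f₀‖ < R)
    (hRρ : ε * R ≤ (boussinesq hc hκ hs hε hε1).ρ)
    (hRT : R * (boussinesq hc hκ hs hε hε1).rate * T ≤ 1) :
    ∃ U V : ℝ → State, IsSolution p γ δ ε s (T / ε) U0 U V ∧
      (∀ U' V' : ℝ → State, IsSolution p γ δ ε s (T / ε) U0 U' V' →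
        ∀ t ∈ Ico 0 (T / ε), U' t = U t ∧ V' t = V t) ∧
      ∀ t ∈ Ico 0 (T / ε),
        epsNorm ε (s + 1) (U t)
          ≤ ENNReal.ofReal ((boussinesq hc hκ hs hε hε1).amp * ‖f₀‖) ∧
        epsNorm ε s (V t) ≤ ENNReal.ofReal ((2 * (boussinesq hc hκ hs hε hε1).Λ + 1)
          * ((boussinesq hc hκ hs hε hε1).amp * ‖f₀‖)) := by
  set Q := boussinesq hc hκ hs hε hε1
  have hamp := Q.one_le_amp
  have hR0 : 0 ≤ R := (mul_nonneg (by linarith) (norm_nonneg _)).trans hR.le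
  have hsm := Q.small_of_le_ρ hR0 hRρ
  obtain ⟨f, h, hsol, hf0, hf⟩ := Q.exists_fourierSol (h0.reflOp (epsWt_neg ε s)) hT hR hRρ hRT
  obtain ⟨U, V, hUV, huniq, hprof⟩ := exists_isSolution_of_fourierSol hc hκ hs hε hε1
    (div_pos hT hε) hsm hR hsol (by rw [hf0]; exact h0) hf
  refine ⟨U, V, hUV, huniq, fun t ht => ?_⟩
  have hft := (hf t ⟨ht.1, ht.2.le⟩).1
  have hht := Q.norm_le_of_rel (hsm.mono Q (hft.trans hR.le)) (hsol.rel t ⟨ht.1, ht.2.le⟩)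
  have hV := (hprof t ht).2.epsNorm_eq hε.le
  rw [sub_add_cancel] at hV
  rw [(hprof t ht).1.epsNorm_eq hε.le, hV, ← ofReal_norm, ← ofReal_norm]
  have := Q.Λ_nonneg
  exact ⟨ENNReal.ofReal_le_ofReal hft,
    ENNReal.ofReal_le_ofReal (hht.trans (mul_le_mul_of_nonneg_left hft (by positivity)))⟩

lemma supNorm_add_supNorm_le {ε r r' a b : ℝ} {I : Set ℝ} {U V : ℝ → State} (ha : 0 ≤ a)
    (hb : 0 ≤ b) (h : ∀ t ∈ I, epsNorm ε r (U t) ≤ ENNReal.ofReal a ∧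
      epsNorm ε r' (V t) ≤ ENNReal.ofReal b) :
    supNorm ε r I U + supNorm ε r' I V ≤ ENNReal.ofReal (a + b) := by
  rw [ENNReal.ofReal_add ha hb]
  exact add_le_add (iSup₂_le fun t ht => (h t ht).1) (iSup₂_le fun t ht => (h t ht).2)

/-- Turns a bound uniform in time into the weaker bound with the denominator of the statement. -/
lemma le_div_one_sub {x y z : ℝ} (hy : 0 ≤ y) (hxy : x ≤ y) (hz0 : 0 ≤ z) (hz : z < 1) :
    x ≤ y / (1 - z) := by
  rw [le_div_iff₀ (by linarith)]
  nlinarith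

/-- The radius `R = amp n + ρ / 2` exceeds the a priori bound strictly. The smallness of the datum
gives `ε amp n ≤ ρ / 2`, and `ε ≤ 1` takes care of the other half. -/
lemma mul_add_half_le {ε ρ amp c n : ℝ} (hε : 0 ≤ ε) (hε1 : ε ≤ 1) (hρ : 0 < ρ) (hn : 0 ≤ n)
    (hc : 2 * amp / ρ ≤ c) (h : ε * (c * n) ≤ 1) : ε * (amp * n + ρ / 2) ≤ ρ := by
  have h1 : ε * (2 * amp / ρ * n) ≤ 1 :=
    (mul_le_mul_of_nonneg_left (mul_le_mul_of_nonneg_right hc hn) hε).trans h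
  have h2 : ε * (amp * n) = ε * (2 * amp / ρ * n) * (ρ / 2) := by field_simp
  have h3 : ε * (2 * amp / ρ * n) * (ρ / 2) ≤ 1 * (ρ / 2) := by gcongr
  have h4 : ε * (ρ / 2) ≤ 1 * (ρ / 2) := by gcongr
  rw [mul_add, h2]
  linarith

/-- The existence time depends on an upper bound of the norm of the datum only. -/
lemma exists_time {rate amp ρ c m : ℝ} (hrate : 0 ≤ rate) (hamp : 0 ≤ amp) (hρ : 0 < ρ)
    (hc : 0 < c) (hm : 0 ≤ m) : ∃ T > 0, ∀ n, 0 ≤ n → n ≤ m →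
      c * n * T < 1 ∧ (amp * n + ρ / 2) * rate * T ≤ 1 := by
  -- The first entry keeps the Grönwall exponent at most 1, the second keeps the denominator of the
  -- final bound positive.
  refine ⟨min (1 / (rate * (amp * m + ρ / 2) + 1)) (1 / (2 * c * (m + 1))),
    lt_min (by positivity) (by positivity), fun n hn hnm => ⟨?_, ?_⟩⟩
  · calc _ ≤ c * m * (1 / (2 * c * (m + 1))) := by
          gcongr
          exact min_le_right _ _
      _ = m / (2 * (m + 1)) := by field_simp
      _ < 1 := by rw [div_lt_one (by positivity)]; linarith
  · calc _ ≤ (amp * m + ρ / 2) * rate * (1 / (rate * (amp * m + ρ / 2) + 1)) := by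
          gcongr
          exact min_le_left _ _
      _ ≤ 1 := by
          rw [mul_one_div, div_le_one (by positivity)]
          linarith

end Solutions

end SymBoussinesq

end

theorem proposition2p3 (p : Params) (γmin γmax δmin δmax : ℝ)
    (hγmin : 0 < γmin) (hγmax : γmax < 1) (hδmin : 0 < δmin)
    (hS2 : ∀ γ ∈ Set.Icc γmin γmax, ∀ δ ∈ Set.Icc δmin δmax, (S2 p γ δ).PosDef)
    (s : ℝ) (hs : 3 / 2 < s) :
    ∃ C : ℝ → ℝ → ℝ, (∀ x y, 0 < C x y) ∧
      (∀ x x' y y', x ≤ x' → y ≤ y' → C x y ≤ C x' y') ∧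
      ∀ γ ∈ Set.Icc γmin γmax, ∀ δ ∈ Set.Icc δmin δmax, ∀ C₀ : ℝ,
        C₀ = C (1 / (γ * (1 - γ))) (δ + 1 / δ) →
        ∀ U0 : State, MemHs (s + 1) U0 →
          ∃ T : ℝ, 0 < T ∧ ∀ ε : ℝ, 0 < ε → ε ≤ 1 →
            ∀ N : ℝ, N = (epsNorm ε (s + 1) U0).toReal → ε * (C₀ * N) ≤ 1 →
              C₀ * N * T < 1 ∧
              ∃ U V : ℝ → State,
                IsSolution p γ δ ε s (T / ε) U0 U V ∧
                (∀ U' V' : ℝ → State, IsSolution p γ δ ε s (T / ε) U0 U' V' →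
                  ∀ t ∈ Set.Ico 0 (T / ε), U' t = U t ∧ V' t = V t) ∧
                ∀ t ∈ Set.Icc 0 (T / ε),
                  supNorm ε (s + 1) (Set.Icc 0 t ∩ Set.Ico 0 (T / ε)) U
                    + supNorm ε s (Set.Icc 0 t ∩ Set.Ico 0 (T / ε)) V
                    ≤ ENNReal.ofReal (C₀ * N / (1 - C₀ * N * ε * t)) := by
  obtain ⟨κ, K, hκ, hK, hcoeff⟩ := exists_coeffBound p hγmin hγmax hδmin hS2
  obtain ⟨ρ, rate, amp, Λ, hρ, hrate, hamp, hΛ, hconst⟩ := exists_constants κ K s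
  have hamp0 : 0 < amp := by linarith
  -- The first summand covers the sum `amp + (2Λ + 1) amp` of the bounds for `U` and `∂ₜU`; the
  -- second makes the hypothesis on `ε` imply that the radius of the ball is admissible.
  set c₀ : ℝ := (2 * Λ + 2) * amp + 2 * amp / ρ with hc₀
  have hc₀pos : 0 < c₀ := by positivity
  have hc₀1 : (2 * Λ + 2) * amp ≤ c₀ := by
    rw [hc₀]; linarith [show 0 < 2 * amp / ρ by positivity]
  have hc₀2 : 2 * amp / ρ ≤ c₀ := by
    rw [hc₀]; linarith [show 0 < (2 * Λ + 2) * amp by positivity]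
  -- The dependence on `γ` and `δ` is already contained in the uniform `κ` and `K`, so a constant
  -- function will do.
  refine ⟨fun _ _ => c₀, fun _ _ => hc₀pos, fun _ _ _ _ _ _ => le_rfl, ?_⟩
  rintro γ hγ δ hδ C₀ rfl U0 hU0
  have hc := hcoeff γ hγ δ hδ
  -- The norm for `ε = 1` dominates those for all `ε ≤ 1`; fixing `T` by it makes `T` independent of
  -- `ε`.
  obtain ⟨f₁, hf₁⟩ := MemHs.exists_profile zero_le_one hU0
  have hN1 := hf₁.epsNorm_eq zero_le_one
  have hn : 0 ≤ ‖f₁‖ := norm_nonneg _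
  obtain ⟨T, hTpos, hT⟩ := exists_time hrate hamp0.le hρ hc₀pos hn
  refine ⟨T, hTpos, fun ε hε hε1 N hN hsmall => ?_⟩
  obtain ⟨f₀, hf₀⟩ := MemHs.exists_profile hε.le hU0
  have hNf : N = ‖f₀‖ := by rw [hN, hf₀.epsNorm_eq hε.le, toReal_enorm]
  have hNle : ‖f₀‖ ≤ ‖f₁‖ := by
    have := epsNorm_mono hε1 (s + 1) U0
    rw [hN1, hf₀.epsNorm_eq hε.le, ← ofReal_norm, ← ofReal_norm] at this
    exact (ENNReal.ofReal_le_ofReal_iff hn).1 this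
  have hN0 : 0 ≤ ‖f₀‖ := norm_nonneg _
  rw [hNf] at hsmall ⊢
  simp only at hsmall ⊢
  obtain ⟨hCNT, hRT⟩ := hT ‖f₀‖ hN0 hNle
  refine ⟨hCNT, ?_⟩
  obtain ⟨e1, e2, e3, e4⟩ := hconst (boussinesq hc hκ hs hε hε1)
  obtain ⟨U, V, hsol, huniq, hbound⟩ := exists_unique_isSolution hc hκ hs hε hε1 hf₀ hTpos
    (R := amp * ‖f₀‖ + ρ / 2) (by rw [e3]; linarith)
    (by rw [e1]; exact mul_add_half_le hε.le hε1 hρ hN0 hc₀2 hsmall) (by rw [e2]; exact hRT)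
  refine ⟨U, V, hsol, huniq, fun t ht => ?_⟩
  rw [e3, e4] at hbound
  refine (supNorm_add_supNorm_le (by positivity) (by positivity)
    fun τ hτ => hbound τ hτ.2).trans (ENNReal.ofReal_le_ofReal ?_)
  have hεt : ε * t ≤ T := by
    rw [mul_comm]; exact (le_div_iff₀ hε).1 ht.2
  have ht0 := ht.1
  refine le_div_one_sub (by positivity) ?_ (by positivity) ?_
  · calc _ = (2 * Λ + 2) * amp * ‖f₀‖ := by ring
      _ ≤ c₀ * ‖f₀‖ := mul_le_mul_of_nonneg_right hc₀1 hN0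
  · rw [mul_assoc (c₀ * ‖f₀‖)]
    exact (mul_le_mul_of_nonneg_left hεt (by positivity)).trans_lt hCNT
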